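/- **Setup.** Let $G$ be a simple, simply connected linear algebraic group over $\mathbb C$ with maximal torus $T$, character lattice $T^*$, roots $\Phi$, simple roots $\alpha_1,\dots,\alpha_n$, highest root $\theta$, coroot lattice $Q^\vee$, Weyl group $W$ and affine Weyl group $W_a=Q^\vee\rtimes W$ with translations $t_\lambda$ $(\lambda\in Q^\vee)$ and $s_0=t_{\theta^\vee}s_\theta$. Let $R$ be an integral domain of characteristic $0$. Let one of the following be given. (i) A one-dimensional commutative formal group law $F$ over $R$, with $S=R[[x_\mu\mid\mu\in T^*]]/\mathcal J_F$ the formal group algebra, $\mathcal J_F$ being the closure of the ideal generated by $x_0$ and all $x_{\mu+\nu}-F(x_\mu,x_\nu)$; a basis $\mu_1,\dots,\mu_n$ of $T^*$ identifies $S$ with $R[[x_{\mu_1},\dots,x_{\mu_n}]]$. (ii) An element $\mathfrak c\in R$ and the connective formal group law $F(x,y)=x+y-\mathfrak c xy$, with the polynomial version $S=R[x_\mu\mid\mu\in T^*]/(x_0,\ x_{\mu+\nu}-F(x_\mu,x_\nu))$. Let $W_a$ act on $S$ by $t_\lambda w(x_\mu)=x_{w(\mu)}$ and put $\mathcal Q=S[\tfrac1{x_\alpha},\alpha\in\Phi]$.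 Let $\mathcal Q_{W_a}=\mathcal Q\rtimes R[W_a]$ be the twisted group algebra, with left $\mathcal Q$-basis $\eta_w$ $(w\in W_a)$ and product $p\eta_v\cdot q\eta_w=p\,v(q)\,\eta_{vw}$, and let $\mathcal Q_{Q^\vee}=\mathcal Q\rtimes R[Q^\vee]$. As $Q^\vee$ acts trivially on $\mathcal Q$, the latter is the group algebra of $Q^\vee$ over $\mathcal Q$; it is a Hopf algebra over $\mathcal Q$ with coproduct $\eta_{t_\lambda}\mapsto\eta_{t_\lambda}\otimes\eta_{t_\lambda}$, counit $\eta_{t_\lambda}\mapsto1$ and antipode $\eta_{t_\lambda}\mapsto\eta_{t_{-\lambda}}$. Let $\mathbf D_{W_a}\subset\mathcal Q_{W_a}$ be the subalgebra generated by $S$, by $X_i=\frac1{x_{\alpha_i}}(1-\eta_{s_i})$ for $1\le i\le n$, and by $X_0=\frac1{x_{-\theta}}(1-\eta_{s_0})$. Let $\mathrm{pr}:\mathcal Q_{W_a}\to\mathcal Q_{Q^\vee}$, $p\,\eta_{t_\lambda w}\mapsto p\,\eta_{t_\lambda}$ $(w\in W)$, and $k:\mathcal Q_{Q^\vee}\to\mathcal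 Q_{W_a}$, $p\,\eta_{t_\lambda}\mapsto p\,\eta_{t_\lambda}$. The Peterson subalgebra is $\mathbf D_{Q^\vee}=k(\mathrm{pr}(\mathbf D_{W_a}))\subset\mathcal Q_{W_a}$. **Theorem.** $\mathbf D_{Q^\vee}$ is a subring of $\mathcal Q_{W_a}$ containing $S$ in its centre, and it is a Hopf algebra over $S$. Its structure is induced by that of $\mathcal Q_{Q^\vee}$: with $j:\mathbf D_{Q^\vee}\to\mathcal Q_{Q^\vee}$ the embedding inverse to $k$, the map $j\otimes j:\mathbf D_{Q^\vee}\otimes_S\mathbf D_{Q^\vee}\to\mathcal Q_{Q^\vee}\otimes_{\mathcal Q}\mathcal Q_{Q^\vee}$ is injective and $j$ is a homomorphism of Hopf algebras (it is an $S$-algebra homomorphism that commutes with coproducts, counits and antipodes). In particular $\eta_{t_\lambda}\in\mathbf D_{Q^\vee}$ for all $\lambda\in Q^\vee$, with coproduct $\eta_{t_\lambda}\otimes\eta_{t_\lambda}$, counit $1$ and antipode $\eta_{t_{-\lambda}}$. -/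

import Mathlib

noncomputable section

namespace Peterson

section FormalInverse

variable {R : Type*} [CommRing R] (F : FormalGroup R)

theorem hasSubst_X_pair {c : PowerSeries R} (hc : PowerSeries.constantCoeff c = 0) :
    MvPowerSeries.HasSubst (S := R) ![(PowerSeries.X : PowerSeries R), c] := by
  refine MvPowerSeries.hasSubst_of_constantCoeff_zero fun s => ?_
  fin_cases s
  · exact PowerSeries.constantCoeff_X
  · exact hc

/-- The coefficient of degree `m` of `F(X, a) - a` only depends on the coefficients of `a` of
degree less than `m`. -/
theorem coeff_subst_sub_congr {a b : PowerSeries R} (ha : PowerSeries.constantCoeff a = 0)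
    (hb : PowerSeries.constantCoeff b = 0) (m : ℕ)
    (hab : ∀ k < m, PowerSeries.coeff k a = PowerSeries.coeff k b) :
    PowerSeries.coeff m ((F.toPowerSeries.subst ![PowerSeries.X, a] : PowerSeries R) - a) =
      PowerSeries.coeff m ((F.toPowerSeries.subst ![PowerSeries.X, b] : PowerSeries R) - b) := by
  have key : ∀ c : PowerSeries R, PowerSeries.constantCoeff c = 0 →
      (F.toPowerSeries.subst ![PowerSeries.X, c] : PowerSeries R) - c =
        (F.toPowerSeries - MvPowerSeries.X 1).subst ![PowerSeries.X, c] := by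
    intro c hc
    rw [MvPowerSeries.subst_sub (hasSubst_X_pair hc), MvPowerSeries.subst_X (hasSubst_X_pair hc)]
    rfl
  rw [key a ha, key b hb, PowerSeries.coeff, MvPowerSeries.coeff_subst (hasSubst_X_pair ha),
    MvPowerSeries.coeff_subst (hasSubst_X_pair hb)]
  refine finsum_congr fun d => ?_
  rw [Finsupp.prod_fintype _ _ (by simp), Finsupp.prod_fintype _ _ (by simp)]
  simp only [Fin.prod_univ_two]
  have hX : (PowerSeries.X : PowerSeries R) ^ m ∣ a - b :=
    PowerSeries.X_pow_dvd_iff.2 fun k hk => by rw [map_sub, hab k hk, sub_self]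
  have hpow : ∀ j : ℕ, a - b ∣ a ^ j - b ^ j := fun j => sub_dvd_pow_sub_pow a b j
  by_cases hd : d = Finsupp.single 1 1
  · rw [hd, map_sub, F.lin_coeff_Y]
    simp [MvPowerSeries.X]
  · congr 1
    have hdvd : (PowerSeries.X : PowerSeries R) ^ (m + 1) ∣
        PowerSeries.X ^ d 0 * a ^ d 1 - PowerSeries.X ^ d 0 * b ^ d 1 := by
      rw [← mul_sub]
      by_cases h0 : d 0 = 0
      · obtain h1 | h1 | h1 : d 1 = 0 ∨ d 1 = 1 ∨ 2 ≤ d 1 := by omega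
        · simp [h1]
        · exact absurd (by ext s; fin_cases s <;> simp [h0, h1]) hd
        · rw [h0, pow_zero, one_mul, pow_succ, ← Commute.mul_geom_sum₂ (Commute.all a b)]
          refine mul_dvd_mul hX (Finset.dvd_sum fun k hk => ?_)
          rw [Finset.mem_range] at hk
          rcases Nat.eq_zero_or_pos k with rfl | hk0
          · exact Dvd.dvd.mul_left
              (dvd_pow (PowerSeries.X_dvd_iff.2 hb) (by omega)) _
          · exact Dvd.dvd.mul_right (dvd_pow (PowerSeries.X_dvd_iff.2 ha) (by omega)) _
      · rw [pow_succ']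
        exact mul_dvd_mul (dvd_pow_self _ h0) (hX.trans (hpow _))
    have := PowerSeries.X_pow_dvd_iff.1 hdvd m (Nat.lt_succ_self m)
    rw [map_sub, sub_eq_zero] at this
    exact this

/-- Successive approximations of the formal inverse. -/
def formalInverseApprox : ℕ → PowerSeries R
  | 0 => 0
  | n + 1 => formalInverseApprox n -
      (F.toPowerSeries.subst ![PowerSeries.X, formalInverseApprox n] : PowerSeries R)

theorem constantCoeff_subst_X_pair {c : PowerSeries R} (hc : PowerSeries.constantCoeff c = 0) :
    PowerSeries.constantCoeff
      (F.toPowerSeries.subst ![PowerSeries.X, c] : PowerSeries R) = 0 := by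
  refine MvPowerSeries.constantCoeff_subst_eq_zero (hasSubst_X_pair hc) (fun s => ?_)
    F.zero_constantCoeff
  fin_cases s
  · exact PowerSeries.constantCoeff_X
  · exact hc

theorem constantCoeff_formalInverseApprox (n : ℕ) :
    PowerSeries.constantCoeff (formalInverseApprox F n) = 0 := by
  induction n with
  | zero => simp [formalInverseApprox]
  | succ n ih => rw [formalInverseApprox, map_sub, ih, constantCoeff_subst_X_pair F ih, sub_zero]

theorem coeff_subst_formalInverseApprox (n : ℕ) : ∀ m < n + 1, PowerSeries.coeff m
    (F.toPowerSeries.subst ![PowerSeries.X, formalInverseApprox F n] : PowerSeries R) = 0 := by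
  induction n with
  | zero =>
    intro m hm
    obtain rfl : m = 0 := by omega
    rw [PowerSeries.coeff_zero_eq_constantCoeff_apply]
    exact constantCoeff_subst_X_pair F (constantCoeff_formalInverseApprox F 0)
  | succ n ih =>
    intro m hm
    have h := coeff_subst_sub_congr F (constantCoeff_formalInverseApprox F (n + 1))
      (constantCoeff_formalInverseApprox F n) m (fun k hk => by
        rw [formalInverseApprox, map_sub, ih k (by omega), sub_zero])
    rw [map_sub, map_sub] at h
    nth_rewrite 2 [formalInverseApprox] at h
    rw [map_sub] at h
    linear_combination h

/-- The formal inverse `i(X)` of a formal group law, characterised by `F(X, i(X)) = 0`. -/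
def formalInverse : PowerSeries R :=
  PowerSeries.mk fun n => PowerSeries.coeff n (formalInverseApprox F n)

theorem coeff_formalInverse (m n : ℕ) (h : m ≤ n) :
    PowerSeries.coeff m (formalInverse F) = PowerSeries.coeff m (formalInverseApprox F n) := by
  induction n, h using Nat.le_induction with
  | base => rw [formalInverse, PowerSeries.coeff_mk]
  | succ n hn ih =>
    rw [ih, formalInverseApprox, map_sub, coeff_subst_formalInverseApprox F n m (by omega),
      sub_zero]

theorem constantCoeff_formalInverse : PowerSeries.constantCoeff (formalInverse F) = 0 := by
  rw [← PowerSeries.coeff_zero_eq_constantCoeff_apply, coeff_formalInverse F 0 0 le_rfl,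
    PowerSeries.coeff_zero_eq_constantCoeff_apply, constantCoeff_formalInverseApprox]

theorem subst_X_formalInverse :
    (F.toPowerSeries.subst ![PowerSeries.X, formalInverse F] : PowerSeries R) = 0 := by
  ext m
  have h := coeff_subst_sub_congr F (constantCoeff_formalInverse F)
    (constantCoeff_formalInverseApprox F m) m (fun k hk => coeff_formalInverse F k m hk.le)
  rw [map_sub, map_sub, coeff_formalInverse F m m le_rfl,
    coeff_subst_formalInverseApprox F m m (by omega)] at h
  rw [map_zero]
  linear_combination h

theorem hasSubst_formalInverse {κ : Type*} {f : MvPowerSeries κ R} (hf : PowerSeries.HasSubst f) :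
    PowerSeries.HasSubst (PowerSeries.subst f (formalInverse F)) :=
  MvPowerSeries.IsNilpotent_subst hf.const (by
    have := constantCoeff_formalInverse F
    rw [PowerSeries.constantCoeff] at this
    rw [this]
    exact IsNilpotent.zero)

theorem subst_formalInverse {κ : Type*} {f : MvPowerSeries κ R} (hf : PowerSeries.HasSubst f) :
    F.toPowerSeries.subst ![f, PowerSeries.subst f (formalInverse F)] = 0 := by
  have h := congrArg (PowerSeries.subst f) (subst_X_formalInverse F)
  rw [PowerSeries.subst, MvPowerSeries.subst_comp_subst_apply
    (hasSubst_X_pair (constantCoeff_formalInverse F)) hf.const] at h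
  have h0 : PowerSeries.subst f (0 : PowerSeries R) = 0 := by
    rw [← PowerSeries.coe_substAlgHom hf, map_zero]
  rw [h0] at h
  rw [← h]
  congr 1
  funext s
  fin_cases s
  · exact (PowerSeries.subst_X hf).symm
  · rfl

/-- The power series underlying a point of `F`. -/
def pointVal {κ : Type*} (p : F.Point κ) : MvPowerSeries κ R := Subtype.val p

/-- The point of `F` given by a power series with nilpotent constant coefficient. -/
def pointMk {κ : Type*} (f : MvPowerSeries κ R) (hf : PowerSeries.HasSubst f) : F.Point κ :=
  Subtype.mk f hf

theorem pointVal_pointMk {κ : Type*} (f : MvPowerSeries κ R) (hf : PowerSeries.HasSubst f) :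
    pointVal F (pointMk F f hf) = f := rfl

theorem hasSubst_pointVal {κ : Type*} (p : F.Point κ) : PowerSeries.HasSubst (pointVal F p) :=
  Subtype.prop p

theorem point_ext {κ : Type*} {p q : F.Point κ} (h : pointVal F p = pointVal F q) : p = q :=
  Subtype.ext h

theorem pointVal_zero {κ : Type*} : pointVal F (0 : F.Point κ) = 0 := rfl

theorem pointVal_add {κ : Type*} (p q : F.Point κ) :
    pointVal F (p + q) = F.toPowerSeries.subst ![pointVal F p, pointVal F q] := rfl

instance (κ : Type*) : Neg (F.Point κ) where
  neg p := pointMk F (PowerSeries.subst (pointVal F p) (formalInverse F))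
    (hasSubst_formalInverse F (hasSubst_pointVal F p))

/-- The points of a commutative formal group law form an abelian group. -/
instance [F.IsComm] (κ : Type*) : AddCommGroup (F.Point κ) where
  __ := (inferInstance : AddCommMonoid (F.Point κ))
  __ := (inferInstance : Neg (F.Point κ))
  zsmul := zsmulRec
  neg_add_cancel p := by
    rw [add_comm]
    exact point_ext F (subst_formalInverse F (hasSubst_pointVal F p))

end FormalInverse

section FormalGroupAlgebra

variable {R : Type*} [CommRing R] {M : Type*} [AddCommGroup M] {κ : Type*}
variable (F : FormalGroup R) [F.IsComm] (B : Module.Basis κ ℤ M)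

/-- The additive map `μ ↦ x_μ` from `M` to the points of `F`, that is
`x_{∑ mᵢ Bᵢ} = ∑_F [mᵢ]_F x_{Bᵢ}`. -/
def point : M →+ F.Point κ :=
  ((B.constr ℤ) fun i : κ =>
    pointMk F (MvPowerSeries.X i) (PowerSeries.HasSubst.X i)).toAddMonoidHom

/-- The power series `x_μ`, in the variables `x_{B i}`. -/
def xSeries (μ : M) : MvPowerSeries κ R := pointVal F (point F B μ)

theorem xSeries_basis (i : κ) : xSeries F B (B i) = MvPowerSeries.X i := by
  have : point F B (B i) = pointMk F (MvPowerSeries.X i) (PowerSeries.HasSubst.X i) :=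
    B.constr_basis ℤ _ i
  rw [xSeries, this, pointVal_pointMk]

theorem xSeries_zero : xSeries F B 0 = 0 := by
  rw [xSeries, map_zero, pointVal_zero]

theorem xSeries_add (μ ν : M) :
    xSeries F B (μ + ν) = F.toPowerSeries.subst ![xSeries F B μ, xSeries F B ν] := by
  rw [xSeries, map_add, pointVal_add]; rfl

section Substitution

variable [Finite κ]

theorem hasSubst_xSeries (f : κ → M) : MvPowerSeries.HasSubst fun i => xSeries F B (f i) :=
  MvPowerSeries.hasSubst_of_constantCoeff_nilpotent fun i => hasSubst_pointVal F (point F B (f i))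

/-- The substitution endomorphism `x_{B i} ↦ x_{f i}` of the power series ring. -/
def substHom (f : κ → M) : MvPowerSeries κ R →ₐ[R] MvPowerSeries κ R :=
  MvPowerSeries.substAlgHom (hasSubst_xSeries F B f)

theorem substHom_apply (f : κ → M) (z : MvPowerSeries κ R) :
    substHom F B f z = MvPowerSeries.subst (fun i => xSeries F B (f i)) z :=
  MvPowerSeries.substAlgHom_apply _ _

/-- A substitution endomorphism is additive on points. -/
def pointHom (f : κ → M) : F.Point κ →+ F.Point κ where
  toFun p := pointMk F (substHom F B f (pointVal F p)) (by
    rw [substHom_apply]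
    exact MvPowerSeries.IsNilpotent_subst (hasSubst_xSeries F B f) (hasSubst_pointVal F p))
  map_zero' := point_ext F (by rw [pointVal_pointMk, pointVal_zero, map_zero])
  map_add' p q := by
    apply point_ext
    rw [pointVal_pointMk, pointVal_add F p q, pointVal_add, pointVal_pointMk, pointVal_pointMk]
    have h : MvPowerSeries.HasSubst ![pointVal F p, pointVal F q] :=
      MvPowerSeries.hasSubst_of_constantCoeff_nilpotent fun s => by
        fin_cases s
        · exact hasSubst_pointVal F p
        · exact hasSubst_pointVal F q
    rw [substHom_apply, substHom_apply, substHom_apply,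
      MvPowerSeries.subst_comp_subst_apply h (hasSubst_xSeries F B f)]
    congr 1
    funext s
    fin_cases s <;> rfl

theorem substHom_xSeries (g : M →+ M) (μ : M) :
    substHom F B (fun i => g (B i)) (xSeries F B μ) = xSeries F B (g μ) := by
  have h : ((pointHom F B fun i => g (B i)).comp (point F B)).toIntLinearMap =
      ((point F B).comp g).toIntLinearMap := by
    refine B.ext fun i => point_ext F ?_
    change substHom F B (fun i => g (B i)) (xSeries F B (B i)) = xSeries F B (g (B i))
    rw [xSeries_basis, substHom_apply]
    exact MvPowerSeries.subst_X (hasSubst_xSeries F B _) i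
  exact congrArg (pointVal F) (DFunLike.congr_fun h μ)

theorem substHom_one_smul {G : Type*} [Group G] [DistribMulAction G M] (z : MvPowerSeries κ R) :
    substHom F B (fun i => (1 : G) • B i) z = z := by
  rw [substHom_apply]
  simp only [one_smul, xSeries_basis]
  exact congrFun MvPowerSeries.subst_self z

theorem substHom_mul_smul {G : Type*} [Group G] [DistribMulAction G M] (g h : G)
    (z : MvPowerSeries κ R) :
    substHom F B (fun i => (g * h) • B i) z =
      substHom F B (fun i => g • B i) (substHom F B (fun i => h • B i) z) := by
  rw [substHom_apply, substHom_apply F B (fun i => h • B i), substHom_apply,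
    MvPowerSeries.subst_comp_subst_apply (hasSubst_xSeries F B _) (hasSubst_xSeries F B _)]
  congr 1
  funext i
  rw [← substHom_apply, mul_smul]
  exact (substHom_xSeries F B (DistribSMul.toAddMonoidHom M g) (h • B i)).symm

end Substitution

/-- The formal group algebra `R⟦x_μ | μ ∈ M⟧ / 𝒥_F` of the lattice `M`, where `𝒥_F` is the closure
of the ideal generated by `x_0` and `x_{μ+ν} - F(x_μ, x_ν)`. A basis `B` of `M` identifies it with
the power series ring over `R` in the variables `x_{B i}`, and this is how it is defined here. The
elements `x_μ` for all `μ ∈ M` are `FormalGroupAlgebra.x`; they satisfy the defining relations, by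
`FormalGroupAlgebra.x_zero` and `FormalGroupAlgebra.x_add`. -/
def FormalGroupAlgebra (_F : FormalGroup R) (_B : Module.Basis κ ℤ M) : Type _ :=
  MvPowerSeries κ R

namespace FormalGroupAlgebra

instance (F : FormalGroup R) (B : Module.Basis κ ℤ M) : CommRing (FormalGroupAlgebra F B) :=
  inferInstanceAs (CommRing (MvPowerSeries κ R))

/-- The identification of the formal group algebra with a power series ring. -/
def equivPowerSeries (F : FormalGroup R) (B : Module.Basis κ ℤ M) :
    FormalGroupAlgebra F B ≃+* MvPowerSeries κ R :=
  RingEquiv.refl _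

/-- A group acting additively on `M` acts on the formal group algebra by `g • x_μ = x_{g • μ}`. -/
instance [Finite κ] {G : Type*} [Group G] [DistribMulAction G M] :
    MulSemiringAction G (FormalGroupAlgebra F B) where
  smul g z := (equivPowerSeries F B).symm
    (substHom F B (fun i => g • B i) (equivPowerSeries F B z))
  one_smul z := substHom_one_smul F B z
  mul_smul g h z := substHom_mul_smul F B g h z
  smul_zero g := map_zero (substHom F B fun i => g • B i)
  smul_add g := map_add (substHom F B fun i => g • B i)
  smul_one g := map_one (substHom F B fun i => g • B i)
  smul_mul g := map_mul (substHom F B fun i => g • B i)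

/-- The element `x_μ` of the formal group algebra. -/
def x (μ : M) : FormalGroupAlgebra F B := (equivPowerSeries F B).symm (xSeries F B μ)

theorem x_basis (i : κ) : equivPowerSeries F B (x F B (B i)) = MvPowerSeries.X i :=
  xSeries_basis F B i

theorem x_zero : x F B 0 = 0 := xSeries_zero F B

theorem x_add (μ ν : M) : equivPowerSeries F B (x F B (μ + ν)) =
    F.toPowerSeries.subst
      ![equivPowerSeries F B (x F B μ), equivPowerSeries F B (x F B ν)] :=
  xSeries_add F B μ ν

theorem smul_x [Finite κ] {G : Type*} [Group G] [DistribMulAction G M] (g : G) (μ : M) :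
    g • x F B μ = x F B (g • μ) :=
  substHom_xSeries F B (DistribSMul.toAddMonoidHom M g) μ

/-- The equivariant map `μ ↦ x_μ`. -/
def xHom [Finite κ] (G : Type*) [Group G] [DistribMulAction G M] :
    M →[G] FormalGroupAlgebra F B where
  toFun := x F B
  map_smul' g μ := (smul_x F B g μ).symm

end FormalGroupAlgebra

end FormalGroupAlgebra

section ConnectiveAlgebra

variable {R : Type*} [CommRing R] (c : R) (M : Type*) [AddCommGroup M]

/-- The ideal generated by `x_0` and `x_{μ+ν} - (x_μ + x_ν - c x_μ x_ν)`. -/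
def connectiveIdeal : Ideal (MvPolynomial M R) :=
  Ideal.span ({MvPolynomial.X 0} ∪ Set.range fun p : M × M =>
    MvPolynomial.X (p.1 + p.2) - (MvPolynomial.X p.1 + MvPolynomial.X p.2 -
      MvPolynomial.C c * MvPolynomial.X p.1 * MvPolynomial.X p.2))

/-- The polynomial version of the formal group algebra for the connective formal group law
`x + y - c x y`. -/
abbrev ConnectiveAlgebra : Type _ := MvPolynomial M R ⧸ connectiveIdeal c M

namespace ConnectiveAlgebra

variable {M}

/-- The element `x_μ`. -/
def x (μ : M) : ConnectiveAlgebra c M := Ideal.Quotient.mk _ (MvPolynomial.X μ)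

theorem connectiveIdeal_le_comap (g : M →+ M) :
    connectiveIdeal c M ≤ (connectiveIdeal c M).comap (MvPolynomial.rename (R := R) g) := by
  refine Ideal.span_le.2 ?_
  rintro _ (h | ⟨p, rfl⟩)
  · rw [Set.mem_singleton_iff.1 h]
    refine Ideal.subset_span (Or.inl ?_)
    simp
  · refine Ideal.subset_span (Or.inr ⟨(g p.1, g p.2), ?_⟩)
    simp

/-- The endomorphism `x_μ ↦ x_{g μ}`. -/
def mapHom (g : M →+ M) : ConnectiveAlgebra c M →+* ConnectiveAlgebra c M :=
  Ideal.quotientMap _ (MvPolynomial.rename (R := R) g).toRingHom (connectiveIdeal_le_comap c g)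

theorem mapHom_mk (g : M →+ M) (p : MvPolynomial M R) :
    mapHom c g (Ideal.Quotient.mk _ p) = Ideal.Quotient.mk _ (MvPolynomial.rename g p) :=
  rfl

/-- A group acting additively on `M` acts on the algebra by `g • x_μ = x_{g • μ}`. -/
instance {G : Type*} [Group G] [DistribMulAction G M] :
    MulSemiringAction G (ConnectiveAlgebra c M) where
  smul g z := mapHom c (DistribSMul.toAddMonoidHom M g) z
  one_smul z := by
    obtain ⟨p, rfl⟩ := Ideal.Quotient.mk_surjective z
    change mapHom c (DistribSMul.toAddMonoidHom M (1 : G)) _ = _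
    rw [mapHom_mk]
    congr 1
    have : ⇑(DistribSMul.toAddMonoidHom M (1 : G)) = id := funext fun μ => one_smul G μ
    rw [this, MvPolynomial.rename_id_apply]
  mul_smul g h z := by
    obtain ⟨p, rfl⟩ := Ideal.Quotient.mk_surjective z
    change mapHom c (DistribSMul.toAddMonoidHom M (g * h)) _ =
      mapHom c (DistribSMul.toAddMonoidHom M g) (mapHom c (DistribSMul.toAddMonoidHom M h) _)
    rw [mapHom_mk, mapHom_mk, mapHom_mk, MvPolynomial.rename_rename]
    congr 3
    exact funext fun μ => mul_smul g h μ
  smul_zero g := map_zero (mapHom c _)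
  smul_add g := map_add (mapHom c _)
  smul_one g := map_one (mapHom c _)
  smul_mul g := map_mul (mapHom c _)

/-- The equivariant map `μ ↦ x_μ`. -/
def xHom (G : Type*) [Group G] [DistribMulAction G M] : M →[G] ConnectiveAlgebra c M where
  toFun := x c
  map_smul' g μ := by
    change x c (g • μ) = mapHom c (DistribSMul.toAddMonoidHom M g) (x c μ)
    rw [x, x, mapHom_mk, MvPolynomial.rename_X]
    rfl

end ConnectiveAlgebra

end ConnectiveAlgebra


section Peterson

open TensorProduct

variable {ι M N : Type*} [AddCommGroup M] [AddCommGroup N]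

/-- A root datum is irreducible if it has a root and its roots are not the union of two nonempty
mutually orthogonal subsets. -/
def IsIrreducibleDatum (P : RootPairing ι ℤ M N) : Prop :=
  Nonempty ι ∧ ∀ s : Set ι, s.Nonempty → (∀ i ∈ s, ∀ j ∉ s, P.pairing i j = 0) → s = Set.univ

/-- A root datum is simply connected if the coroots span the cocharacter lattice, which is then the
coroot lattice `Q^∨`. -/
def IsSimplyConnectedDatum (P : RootPairing ι ℤ M N) : Prop :=
  Submodule.span ℤ (Set.range P.coroot) = ⊤

/-- `θ` is the highest root: every difference `θ - β` with `β` a root is a sum of simple roots. -/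
def IsHighestRoot {P : RootPairing ι ℤ M N} (b : P.Base) (θ : ι) : Prop :=
  ∀ j, P.root θ - P.root j ∈ AddSubmonoid.closure (P.root '' b.support)

variable (P : RootPairing ι ℤ M N)

/-- The action of the Weyl group on the cocharacter lattice. In `RootPairing.Aut`, the coweight
component of `w` is the transpose of its weight component, so it is that of `w⁻¹` which is used. -/
def weylCoweightHom : P.weylGroup →* MulAut (Multiplicative N) where
  toFun w := AddEquiv.toMultiplicative
    (DistribMulAction.toAddEquiv N (MulOpposite.op (w⁻¹ : P.weylGroup).val))
  map_one' := by
    ext n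
    simp
  map_mul' v w := by
    ext n
    change MulOpposite.op ((v * w)⁻¹ : P.weylGroup).val • n.toAdd =
      MulOpposite.op (v⁻¹ : P.weylGroup).val • MulOpposite.op (w⁻¹ : P.weylGroup).val • n.toAdd
    rw [mul_inv_rev, Subgroup.coe_mul, MulOpposite.op_mul, mul_smul]

/-- The affine Weyl group `W_a = Q^∨ ⋊ W`, with elements `t_λ w = ⟨λ, w⟩`. -/
abbrev AffineWeyl : Type _ := Multiplicative N ⋊[weylCoweightHom P] P.weylGroup

variable {P}

/-- The translation `t_λ`. -/
def translation (l : N) : AffineWeyl P := SemidirectProduct.inl (Multiplicative.ofAdd l)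

/-- The reflection `s_α` in the root of index `i`. -/
def reflection (i : ι) : AffineWeyl P :=
  SemidirectProduct.inr (RootPairing.weylGroup.ofIdx P i)

/-- The affine reflection `s_0 = t_{θ^∨} s_θ`. -/
def affineReflection (θ : ι) : AffineWeyl P := translation (P.coroot θ) * reflection θ

section Algebra

variable {S : Type*} [CommRing S] [MulSemiringAction P.weylGroup S] (x : M →[P.weylGroup] S)

/-- The multiplicative subset of `S` generated by the `x_α`, `α` a root. -/
def rootSubmonoid : Submonoid S := Submonoid.closure (Set.range fun i => x (P.root i))

theorem x_root_mem (i : ι) : x (P.root i) ∈ rootSubmonoid x := Submonoid.subset_closure ⟨i, rfl⟩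

/-- The ring `𝒬 = S[1/x_α]`. -/
abbrev QRing : Type _ := Localization (rootSubmonoid x)

theorem rootSubmonoid_le_comap (w : P.weylGroup) :
    rootSubmonoid x ≤ (rootSubmonoid x).comap (MulSemiringAction.toRingHom P.weylGroup S w) := by
  refine Submonoid.closure_le.2 ?_
  rintro _ ⟨i, rfl⟩
  change w • x (P.root i) ∈ rootSubmonoid x
  rw [← map_smul]
  have : w • P.root i = P.root (w.val.indexEquiv i) :=
    (RootPairing.Equiv.root_indexEquiv_eq_smul P i w.val).symm
  rw [this]
  exact x_root_mem x _

/-- The action of an element of the Weyl group on `𝒬`. -/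
def weylQHom (w : P.weylGroup) : QRing x →+* QRing x :=
  IsLocalization.map (QRing x) (MulSemiringAction.toRingHom P.weylGroup S w)
    (rootSubmonoid_le_comap x w)

theorem weylQHom_algebraMap (w : P.weylGroup) (s : S) :
    weylQHom x w (algebraMap S (QRing x) s) = algebraMap S (QRing x) (w • s) :=
  IsLocalization.map_eq _ s

theorem weylQHom_one : weylQHom x 1 = RingHom.id (QRing x) := by
  refine IsLocalization.ringHom_ext (rootSubmonoid x) (RingHom.ext fun s => ?_)
  simp [weylQHom_algebraMap]

theorem weylQHom_mul (v w : P.weylGroup) :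
    weylQHom x (v * w) = (weylQHom x v).comp (weylQHom x w) := by
  refine IsLocalization.ringHom_ext (rootSubmonoid x) (RingHom.ext fun s => ?_)
  simp [weylQHom_algebraMap, mul_smul]

/-- The affine Weyl group acts on `𝒬` through its projection to `W`: `t_λ w` acts as `w`. -/
instance affineWeylAction : MulSemiringAction (AffineWeyl P) (QRing x) where
  smul g q := weylQHom x g.right q
  one_smul q := by
    change weylQHom x (1 : AffineWeyl P).right q = q
    rw [SemidirectProduct.one_right, weylQHom_one, RingHom.id_apply]
  mul_smul g h q := by
    change weylQHom x (g * h).right q = weylQHom x g.right (weylQHom x h.right q)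
    rw [SemidirectProduct.mul_right, weylQHom_mul, RingHom.comp_apply]
  smul_zero g := map_zero (weylQHom x g.right)
  smul_add g := map_add (weylQHom x g.right)
  smul_one g := map_one (weylQHom x g.right)
  smul_mul g := map_mul (weylQHom x g.right)

theorem affineWeyl_smul (g : AffineWeyl P) (q : QRing x) : g • q = weylQHom x g.right q := rfl

/-- The twisted group algebra `𝒬_{W_a}`, with `p η_v * q η_w = p v(q) η_{vw}`. -/
abbrev QAffineWeyl : Type _ := SkewMonoidAlgebra (QRing x) (AffineWeyl P)

/-- The algebra `𝒬_{Q^∨}`. The coroot lattice acts trivially on `𝒬`, so it is the group algebra of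
`Q^∨` over `𝒬`, with Hopf algebra structure over `𝒬` given by `η_{t_λ} ↦ η_{t_λ} ⊗ η_{t_λ}`,
`η_{t_λ} ↦ 1` and `η_{t_λ} ↦ η_{t_{-λ}}`. -/
abbrev QCorootLattice : Type _ := AddMonoidAlgebra (QRing x) N

/-- The element `η_w` of `𝒬_{W_a}`. -/
def eta (w : AffineWeyl P) : QAffineWeyl x := SkewMonoidAlgebra.single w 1

/-- The embedding of `𝒬` in `𝒬_{W_a}`. -/
def scalar (q : QRing x) : QAffineWeyl x := SkewMonoidAlgebra.single 1 q

/-- The element `1/x_α` of `𝒬`. -/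
def invRoot (i : ι) : QRing x := Localization.mk 1 ⟨x (P.root i), x_root_mem x i⟩

/-- The Demazure element `X_i = (1/x_{α_i}) (1 - η_{s_i})`. -/
def demazure (i : ι) : QAffineWeyl x := scalar x (invRoot x i) * (1 - eta x (reflection i))

/-- The Demazure element `X_0 = (1/x_{-θ}) (1 - η_{s_0})`; the index of the root `-θ` is
`P.reflectionPerm θ θ`. -/
def affineDemazure (θ : ι) : QAffineWeyl x :=
  scalar x (invRoot x (P.reflectionPerm θ θ)) * (1 - eta x (affineReflection θ))

/-- The formal affine Demazure algebra `𝐃_{W_a}` of the small torus: the subring of `𝒬_{W_a}`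
generated by `S` and by `X_0, X_1, …, X_n`. -/
def demazureAlgebra (b : P.Base) (θ : ι) : Subring (QAffineWeyl x) :=
  Subring.closure ((Set.range fun s : S => scalar x (algebraMap S (QRing x) s)) ∪
    demazure x '' b.support ∪ {affineDemazure x θ})

/-- The projection `𝒬_{W_a} → 𝒬_{Q^∨}`, `p η_{t_λ w} ↦ p η_{t_λ}`. -/
def pr : QAffineWeyl x →ₗ[QRing x] QCorootLattice x :=
  (Finsupp.lsum (QRing x) fun g : AffineWeyl P =>
    (AddMonoidAlgebra.lsingle g.left.toAdd : QRing x →ₗ[QRing x] QCorootLattice x)) ∘ₗ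
      (SkewMonoidAlgebra.coeffLinearEquiv (S := QRing x)).toLinearMap

/-- The ring embedding `k : 𝒬_{Q^∨} → 𝒬_{W_a}`, `p η_{t_λ} ↦ p η_{t_λ}`. -/
def k : QCorootLattice x →+* QAffineWeyl x :=
  AddMonoidAlgebra.liftNCRingHom SkewMonoidAlgebra.singleOneRingHom
    ((SkewMonoidAlgebra.of (QRing x) (AffineWeyl P)).comp SemidirectProduct.inl) (by
      intro q l
      have h : (SemidirectProduct.inl l : AffineWeyl P) • q = q := by
        rw [affineWeyl_smul, SemidirectProduct.right_inl, weylQHom_one, RingHom.id_apply]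
      change SkewMonoidAlgebra.single 1 q * SkewMonoidAlgebra.of _ _ _ =
        SkewMonoidAlgebra.of _ _ _ * SkewMonoidAlgebra.single 1 q
      rw [SkewMonoidAlgebra.of_apply, SkewMonoidAlgebra.single_mul_single,
        SkewMonoidAlgebra.single_mul_single, h, smul_one]
      simp)

theorem pr_single (g : AffineWeyl P) (q : QRing x) :
    pr x (SkewMonoidAlgebra.single g q) = AddMonoidAlgebra.single g.left.toAdd q := by
  change (Finsupp.lsum (QRing x) fun g : AffineWeyl P =>
    (AddMonoidAlgebra.lsingle g.left.toAdd : QRing x →ₗ[QRing x] QCorootLattice x))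
      (Finsupp.single g q) = _
  rw [Finsupp.lsum_single]
  rfl

theorem k_single (l : N) (q : QRing x) :
    k x (AddMonoidAlgebra.single l q) = SkewMonoidAlgebra.single (translation l) q := by
  simp only [k, AddMonoidAlgebra.liftNCRingHom_single]
  change SkewMonoidAlgebra.single 1 q * SkewMonoidAlgebra.of _ _ _ = _
  rw [SkewMonoidAlgebra.of_apply]
  rw [SkewMonoidAlgebra.single_mul_single, one_mul, smul_one, mul_one]
  rfl

/-- The Peterson subalgebra `𝐃_{Q^∨} = k(pr(𝐃_{W_a}))`, as a subset of `𝒬_{W_a}`. -/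
def petersonSet (b : P.Base) (θ : ι) : Set (QAffineWeyl x) :=
  k x '' (pr x '' demazureAlgebra x b θ)

end Algebra

section Hopf

variable {S Q A H : Type*} [CommRing S] [CommRing Q] [Algebra S Q]
  [Ring A] [HopfAlgebra S A] [Ring H] [HopfAlgebra Q H] [Algebra S H] [IsScalarTower S Q H]

/-- The canonical map `A ⊗_S A → H ⊗_Q H`, `a ⊗ a' ↦ j a ⊗ j a'`, of an `S`-algebra homomorphism
`j` from an `S`-algebra `A` to a `Q`-algebra `H`. -/
def tensorSquare (j : A →ₐ[S] H) : A ⊗[S] A →ₗ[S] H ⊗[Q] H :=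
  TensorProduct.mapOfCompatibleSMul Q S S H H ∘ₗ
    TensorProduct.map j.toLinearMap j.toLinearMap

variable (Q) in
/-- `j` is a homomorphism of Hopf algebras from the Hopf algebra `A` over `S` to the Hopf algebra
`H` over the `S`-algebra `Q`: it is a homomorphism of `S`-algebras, and it commutes with the
coproducts, the counits and the antipodes. -/
structure IsHopfHom (j : A →ₐ[S] H) : Prop where
  comul : ∀ a, Coalgebra.comul (R := Q) (j a) = tensorSquare j (Coalgebra.comul (R := S) a)
  counit : ∀ a, Coalgebra.counit (R := Q) (j a) = algebraMap S Q (Coalgebra.counit (R := S) a)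
  antipode : ∀ a, HopfAlgebra.antipode Q (j a) = j (HopfAlgebra.antipode S a)

end Hopf

/-- The Peterson subalgebra `𝐃_{Q^∨}` is a Hopf algebra over `S` and its embedding in `𝒬_{Q^∨}` is
a homomorphism of Hopf algebras. In detail: `𝐃_{Q^∨}` is a subring `D` of `𝒬_{W_a}`; it has a Hopf
algebra structure over `S`, with structure map the inclusion of `S`; and the embedding
`j : D → 𝒬_{Q^∨}` (the inverse of `k`) is a homomorphism of Hopf algebras. The structure of `D` is
induced by the one of `𝒬_{Q^∨}`: the map `D ⊗_S D → 𝒬_{Q^∨} ⊗_𝒬 𝒬_{Q^∨}` is injective, so that the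
coproduct of `D` is the restriction of that of `𝒬_{Q^∨}`; and `D` contains all `η_{t_λ}`, which have
coproduct `η_{t_λ} ⊗ η_{t_λ}`, counit `1` and antipode `η_{t_{-λ}}`. -/
def PetersonIsHopf {S : Type*} [CommRing S] [MulSemiringAction P.weylGroup S]
    (x : M →[P.weylGroup] S) (b : P.Base) (θ : ι) : Prop :=
  ∃ D : Subring (QAffineWeyl x), (D : Set (QAffineWeyl x)) = petersonSet x b θ ∧
    ∃ (_ : HopfAlgebra S D) (j : D →ₐ[S] QCorootLattice x),
      (∀ s : S, (algebraMap S D s : QAffineWeyl x) = scalar x (algebraMap S (QRing x) s)) ∧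
      (∀ d : D, k x (j d) = d) ∧
      IsHopfHom (QRing x) j ∧
      Function.Injective (tensorSquare (Q := QRing x) j) ∧
      ∀ l : N, ∃ d d' : D, (d : QAffineWeyl x) = eta x (translation l) ∧
        (d' : QAffineWeyl x) = eta x (translation (-l)) ∧
        Coalgebra.comul (R := S) d = d ⊗ₜ[S] d ∧
        Coalgebra.counit (R := S) d = 1 ∧
        HopfAlgebra.antipode S d = d'

end Peterson

end Peterson

end

-- Roots, the highest root, and the Bruhat order on the coroot lattice.

noncomputable section

namespace Peterson

section RootCombinatorics

variable {ι M N : Type*} [AddCommGroup M] [AddCommGroup N] {P : RootPairing ι ℤ M N}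

-- Write H for the group algebra 𝒬_{Q^∨}. Under `pr`, left multiplication by the generators of
-- 𝐃_{W_a} becomes a family of operators on H: an affine root r acts through an affine reflection
-- T_r (`opT`) and through X_r = (1 - T_r)/x_r (`op`). So pr(𝐃_{W_a}) is the smallest S-submodule
-- `peterson` of H that contains 1 and is stable under X_r for the simple affine roots r
-- (`image_pr_demazureAlgebra`), and a closure property is proved by checking it on 1 and along the
-- X_r. A twisted Leibniz rule gives products (`mul_mem_peterson`). Similar rules show that counit,
-- antipode and coproduct carry `peterson` into S, into itself and into the image of its tensor
-- square (`counit_mem_range`, `antipode_mem_peterson`, `comul_mem_petersonSquare`).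
--
-- These facts live in H and H ⊗_𝒬 H. They define a Hopf algebra over S once tensor powers over S
-- embed in tensor powers over 𝒬, and for this it is enough that `peterson` has an S-basis that is
-- also a 𝒬-basis of H (`HopfDescent`). Such a basis is indexed by Q^∨ = W_a/W and is triangular for
-- the Bruhat order. Applying X_r along a chain of simple reflections from 0 up to l gives c_l,
-- supported below l, with leading coefficient 1/d_l, where d_l is a product of x_α over the affine
-- walls between l and 0 (`exists_peterson_leading`).
--
-- The c_l span because no larger denominator can occur: if l has maximal rank in the support of an
-- element of `peterson`, then d_l times the coefficient at l is in S
-- (`exists_leadDenom_mul_coeff`). This is checked at one prime x_α at a time. Over S localised at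
-- x_α, the element lies in the ring generated by scalars, translations and (1 - η_{t_{α^∨}})/x_α,
-- where the n-th Taylor coefficient along the line l + ℤα^∨ has a pole of order at most n
-- (`taylor_mem_localRing`). Maximality of the rank confines the support on this line to a window
-- whose width n is an exponent occurring in d_l, and the n-th Taylor coefficient based at the end
-- of the window is the leading coefficient.
--
-- The argument needs the x_α to be prime and associated only for opposite roots. This can fail over
-- T^*, where a root need not be primitive (α = 2ω for SL₂), but it holds over the root lattice, of
-- which the simple roots are a basis (`isGood_reflDatum`). The c_l are therefore built over the
-- ring T of the root lattice and pushed forward to S. There they still span, since their span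
-- contains 1 and is stable under the X_r, and unit diagonal coefficients remain units
-- (`exists_triangular`). Both choices of S provide the divisibilities collected in `LatticeRing`.

theorem root'_reflectionPerm_self (i : ι) (l : N) :
    P.root' (P.reflectionPerm i i) l = -P.root' i l := by
  simp [RootPairing.root', RootPairing.root_reflectionPerm]

theorem coroot_reflectionPerm_self (i : ι) :
    P.coroot (P.reflectionPerm i i) = -P.coroot i := by
  simp [RootPairing.coroot_reflectionPerm]

theorem root'_reflectionPerm (i j : ι) (l : N) :
    P.root' (P.reflectionPerm i j) l = P.root' j (P.coreflection i l) := by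
  simp only [RootPairing.root', RootPairing.root_reflectionPerm, RootPairing.reflection_apply,
    RootPairing.coreflection_apply, map_sub, map_smul, LinearMap.sub_apply, LinearMap.smul_apply,
    smul_eq_mul, LinearMap.flip_apply]
  ring

theorem reflectionPerm_self_self (i : ι) :
    P.reflectionPerm (P.reflectionPerm i i) (P.reflectionPerm i i) = i :=
  P.root.injective (by
    rw [RootPairing.root_reflectionPerm, RootPairing.reflection_apply_self,
      RootPairing.root_reflectionPerm, RootPairing.reflection_apply_self, neg_neg])

theorem coreflection_reflectionPerm_self (i : ι) (l : N) :
    P.coreflection (P.reflectionPerm i i) l = P.coreflection i l := by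
  rw [RootPairing.coreflection_apply, root'_reflectionPerm_self, coroot_reflectionPerm_self,
    RootPairing.coreflection_apply, smul_neg, neg_smul, neg_neg]

theorem coreflection_reflectionPerm (i j : ι) (l : N) :
    P.coreflection (P.reflectionPerm i j) l =
      P.coreflection i (P.coreflection j (P.coreflection i l)) := by
  rw [RootPairing.coreflection_apply, RootPairing.coreflection_apply _ j, map_sub, map_smul,
    RootPairing.coroot_reflectionPerm, root'_reflectionPerm, RootPairing.coreflection_same]

theorem reflectionPerm_reflectionPerm (i j k : ι) :
    P.reflectionPerm (P.reflectionPerm i j) k =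
      P.reflectionPerm i (P.reflectionPerm j (P.reflectionPerm i k)) :=
  P.root.injective (by
    simp only [RootPairing.root_reflectionPerm, RootPairing.reflection_reflectionPerm]; rfl)

-- Heights and the pairings of roots with the highest coroot.

section Height

variable (b : P.Base)

theorem height_le_of_sub_mem {i j : ι}
    (h : P.root i - P.root j ∈ AddSubmonoid.closure (P.root '' b.support)) :
    b.height j ≤ b.height i ∧ (b.height i = b.height j → i = j) := by
  have key : ∀ m ∈ AddSubmonoid.closure (P.root '' b.support),
      ∃ f : ι → ℕ, m = ∑ k ∈ b.support, (f k : ℤ) • P.root k := by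
    classical
    intro m hm
    induction hm using AddSubmonoid.closure_induction with
    | mem x hx =>
      obtain ⟨j, hj, rfl⟩ := hx
      refine ⟨Pi.single j 1, ?_⟩
      rw [Finset.sum_eq_single_of_mem j hj]
      · simp
      · intro k _ hk
        simp [hk]
    | zero => exact ⟨0, by simp⟩
    | add x y _ _ hx hy =>
      obtain ⟨f, rfl⟩ := hx
      obtain ⟨g, rfl⟩ := hy
      exact ⟨f + g, by simp [add_smul, Finset.sum_add_distrib]⟩
  obtain ⟨f, hf⟩ := key _ h
  obtain ⟨g, -, -, hg⟩ := b.exists_root_eq_sum_int j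
  have hi : P.root i = ∑ k ∈ b.support, (g k + f k) • P.root k := by
    rw [sub_eq_iff_eq_add] at hf
    rw [hf, hg, ← Finset.sum_add_distrib]
    exact Finset.sum_congr rfl fun k _ => by rw [add_smul, add_comm]
  have hh : b.height i = b.height j + ∑ k ∈ b.support, (f k : ℤ) := by
    rw [RootPairing.Base.height_eq_sum hi, RootPairing.Base.height_eq_sum hg,
      Finset.sum_add_distrib]
  refine ⟨by rw [hh]; have := Finset.sum_nonneg (s := b.support) (f := fun k => (f k : ℤ))
                        (fun k _ => by positivity); linarith, fun he => ?_⟩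
  have h0 : ∑ k ∈ b.support, (f k : ℤ) = 0 := by linarith
  rw [Finset.sum_eq_zero_iff_of_nonneg (fun k _ => by positivity)] at h0
  apply P.root.injective
  rw [← sub_eq_zero, hf]
  exact Finset.sum_eq_zero fun k hk => by rw [h0 k hk, zero_smul]

theorem height_reflectionPerm_self' (i : ι) :
    b.height (P.reflectionPerm i i) = -b.height i := b.height_reflectionPerm_self i

theorem isPos_reflectionPerm_self (i : ι) : b.IsPos (P.reflectionPerm i i) ↔ ¬ b.IsPos i :=
  RootPairing.Base.IsPos.neg_iff_not b i

theorem height_reflectionPerm (i j : ι) :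
    b.height (P.reflectionPerm i j) = b.height j - P.pairing j i * b.height i := by
  have := b.height_add_zsmul (i := j) (j := i) (k := P.reflectionPerm i j) (z := -P.pairing j i)
    (by rw [RootPairing.root_reflectionPerm, RootPairing.reflection_apply_root, neg_smul,
      sub_eq_add_neg])
  rw [this, smul_eq_mul]
  ring

variable {b} {θ : ι} (hθ : IsHighestRoot b θ)

include hθ

theorem IsHighestRoot.height_le (j : ι) : b.height j ≤ b.height θ :=
  (height_le_of_sub_mem b (hθ j)).1

theorem IsHighestRoot.eq_of_height (j : ι) (h : b.height j = b.height θ) : j = θ :=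
  ((height_le_of_sub_mem b (hθ j)).2 h.symm).symm

theorem IsHighestRoot.isPos : b.IsPos θ := by
  rw [RootPairing.Base.isPos_iff']
  have := hθ.height_le (P.reflectionPerm θ θ)
  rw [height_reflectionPerm_self'] at this
  linarith

/-- If ⟨j, θ^∨⟩ ≥ 2, the root -s_θ(j) = ⟨j, θ^∨⟩θ - j has height at most that of θ, so j has at
least the height of θ and equals θ. This is how the proof uses that θ is a long root. -/
theorem IsHighestRoot.pairing_le_one {j : ι} (h : j ≠ θ) : P.pairing j θ ≤ 1 := by
  by_contra! h1
  have h2 := hθ.height_le (P.reflectionPerm (P.reflectionPerm θ j) (P.reflectionPerm θ j))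
  rw [height_reflectionPerm_self', height_reflectionPerm] at h2
  have h3 : 0 < b.height θ := hθ.isPos
  exact h (hθ.eq_of_height j (le_antisymm (hθ.height_le j) (by nlinarith)))

theorem IsHighestRoot.neg_one_le_pairing {j : ι} (h : j ≠ P.reflectionPerm θ θ) :
    -1 ≤ P.pairing j θ := by
  have := hθ.pairing_le_one (j := P.reflectionPerm j j) (by
    rintro rfl
    exact h (reflectionPerm_self_self j).symm)
  rw [RootPairing.pairing_reflectionPerm_self_left] at this
  linarith

theorem IsHighestRoot.pairing_nonneg {j : ι} (h : b.IsPos j) : 0 ≤ P.pairing j θ := by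
  by_contra! h1
  have h2 := hθ.height_le (P.reflectionPerm θ j)
  rw [height_reflectionPerm] at h2
  have h3 : 0 < b.height θ := hθ.isPos
  rw [RootPairing.Base.isPos_iff] at h
  nlinarith

end Height

/-- Let s be the set of roots β with β^∨ ∈ L such that every root other than ±β pairs with β^∨ to
-1, 0 or 1. It contains θ and is stable under W. If α ≠ ±β is not orthogonal to β ∈ s, then β^∨ -
s_α β^∨ = ±α^∨, so α^∨ ∈ L. Irreducibility provides such a β for every α. -/
theorem eq_top_of_mem_coroot (hirr : IsIrreducibleDatum P) (hsc : IsSimplyConnectedDatum P)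
    {b : P.Base} {θ : ι} (hθ : IsHighestRoot b θ) (L : AddSubgroup N) (h0 : P.coroot θ ∈ L)
    (hL : ∀ i, ∀ l ∈ L, P.coreflection i l ∈ L) : L = ⊤ := by
  let s : Set ι := {β | P.coroot β ∈ L ∧ ∀ α, α = β ∨ α = P.reflectionPerm β β ∨
    (-1 ≤ P.pairing α β ∧ P.pairing α β ≤ 1)}
  have hθs : θ ∈ s := by
    refine ⟨h0, fun α => ?_⟩
    by_cases h1 : α = θ
    · exact Or.inl h1
    by_cases h2 : α = P.reflectionPerm θ θ
    · exact Or.inr (Or.inl h2)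
    exact Or.inr (Or.inr ⟨hθ.neg_one_le_pairing h2, hθ.pairing_le_one h1⟩)
  have hs : ∀ γ, ∀ β ∈ s, P.reflectionPerm γ β ∈ s := by
    rintro γ β ⟨h1, h2⟩
    refine ⟨by rw [RootPairing.coroot_reflectionPerm]; exact hL _ _ h1, fun α => ?_⟩
    rw [RootPairing.pairing_reflectionPerm]
    rcases h2 (P.reflectionPerm γ α) with h | h | h
    · left; rw [← h, RootPairing.reflectionPerm_self]
    · right; left
      rw [← P.reflectionPerm_self γ α, h, reflectionPerm_reflectionPerm,
        RootPairing.reflectionPerm_self]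
    · exact Or.inr (Or.inr h)
  have hmem : ∀ α, ∀ β ∈ s, P.pairing α β ≠ 0 → P.coroot α ∈ L := by
    rintro α β ⟨h1, h2⟩ h3
    rcases h2 α with rfl | rfl | h
    · exact h1
    · rw [coroot_reflectionPerm_self]; exact L.neg_mem h1
    · have h4 := L.sub_mem h1 (hL α _ h1)
      rw [RootPairing.coreflection_apply_coroot, sub_sub_cancel] at h4
      obtain h5 | h5 : P.pairing α β = 1 ∨ P.pairing α β = -1 := by omega
      · rwa [h5, one_smul] at h4
      · rw [h5, neg_smul, one_smul] at h4
        simpa using L.neg_mem h4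
  -- If α meets β ∈ s while α' is orthogonal to all of s, then α' is orthogonal to β and to s_α β;
  -- their coroots differ by a nonzero multiple of α^∨, so α' is orthogonal to α.
  have key : {α | ∃ β ∈ s, P.pairing α β ≠ 0} = Set.univ := by
    refine hirr.2 _ ⟨θ, θ, hθs, by simp⟩ ?_
    rintro α ⟨β, hβ, h1⟩ α' h2
    simp only [Set.mem_ofPred_eq, not_exists, not_and, not_not] at h2
    have h3 := h2 _ (hs α β hβ)
    rw [RootPairing.pairing_reflectionPerm, ← RootPairing.root'_coroot_eq_pairing,
      root'_reflectionPerm, RootPairing.coreflection_apply_coroot, map_sub, map_smul,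
      RootPairing.root'_coroot_eq_pairing, RootPairing.root'_coroot_eq_pairing, h2 β hβ, zero_sub,
      neg_eq_zero, smul_eq_mul, mul_eq_zero] at h3
    exact P.pairing_eq_zero_iff'.1 (h3.resolve_left h1)
  rw [eq_top_iff, ← Submodule.top_toAddSubgroup (R := ℤ), ← hsc]
  have : Submodule.span ℤ (Set.range P.coroot) ≤ AddSubgroup.toIntSubmodule L := by
    rw [Submodule.span_le]
    rintro _ ⟨α, rfl⟩
    obtain ⟨β, hβ, h⟩ : α ∈ {α | ∃ β ∈ s, P.pairing α β ≠ 0} := key ▸ Set.mem_univ α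
    exact hmem α β hβ h
  exact fun x hx => this hx

-- Affine roots, affine reflections and the Bruhat order.

section AffineRoots

variable (P) in
/-- The affine function `l ↦ ⟨l, γ⟩ + k` attached to the affine root `(γ, k)`. -/
def affineEval (r : ι × ℤ) (l : N) : ℤ := P.root' r.1 l + r.2

variable (P) in
/-- The affine reflection of the coroot lattice in the affine root `(γ, k)`. -/
def affineReflect (r : ι × ℤ) (l : N) : N := l - affineEval P r l • P.coroot r.1

variable (P) in
/-- The action of the reflection in the affine root `r` on affine roots. -/
def affineReflectRoot (r s : ι × ℤ) : ι × ℤ :=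
  (P.reflectionPerm r.1 s.1, s.2 - r.2 * P.pairing s.1 r.1)

theorem affineReflect_eq (r : ι × ℤ) (l : N) :
    affineReflect P r l = P.coreflection r.1 l - r.2 • P.coroot r.1 := by
  rw [affineReflect, affineEval, RootPairing.coreflection_apply, add_smul, sub_sub]

theorem affineEval_affineReflect (r s : ι × ℤ) (l : N) :
    affineEval P s (affineReflect P r l) = affineEval P (affineReflectRoot P r s) l := by
  rw [affineReflect_eq, affineEval, affineEval, affineReflectRoot, root'_reflectionPerm, map_sub,
    map_smul, RootPairing.root'_coroot_eq_pairing, smul_eq_mul]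
  ring

theorem affineEval_affineReflect_self (r : ι × ℤ) (l : N) :
    affineEval P r (affineReflect P r l) = -affineEval P r l := by
  rw [affineReflect, affineEval, map_sub, map_smul, RootPairing.root'_coroot_eq_pairing,
    RootPairing.pairing_same, affineEval, smul_eq_mul]
  ring

theorem affineReflect_affineReflect (r : ι × ℤ) (l : N) :
    affineReflect P r (affineReflect P r l) = l := by
  rw [affineReflect, affineEval_affineReflect_self, affineReflect, neg_smul, sub_neg_eq_add,
    sub_add_cancel]

theorem affineReflect_conj (r s : ι × ℤ) (l : N) :
    affineReflect P r (affineReflect P s l) =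
      affineReflect P (affineReflectRoot P r s) (affineReflect P r l) := by
  rw [affineReflect.eq_1 P (affineReflectRoot P r s), ← affineEval_affineReflect,
    affineReflect_affineReflect, affineReflectRoot, RootPairing.coroot_reflectionPerm,
    affineReflect_eq, affineReflect_eq r l, affineReflect, map_sub, map_smul]
  abel

variable (b : P.Base) (θ : ι)

/-- An affine root `(γ, k)` is positive if `k > 0`, or `k = 0` and `γ` is positive. -/
def IsPosAffine (r : ι × ℤ) : Prop := 0 < r.2 ∨ (r.2 = 0 ∧ b.IsPos r.1)

/-- The simple affine roots: the simple roots and `(-θ, 1)`. -/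
def IsSimpleAffine (r : ι × ℤ) : Prop :=
  (r.1 ∈ b.support ∧ r.2 = 0) ∨ r = (P.reflectionPerm θ θ, 1)

variable {b θ}

theorem IsSimpleAffine.isPosAffine {r : ι × ℤ} (h : IsSimpleAffine b θ r) : IsPosAffine b r := by
  rcases h with ⟨h1, h2⟩ | rfl
  · exact Or.inr ⟨h2, RootPairing.Base.isPos_of_mem_support h1⟩
  · exact Or.inl one_pos

theorem pairing_highest_zero {j : ι} (h : P.pairing j θ = 0) : P.reflectionPerm θ j = j :=
  P.root.injective (by
    rw [RootPairing.root_reflectionPerm, RootPairing.reflection_apply_root, h, zero_smul, sub_zero])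

theorem IsHighestRoot.isPos_reflectionPerm_of_neg (hθ : IsHighestRoot b θ) {j : ι}
    (h : P.pairing j θ < 0) : b.IsPos (P.reflectionPerm θ j) := by
  rw [RootPairing.Base.isPos_iff', height_reflectionPerm]
  have h2 := hθ.height_le (P.reflectionPerm j j)
  rw [height_reflectionPerm_self'] at h2
  have h3 : 0 < b.height θ := hθ.isPos
  nlinarith

/-- A simple reflection permutes the other positive roots, in affine form. The reflection in (-θ, 1)
sends (γ, k) to (s_θ γ, k + ⟨γ, θ^∨⟩). For γ ≠ -θ the level drops by at most one, and if it drops to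
0 the new gradient is positive. -/
theorem IsPosAffine.affineReflectRoot [Finite ι] [P.IsReduced] (hθ : IsHighestRoot b θ)
    {r s : ι × ℤ} (hr : IsSimpleAffine b θ r) (hs : IsPosAffine b s) (hrs : s ≠ r) :
    IsPosAffine b (affineReflectRoot P r s) := by
  obtain ⟨γ, k⟩ := s
  rcases hr with ⟨h1, h2⟩ | rfl
  · obtain ⟨β, m⟩ := r
    obtain rfl : m = 0 := h2
    rcases hs with hs | ⟨hs, h⟩
    · exact Or.inl (by simpa [Peterson.affineReflectRoot] using hs)
    · obtain rfl : k = 0 := hs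
      exact Or.inr ⟨by simp [Peterson.affineReflectRoot],
        RootPairing.Base.IsPos.reflectionPerm h h1 (by rintro rfl; exact hrs rfl)⟩
  · have hp : P.pairing γ (P.reflectionPerm θ θ) = -P.pairing γ θ := by
      rw [RootPairing.pairing_reflectionPerm_self_right]
    have hperm : P.reflectionPerm (P.reflectionPerm θ θ) γ = P.reflectionPerm θ γ := by
      rw [reflectionPerm_reflectionPerm, RootPairing.reflectionPerm_self]
    simp only [IsPosAffine, Peterson.affineReflectRoot, hp, hperm, one_mul, sub_neg_eq_add]
    rcases hs with hs | ⟨hs, h⟩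
    · simp only at hs
      by_cases hγ : γ = P.reflectionPerm θ θ
      · subst hγ
        -- The gradient -θ has pairing -2, but the excluded root is exactly the one with k = 1, so k
        -- - 2 ≥ 0 and the new gradient is θ.
        have hk : k ≠ 1 := by rintro rfl; exact hrs rfl
        rw [RootPairing.pairing_reflectionPerm_self_left, RootPairing.pairing_same,
          RootPairing.reflectionPerm_self]
        obtain h | h : 0 < k + -2 ∨ k + -2 = 0 := by omega
        · exact Or.inl h
        · exact Or.inr ⟨h, hθ.isPos⟩
      · have h1 := hθ.neg_one_le_pairing hγ
        obtain h | h : 0 < k + P.pairing γ θ ∨ (k + P.pairing γ θ = 0 ∧ P.pairing γ θ < 0) := by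
          omega
        · exact Or.inl h
        · exact Or.inr ⟨h.1, hθ.isPos_reflectionPerm_of_neg h.2⟩
    · obtain rfl : k = 0 := hs
      rw [zero_add]
      rcases (hθ.pairing_nonneg h).lt_or_eq with h1 | h1
      · exact Or.inl h1
      · exact Or.inr ⟨h1.symm, by rwa [pairing_highest_zero h1.symm]⟩

variable (b) in
/-- One step up in the order on the coroot lattice: apply the reflection in a positive affine root
whose value is positive. -/
def BruhatStep (l l' : N) : Prop :=
  ∃ s, IsPosAffine b s ∧ 0 < affineEval P s l ∧ l' = affineReflect P s l

variable (b) in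
/-- The Bruhat order on the coroot lattice `Q^∨ = W_a / W`. -/
def BruhatLE : N → N → Prop := Relation.ReflTransGen (BruhatStep b)

theorem bruhatLE_affineReflect_self {r : ι × ℤ} (hr : IsPosAffine b r) {l : N}
    (h : 0 ≤ affineEval P r l) : BruhatLE b l (affineReflect P r l) := by
  rcases h.lt_or_eq with h | h
  · exact Relation.ReflTransGen.single ⟨r, hr, h, rfl⟩
  · rw [affineReflect, ← h, zero_smul, sub_zero]
    exact Relation.ReflTransGen.refl

theorem BruhatStep.reflect [Finite ι] [P.IsReduced] (hθ : IsHighestRoot b θ) {r s : ι × ℤ}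
    (hr : IsSimpleAffine b θ r) {l : N} (hs : IsPosAffine b s) (h : 0 < affineEval P s l)
    (hrs : s ≠ r) :
    BruhatStep b (affineReflect P r l) (affineReflect P r (affineReflect P s l)) :=
  ⟨affineReflectRoot P r s, hs.affineReflectRoot hθ hr hrs, by
    rwa [← affineEval_affineReflect, affineReflect_affineReflect], affineReflect_conj r s l⟩

/-- The lifting property. The reflection r carries a chain step by step, since it permutes the
positive affine roots other than r. A step by r itself is dropped: its target is already s_r l, and
the chain continues up to l' ≤ s_r l'. -/
theorem BruhatLE.reflect [Finite ι] [P.IsReduced] (hθ : IsHighestRoot b θ) {r : ι × ℤ}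
    (hr : IsSimpleAffine b θ r) {l l' : N} (h : BruhatLE b l l') (h' : 0 ≤ affineEval P r l') :
    BruhatLE b (affineReflect P r l) (affineReflect P r l') := by
  induction h using Relation.ReflTransGen.head_induction_on with
  | refl => exact Relation.ReflTransGen.refl
  | head h1 h2 ih =>
    obtain ⟨s, hs, h3, rfl⟩ := h1
    by_cases hrs : s = r
    · subst hrs
      exact h2.trans (bruhatLE_affineReflect_self hr.isPosAffine h')
    · exact Relation.ReflTransGen.head (BruhatStep.reflect hθ hr hs h3 hrs) ih

/-- Lifting without a sign condition at l'. A step by r itself turns the first alternative for its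
target into the second for its source; the second alternative passes down the chain by prepending
steps. -/
theorem BruhatLE.reflect_or [Finite ι] [P.IsReduced] (hθ : IsHighestRoot b θ) {r : ι × ℤ}
    (hr : IsSimpleAffine b θ r) {l l' : N} (h : BruhatLE b l l') :
    BruhatLE b (affineReflect P r l) (affineReflect P r l') ∨
      BruhatLE b l (affineReflect P r l') := by
  induction h using Relation.ReflTransGen.head_induction_on with
  | refl => exact Or.inl Relation.ReflTransGen.refl
  | head h1 h2 ih =>
    rcases ih with ih | ih
    · obtain ⟨s, hs, h3, rfl⟩ := h1
      by_cases hrs : s = r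
      · subst hrs
        rw [affineReflect_affineReflect] at ih
        exact Or.inr ih
      · exact Or.inl (Relation.ReflTransGen.head (BruhatStep.reflect hθ hr hs h3 hrs) ih)
    · exact Or.inr (Relation.ReflTransGen.head h1 ih)

theorem bruhatLE_zero_affineReflect [Finite ι] [P.IsReduced] (hθ : IsHighestRoot b θ) {r : ι × ℤ}
    (hr : IsSimpleAffine b θ r) {l : N} (h : BruhatLE b 0 l) :
    BruhatLE b 0 (Peterson.affineReflect P r l) := by
  rcases h.reflect_or hθ hr with h1 | h1
  · refine Relation.ReflTransGen.trans (bruhatLE_affineReflect_self hr.isPosAffine ?_) h1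
    rw [affineEval, map_zero, zero_add]
    rcases hr.isPosAffine with h | h
    · exact h.le
    · exact h.1.ge
  · exact h1

/-- The set of elements above 0 is stable under the simple affine reflections. The translations
preserving it form a W-stable subgroup, which contains θ^∨ because t_{θ^∨} = s_0 s_θ, and so is the
whole lattice. -/
theorem bruhatLE_zero [Finite ι] [P.IsReduced] (hirr : IsIrreducibleDatum P)
    (hsc : IsSimplyConnectedDatum P) (hθ : IsHighestRoot b θ) (l : N) : BruhatLE b 0 l := by
  have hsimple : ∀ r, IsSimpleAffine b θ r → ∀ l,
      BruhatLE b 0 (affineReflect P r l) ↔ BruhatLE b 0 l := fun r hr l =>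
    ⟨fun h => by simpa [affineReflect_affineReflect] using bruhatLE_zero_affineReflect hθ hr h,
      bruhatLE_zero_affineReflect hθ hr⟩
  have hrefl : ∀ i l, BruhatLE b 0 (P.coreflection i l) ↔ BruhatLE b 0 l := by
    intro i
    induction i using b.induction_reflect with
    | h₀ i ih => intro l; rw [coreflection_reflectionPerm_self, ih]
    | h₁ i hi =>
      intro l
      rw [← hsimple (i, 0) (Or.inl ⟨hi, rfl⟩) l, affineReflect_eq, zero_smul, sub_zero]
    | h₂ i j ih hj =>
      have hj' : ∀ l, BruhatLE b 0 (P.coreflection j l) ↔ BruhatLE b 0 l := fun l => by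
        rw [← hsimple (j, 0) (Or.inl ⟨hj, rfl⟩) l, affineReflect_eq, zero_smul, sub_zero]
      intro l
      rw [coreflection_reflectionPerm, hj', ih, hj']
  let L : AddSubgroup N :=
    { carrier := {l | ∀ m, BruhatLE b 0 (m + l) ↔ BruhatLE b 0 m}
      zero_mem' := fun m => by rw [add_zero]
      add_mem' := fun {x y} hx hy m => by rw [← add_assoc, hy, hx]
      neg_mem' := fun {x} hx m => by rw [← hx, neg_add_cancel_right] }
  have hL : L = ⊤ := by
    refine eq_top_of_mem_coroot hirr hsc hθ L (fun m => ?_) (fun i l hl m => ?_)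
    · rw [← hrefl θ m, ← hsimple _ (Or.inr rfl) (P.coreflection θ m), affineReflect_eq,
        coreflection_reflectionPerm_self, RootPairing.coreflection_same,
        coroot_reflectionPerm_self, one_smul, sub_neg_eq_add]
    · rw [← hrefl i (m + _), map_add, RootPairing.coreflection_same, hl, hrefl]
  have h : l ∈ L := hL ▸ AddSubgroup.mem_top l
  have := h 0
  rw [zero_add] at this
  exact this.2 Relation.ReflTransGen.refl

/-- A nonzero element of the coroot lattice does not lie in the fundamental alcove. -/
theorem exists_isSimpleAffine_neg [Finite ι] [P.IsReduced] (hirr : IsIrreducibleDatum P)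
    (hsc : IsSimplyConnectedDatum P) (hθ : IsHighestRoot b θ) {l : N} (hl : l ≠ 0) :
    ∃ r, IsSimpleAffine b θ r ∧ affineEval P r l < 0 := by
  by_contra! h
  have hclosure : ∀ m ∈ AddSubmonoid.closure (P.root '' b.support), 0 ≤ P.toLinearMap m l := by
    intro m hm
    induction hm using AddSubmonoid.closure_induction with
    | mem x hx =>
      obtain ⟨i, hi, rfl⟩ := hx
      simpa [affineEval] using h (i, 0) (Or.inl ⟨hi, rfl⟩)
    | zero => simp
    | add x y _ _ hx hy => rw [map_add, LinearMap.add_apply]; exact add_nonneg hx hy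
  have hpos : ∀ i, b.IsPos i → 0 ≤ P.root' i l := by
    intro i hi
    rcases b.root_mem_or_neg_mem i with h1 | h1
    · exact hclosure _ h1
    · exfalso
      have h2 := height_le_of_sub_mem b (i := P.reflectionPerm i i) (j := i) (by
        have := AddSubmonoid.add_mem _ h1 h1
        rwa [RootPairing.root_reflectionPerm, RootPairing.reflection_apply_self, sub_eq_add_neg])
      rw [height_reflectionPerm_self'] at h2
      rw [RootPairing.Base.isPos_iff] at hi
      linarith [h2.1]
  have hall : ∀ s, IsPosAffine b s → 0 ≤ affineEval P s l := by
    rintro ⟨i, k⟩ (hk | ⟨hk, hi⟩)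
    -- The difference of θ and the root -γ is a sum of simple roots, so ⟨γ, l⟩ ≥ -⟨θ, l⟩ ≥ -1 ≥ -k.
    · have h1 := h _ (Or.inr rfl)
      have h2 := hclosure _ (hθ (P.reflectionPerm i i))
      rw [map_sub, LinearMap.sub_apply] at h2
      have h3 := root'_reflectionPerm_self (P := P) i l
      have h4 := root'_reflectionPerm_self (P := P) θ l
      simp only [affineEval] at *
      linarith
    · obtain rfl : k = 0 := hk
      simpa [affineEval] using hpos i hi
  -- The last step of a chain from 0 to l is a reflection in a positive affine root whose value
  -- changes from positive to negative, which contradicts `hall`.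
  rcases Relation.ReflTransGen.cases_tail (bruhatLE_zero hirr hsc hθ l) with h1 | ⟨m, -, h1⟩
  · exact hl h1
  · obtain ⟨s, hs, h2, rfl⟩ := h1
    have := hall s hs
    rw [affineEval_affineReflect_self] at this
    linarith

end AffineRoots

end RootCombinatorics

end Peterson
end

-- A rank function for the Bruhat order, and inversion counts.

noncomputable section

namespace Peterson

section Rank

variable {ι M N : Type*} [Fintype ι] [AddCommGroup M] [AddCommGroup N] {P : RootPairing ι ℤ M N}

variable (P) in
/-- The invariant quadratic form on the coroot lattice. -/
def sqNorm (l : N) : ℤ := P.CorootForm l l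

/-- Invariance of the form under s_i, applied to the pair l and α_i^∨, where s_i α_i^∨ = -α_i^∨. -/
theorem corootForm_coroot (l : N) (i : ι) :
    2 * P.CorootForm l (P.coroot i) = P.root' i l * sqNorm P (P.coroot i) := by
  have h := P.flip.rootForm_reflection_reflection_apply i l (P.coroot i)
  have h1 : P.flip.reflection i (P.coroot i) = -P.coroot i := P.coreflection_apply_self i
  have h2 : P.flip.reflection i l = l - P.root' i l • P.coroot i := P.coreflection_apply i l
  rw [h1, h2] at h
  change P.CorootForm _ _ = P.CorootForm _ _ at h
  rw [map_neg, map_sub, map_smul, LinearMap.sub_apply, LinearMap.smul_apply, smul_eq_mul] at h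
  rw [sqNorm]
  linarith

theorem sqNorm_coroot_pos (i : ι) : 0 < sqNorm P (P.coroot i) := by
  rw [sqNorm, RootPairing.corootForm_apply_apply]
  refine Finset.sum_pos' (fun j _ => mul_self_nonneg _) ⟨i, Finset.mem_univ i, ?_⟩
  rw [RootPairing.root'_coroot_eq_pairing, RootPairing.pairing_same]
  norm_num

theorem sqNorm_add_smul_coroot (l : N) (i : ι) (j : ℤ) :
    sqNorm P (l + j • P.coroot i) =
      sqNorm P l + j * (P.root' i l + j) * sqNorm P (P.coroot i) := by
  have hs : P.CorootForm (P.coroot i) l = P.CorootForm l (P.coroot i) := by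
    rw [RootPairing.corootForm_apply_apply, RootPairing.corootForm_apply_apply]
    exact Finset.sum_congr rfl fun _ _ => mul_comm _ _
  have h := corootForm_coroot (P := P) l i
  simp only [sqNorm, map_add, map_smul, LinearMap.add_apply, LinearMap.smul_apply, smul_eq_mul] at *
  linear_combination j * h + j * hs

variable (b : P.Base)

open Classical in
/-- The pairing with the sum of the positive roots. -/
def posSum (l : N) : ℤ := ∑ i, if b.IsPos i then P.root' i l else 0

theorem posSum_add_smul (l m : N) (j : ℤ) :
    posSum b (l + j • m) = posSum b l + j * posSum b m := by
  simp only [posSum, Finset.mul_sum, ← Finset.sum_add_distrib]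
  refine Finset.sum_congr rfl fun i _ => ?_
  split_ifs
  · rw [map_add, map_smul, smul_eq_mul]
  · simp

theorem abs_posSum_le (l : N) : |posSum b l| ≤ sqNorm P l := by
  rw [posSum, sqNorm, RootPairing.corootForm_apply_apply]
  refine (Finset.abs_sum_le_sum_abs _ _).trans (Finset.sum_le_sum fun i _ => ?_)
  split_ifs
  · rw [← abs_mul_abs_self]
    rcases (abs_nonneg (P.root' i l)).eq_or_lt with h | h
    · simp [← h]
    · nlinarith
  · rw [abs_zero]
    exact mul_self_nonneg _

/-- This is ⟨2ρ, α^∨⟩ > 0 for α positive. The positive roots β with s_α β positive cancel in pairs.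
For the remaining positive β, the height of s_α β = β - ⟨β, α^∨⟩α is not positive, which forces ⟨β,
α^∨⟩ > 0; the root α itself contributes 2. -/
theorem posSum_coroot_pos {i : ι} (hi : b.IsPos i) : 0 < posSum b (P.coroot i) := by
  classical
  set f : ι → ℤ := fun j => if b.IsPos j then P.root' j (P.coroot i) else 0 with hf
  set s : Finset ι := Finset.univ.filter fun j => b.IsPos j ∧ b.IsPos (P.reflectionPerm i j) with hs
  have h1 : ∑ j ∈ s, f j = 0 := by
    refine Finset.sum_involution (fun j _ => P.reflectionPerm i j) (fun j hj => ?_)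
      (fun j hj h h' => ?_) (fun j hj => ?_) (fun j _ => P.reflectionPerm_self i j)
    · simp only [hs, Finset.mem_filter, Finset.mem_univ, true_and] at hj
      simp only [hf, if_pos hj.1, if_pos hj.2, root'_reflectionPerm,
        RootPairing.coreflection_apply_self, map_neg, add_neg_cancel]
    · simp only [hs, Finset.mem_filter, Finset.mem_univ, true_and] at hj
      apply h
      have h2 := root'_reflectionPerm (P := P) i j (P.coroot i)
      rw [h', RootPairing.coreflection_apply_self, map_neg] at h2
      simp only [hf, if_pos hj.1]
      linarith
    · simp only [hs, Finset.mem_filter, Finset.mem_univ, true_and] at hj ⊢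
      rw [RootPairing.reflectionPerm_self]
      exact hj.symm
  have h2 : posSum b (P.coroot i) = ∑ j ∈ sᶜ, f j := by
    rw [← zero_add (∑ j ∈ sᶜ, f j), ← h1, Finset.sum_add_sum_compl]
    rfl
  have hi' : 0 < b.height i := hi
  rw [h2]
  refine Finset.sum_pos' (fun j hj => ?_) ⟨i, ?_, ?_⟩
  · simp only [hs, Finset.mem_compl, Finset.mem_filter, Finset.mem_univ, true_and, not_and] at hj
    simp only [hf]
    split_ifs with hj'
    · have h3 := hj hj'
      rw [RootPairing.Base.isPos_iff, height_reflectionPerm] at h3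
      rw [RootPairing.Base.isPos_iff] at hj'
      rw [RootPairing.root'_coroot_eq_pairing]
      by_contra! h4
      nlinarith
    · exact le_rfl
  · simp only [hs, Finset.mem_compl, Finset.mem_filter, Finset.mem_univ, true_and, not_and]
    intro _
    rw [isPos_reflectionPerm_self]
    exact not_not.2 hi
  · simp [hf, if_pos hi]

/-- A rank function on the coroot lattice: compare invariant norms first, and then the pairings
with the sum of the positive roots. -/
def rank (l : N) : ℕ := (sqNorm P l ^ 2 + (sqNorm P l - posSum b l)).toNat

theorem cast_rank (l : N) : (rank b l : ℤ) = sqNorm P l ^ 2 + (sqNorm P l - posSum b l) := by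
  refine Int.toNat_of_nonneg ?_
  have := abs_le.1 (abs_posSum_le b l)
  nlinarith [sq_nonneg (sqNorm P l)]

variable {b}

/-- With q the norm, |posSum| ≤ q puts the correction q - posSum between 0 and 2q. As q² + 2q < (q +
1)², the square dominates, so a single natural number encodes a lexicographic order. -/
theorem rank_lt_of_sqNorm_lt {l m : N} (h : sqNorm P l < sqNorm P m) : rank b l < rank b m := by
  have h1 := abs_le.1 (abs_posSum_le b l)
  have h2 := abs_le.1 (abs_posSum_le b m)
  have h3 := (abs_nonneg _).trans (abs_posSum_le b l)
  zify
  rw [cast_rank, cast_rank]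
  nlinarith

theorem rank_lt_of_sqNorm_eq {l m : N} (h : sqNorm P l = sqNorm P m)
    (h' : posSum b m < posSum b l) : rank b l < rank b m := by
  zify
  rw [cast_rank, cast_rank, h]
  linarith

/-- A reflection in (γ, k) at value f > 0 raises the norm by f k times the norm of γ^∨. If k = 0 the
norm is unchanged, and the pairing with the positive roots falls because γ is positive. -/
theorem BruhatStep.rank_lt {l l' : N} (h : BruhatStep b l l') : rank b l < rank b l' := by
  obtain ⟨⟨i, k⟩, hs, h1, rfl⟩ := h
  have hc := sqNorm_coroot_pos (P := P) i
  have h2 := sqNorm_add_smul_coroot (P := P) l i (-affineEval P (i, k) l)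
  have h3 := posSum_add_smul b l (P.coroot i) (-affineEval P (i, k) l)
  rw [neg_smul, ← sub_eq_add_neg] at h2 h3
  change sqNorm P (affineReflect P (i, k) l) = _ at h2
  change posSum b (affineReflect P (i, k) l) = _ at h3
  set f := affineEval P (i, k) l with hf
  have hk : P.root' i l + -f = -k := by rw [hf, affineEval]; ring
  rw [hk] at h2
  rcases hs with hk0 | ⟨hk0, hi⟩
  · apply rank_lt_of_sqNorm_lt
    rw [h2]
    have : 0 < f * k * sqNorm P (P.coroot i) := by
      have hk0 : 0 < k := hk0
      positivity
    linarith
  · obtain rfl : k = 0 := hk0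
    have := posSum_coroot_pos b hi
    exact rank_lt_of_sqNorm_eq (by rw [h2]; ring) (by rw [h3]; nlinarith)

theorem BruhatLE.eq_or_rank_lt {l l' : N} (h : BruhatLE b l l') : l = l' ∨ rank b l < rank b l' := by
  induction h with
  | refl => exact Or.inl rfl
  | tail h1 h2 ih =>
    rcases ih with rfl | ih
    · exact Or.inr h2.rank_lt
    · exact Or.inr (ih.trans h2.rank_lt)

variable (b) in
open Classical in
/-- The number of positive affine roots with gradient the root of index `i` which are negative
at `l`. -/
def inversions (i : ι) (l : N) : ℕ := (-P.root' i l - if b.IsPos i then 0 else 1).toNat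

omit [Fintype ι] in
theorem inversions_zero (i : ι) : inversions b i (0 : N) = 0 := by
  rw [inversions, map_zero]
  split_ifs <;> rfl

variable {θ : ι}

/-- The reflection permutes the positive affine roots other than r, hence preserves inversion counts
for gradients other than ±r.1. For r = (-θ, 1), the shift of levels by ⟨i, θ^∨⟩ ∈ {0, 1, -1} exactly
compensates the change of sign of the gradient. -/
theorem inversions_affineReflect [P.IsReduced] (hθ : IsHighestRoot b θ) {r : ι × ℤ}
    (hr : IsSimpleAffine b θ r) {i : ι} (h1 : i ≠ r.1) (h2 : i ≠ P.reflectionPerm r.1 r.1) (l : N) :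
    inversions b (P.reflectionPerm r.1 i) (affineReflect P r l) = inversions b i l := by
  have key : P.root' (P.reflectionPerm r.1 i) (affineReflect P r l) =
      P.root' i l + r.2 * P.pairing i r.1 := by
    rw [affineReflect_eq, root'_reflectionPerm, map_sub, map_smul, map_sub, map_smul,
      RootPairing.coreflection_same, RootPairing.coreflection_apply_self, map_neg,
      RootPairing.root'_coroot_eq_pairing, smul_eq_mul]
    ring
  rw [inversions, inversions, key]
  congr 1
  rcases hr with ⟨h3, h4⟩ | rfl
  · rw [h4]
    have : b.IsPos (P.reflectionPerm r.1 i) ↔ b.IsPos i := by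
      constructor
      · intro h
        rw [← P.reflectionPerm_self r.1 i]
        refine h.reflectionPerm h3 fun h5 => h2 ?_
        rw [← P.reflectionPerm_self r.1 i, h5]
      · exact fun h => h.reflectionPerm h3 h1
    by_cases hi : b.IsPos i
    · rw [if_pos hi, if_pos (this.2 hi)]
      ring
    · rw [if_neg hi, if_neg (mt this.1 hi)]
      ring
  · simp only at h1 h2 ⊢
    rw [reflectionPerm_self_self] at h2
    have hp : P.pairing i (P.reflectionPerm θ θ) = -P.pairing i θ := by
      rw [RootPairing.pairing_reflectionPerm_self_right]
    have hperm : P.reflectionPerm (P.reflectionPerm θ θ) i = P.reflectionPerm θ i := by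
      rw [reflectionPerm_reflectionPerm, RootPairing.reflectionPerm_self]
    rw [hp, hperm]
    have h3 := hθ.neg_one_le_pairing h1
    have h4 := hθ.pairing_le_one h2
    have h5 : 0 < b.height θ := hθ.isPos
    obtain h | h | h : P.pairing i θ = 0 ∨ P.pairing i θ = 1 ∨ P.pairing i θ = -1 := by omega
    · rw [pairing_highest_zero h, h]
      ring
    -- Otherwise -i would be a positive root with negative pairing against θ^∨.
    · have h6 : b.IsPos i := by
        have h6 := hθ.isPos_reflectionPerm_of_neg (j := P.reflectionPerm i i) (by
          rw [RootPairing.pairing_reflectionPerm_self_left, h]; norm_num)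
        rw [RootPairing.Base.isPos_iff, height_reflectionPerm,
          RootPairing.pairing_reflectionPerm_self_left, h, height_reflectionPerm_self'] at h6
        by_contra h7
        rw [← isPos_reflectionPerm_self, RootPairing.Base.isPos_iff,
          height_reflectionPerm_self'] at h7
        have h8 := hθ.pairing_nonneg (j := P.reflectionPerm i i) (by
          rw [RootPairing.Base.isPos_iff, height_reflectionPerm_self']; exact h7)
        rw [RootPairing.pairing_reflectionPerm_self_left, h] at h8
        omega
      have h7 : ¬ b.IsPos (P.reflectionPerm θ i) := by
        rw [RootPairing.Base.isPos_iff, height_reflectionPerm, h]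
        have := hθ.height_le i
        linarith
      rw [if_pos h6, if_neg h7, h]
      ring
    · have h6 : ¬ b.IsPos i := fun h6 => by
        have := hθ.pairing_nonneg h6
        omega
      have h7 := hθ.isPos_reflectionPerm_of_neg (j := i) (by omega)
      rw [if_neg h6, if_pos h7, h]
      ring

/-- Crossing the wall of r makes r a new inversion and exchanges the counts for the gradients ±r.1.
This +1 is the source of the extra factor in `leadDenom_affineReflect`. -/
theorem inversions_affineReflect_self (hθ : IsHighestRoot b θ) {r : ι × ℤ}
    (hr : IsSimpleAffine b θ r) {l : N} (h : 0 < affineEval P r l) :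
    inversions b r.1 l = 0 ∧
    inversions b r.1 (affineReflect P r l) = inversions b (P.reflectionPerm r.1 r.1) l + 1 ∧
      inversions b (P.reflectionPerm r.1 r.1) (affineReflect P r l) = 0 := by
  have key : P.root' r.1 (affineReflect P r l) = -P.root' r.1 l - 2 * r.2 := by
    rw [affineReflect, affineEval, map_sub, map_smul, RootPairing.root'_coroot_eq_pairing,
      RootPairing.pairing_same, smul_eq_mul]
    ring
  simp only [inversions, root'_reflectionPerm_self, key]
  have hn := isPos_reflectionPerm_self b r.1
  rw [affineEval] at h
  have hp : (b.IsPos r.1 ∧ r.2 = 0) ∨ (¬ b.IsPos r.1 ∧ r.2 = 1) := by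
    rcases hr with ⟨h3, h4⟩ | rfl
    · exact Or.inl ⟨RootPairing.Base.isPos_of_mem_support h3, h4⟩
    · exact Or.inr ⟨by rw [isPos_reflectionPerm_self]; exact not_not.2 hθ.isPos, rfl⟩
  rcases hp with ⟨h1, h2⟩ | ⟨h1, h2⟩
  · rw [if_pos h1, if_neg (by rw [hn]; exact not_not.2 h1), h2]
    omega
  · rw [if_neg h1, if_pos (hn.2 h1), h2]
    omega

/-- Along a coroot string, the elements of rank at most that of `l` lie in a window of width
`inversions (-i) l`. -/
theorem string_window {i : ι} {l : N} (h : 0 ≤ P.root' i l) {j : ℤ}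
    (hj : rank b (l + j • P.coroot i) ≤ rank b l) :
    -(inversions b (P.reflectionPerm i i) l : ℤ) ≤ j ∧ j ≤ 0 := by
  have hc := sqNorm_coroot_pos (P := P) i
  have h2 := sqNorm_add_smul_coroot (P := P) l i j
  have h3 := posSum_add_smul b l (P.coroot i) j
  have h4 : sqNorm P (l + j • P.coroot i) ≤ sqNorm P l := by
    by_contra! h5
    exact absurd (rank_lt_of_sqNorm_lt (b := b) h5) (not_lt.2 hj)
  have h5 : j * (P.root' i l + j) ≤ 0 := by
    by_contra! h6
    have := mul_pos h6 hc
    linarith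
  have h6 : j ≤ 0 := by
    by_contra! h6
    nlinarith
  have h7 : 0 ≤ P.root' i l + j := by
    by_contra! h7
    nlinarith
  refine ⟨?_, h6⟩
  rw [inversions, root'_reflectionPerm_self]
  have hn := isPos_reflectionPerm_self b i
  by_cases hi : b.IsPos i
  · rw [if_neg (by rw [hn]; exact not_not.2 hi)]
    -- The endpoint j = -⟨i, l⟩ is s_i l, which has the same norm as l. For i positive and j < 0 its
    -- rank is larger, so it is excluded; this is the unit that `inversions` subtracts for the
    -- negative root -i.
    by_cases h8 : P.root' i l + j = 0
    · rcases h6.lt_or_eq with h9 | h9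
      · exfalso
        rw [h8, mul_zero, zero_mul, add_zero] at h2
        have := posSum_coroot_pos b hi
        exact absurd (rank_lt_of_sqNorm_eq (b := b) h2.symm (by rw [h3]; nlinarith)) (not_lt.2 hj)
      · omega
    · omega
  · rw [if_pos (hn.2 hi)]
    omega

end Rank

end Peterson
end

-- Demazure operators on the group algebra and the Peterson module.

noncomputable section

namespace Peterson

section ReflDatum

variable {ι M N : Type*} [AddCommGroup M] [AddCommGroup N]

/-- A commutative ring with an action of the reflections of a root datum and elements `x_α`,
permuted by the reflections, such that `s_α` acts trivially modulo `x_α`. -/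
structure ReflDatum (P : RootPairing ι ℤ M N) (S : Type*) [CommRing S] where
  /-- The element `x_α`. -/
  x : ι → S
  /-- The action of the reflection `s_α`. -/
  σ : ι → S →+* S
  σ_x : ∀ i j, σ i (x j) = x (P.reflectionPerm i j)
  σ_σ : ∀ i s, σ i (σ i s) = s
  σ_conj : ∀ i j s, σ (P.reflectionPerm i j) s = σ i (σ j (σ i s))
  dvd_sub : ∀ i s, x i ∣ s - σ i s
  neg_dvd : ∀ i, x (P.reflectionPerm i i) ∣ x i

namespace ReflDatum

variable {P : RootPairing ι ℤ M N} {S : Type*} [CommRing S] (D : ReflDatum P S)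

/-- The multiplicative set generated by the `x_α`. -/
def denom : Submonoid S := Submonoid.closure (Set.range D.x)

theorem x_mem_denom (i : ι) : D.x i ∈ D.denom := Submonoid.subset_closure ⟨i, rfl⟩

theorem denom_le_comap (i : ι) : D.denom ≤ D.denom.comap (D.σ i) := by
  refine Submonoid.closure_le.2 ?_
  rintro _ ⟨j, rfl⟩
  rw [SetLike.mem_coe, Submonoid.mem_comap, D.σ_x]
  exact D.x_mem_denom _

variable (Q : Type*) [CommRing Q] [Algebra S Q] [IsLocalization D.denom Q]

/-- The action of a reflection on the localization. -/
def sig (i : ι) : Q →+* Q := IsLocalization.map Q (D.σ i) (D.denom_le_comap i)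

/-- The element `1 / x_α` of the localization. -/
def inv (i : ι) : Q := IsLocalization.mk' Q 1 (⟨D.x i, D.x_mem_denom i⟩ : D.denom)

variable {Q}

theorem sig_algebraMap (i : ι) (s : S) :
    D.sig Q i (algebraMap S Q s) = algebraMap S Q (D.σ i s) := IsLocalization.map_eq _ s

theorem x_mul_inv (i : ι) : algebraMap S Q (D.x i) * D.inv Q i = 1 := by
  exact (IsLocalization.mk'_spec' Q 1 (⟨D.x i, D.x_mem_denom i⟩ : D.denom)).trans (map_one _)

theorem eq_inv_of_mul_eq_one {i : ι} {q : Q} (h : algebraMap S Q (D.x i) * q = 1) :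
    q = D.inv Q i := by
  rw [← one_mul q, ← D.x_mul_inv i, mul_comm _ (D.inv Q i), mul_assoc, h, mul_one]

theorem sig_inv (i j : ι) : D.sig Q i (D.inv Q j) = D.inv Q (P.reflectionPerm i j) := by
  apply D.eq_inv_of_mul_eq_one
  rw [← D.σ_x, ← D.sig_algebraMap, ← map_mul, D.x_mul_inv, map_one]

theorem sig_sig (i : ι) (q : Q) : D.sig Q i (D.sig Q i q) = q := by
  have : (D.sig Q i).comp (D.sig Q i) = RingHom.id Q :=
    IsLocalization.ringHom_ext D.denom (RingHom.ext fun s => by simp [sig_algebraMap, D.σ_σ])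
  exact RingHom.congr_fun this q

theorem sig_conj (i j : ι) (q : Q) :
    D.sig Q (P.reflectionPerm i j) q = D.sig Q i (D.sig Q j (D.sig Q i q)) := by
  have : D.sig Q (P.reflectionPerm i j) = ((D.sig Q i).comp (D.sig Q j)).comp (D.sig Q i) :=
    IsLocalization.ringHom_ext D.denom (RingHom.ext fun s => by simp [sig_algebraMap, D.σ_conj])
  exact RingHom.congr_fun this q

theorem sig_neg (i : ι) : D.sig Q (P.reflectionPerm i i) = D.sig Q i :=
  RingHom.ext fun q => by rw [sig_conj, sig_sig]

theorem exists_inv_neg (i : ι) :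
    ∃ s : S, D.inv Q (P.reflectionPerm i i) = algebraMap S Q s * D.inv Q i := by
  obtain ⟨s, hs⟩ := D.neg_dvd i
  refine ⟨s, (D.eq_inv_of_mul_eq_one ?_).symm⟩
  rw [← mul_assoc, ← map_mul, ← hs, D.x_mul_inv]

theorem exists_inv_mul_sub (i : ι) (s : S) : ∃ t : S,
    D.inv Q i * (algebraMap S Q s - D.sig Q i (algebraMap S Q s)) = algebraMap S Q t := by
  obtain ⟨t, ht⟩ := D.dvd_sub i s
  refine ⟨t, ?_⟩
  rw [sig_algebraMap, ← map_sub, ht, map_mul, mul_left_comm, ← mul_assoc, D.x_mul_inv, one_mul]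

open AddMonoidAlgebra (single)

variable (Q)

/-- The action of a reflection on the group algebra of the coroot lattice. -/
def tau (i : ι) : AddMonoidAlgebra Q N →+* AddMonoidAlgebra Q N :=
  (AddMonoidAlgebra.mapRingHom N (D.sig Q i)).comp
    (AddMonoidAlgebra.mapDomainRingHom Q (P.coreflection i).toAddMonoidHom)

/-- The action of an affine reflection on the group algebra of the coroot lattice. -/
def opT (r : ι × ℤ) : AddMonoidAlgebra Q N →+ AddMonoidAlgebra Q N :=
  (AddMonoidHom.mulLeft (single (-(r.2 • P.coroot r.1)) 1)).comp (D.tau Q r.1).toAddMonoidHom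

/-- The Demazure operator of an affine root. -/
def op (r : ι × ℤ) (a : AddMonoidAlgebra Q N) : AddMonoidAlgebra Q N :=
  D.inv Q r.1 • (a - D.opT Q r a)

variable {Q}

@[simp]
theorem tau_single (i : ι) (l : N) (q : Q) :
    D.tau Q i (single l q) = single (P.coreflection i l) (D.sig Q i q) := by
  simp [tau]

theorem tau_smul (i : ι) (q : Q) (a : AddMonoidAlgebra Q N) :
    D.tau Q i (q • a) = D.sig Q i q • D.tau Q i a := by
  induction a using AddMonoidAlgebra.induction_linear with
  | zero => simp
  | add a b ha hb => simp only [smul_add, map_add, ha, hb]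
  | single l p => simp

theorem tau_tau (i : ι) (a : AddMonoidAlgebra Q N) : D.tau Q i (D.tau Q i a) = a := by
  induction a using AddMonoidAlgebra.induction_linear with
  | zero => simp
  | add a b ha hb => simp only [map_add, ha, hb]
  | single l p => rw [tau_single, tau_single, sig_sig, RootPairing.coreflection_same]

theorem tau_conj (i j : ι) (a : AddMonoidAlgebra Q N) :
    D.tau Q (P.reflectionPerm i j) a = D.tau Q i (D.tau Q j (D.tau Q i a)) := by
  induction a using AddMonoidAlgebra.induction_linear with
  | zero => simp
  | add a b ha hb => simp only [map_add, ha, hb]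
  | single l p => simp only [tau_single, sig_conj, coreflection_reflectionPerm]

theorem tau_neg (i : ι) : D.tau Q (P.reflectionPerm i i) = D.tau Q i :=
  RingHom.ext fun q => by rw [tau_conj, tau_tau]

theorem opT_apply (r : ι × ℤ) (a : AddMonoidAlgebra Q N) :
    D.opT Q r a = single (-(r.2 • P.coroot r.1)) 1 * D.tau Q r.1 a := rfl

theorem opT_zero (i : ι) (a : AddMonoidAlgebra Q N) : D.opT Q (i, 0) a = D.tau Q i a := by
  rw [opT_apply, zero_smul, neg_zero, ← AddMonoidAlgebra.one_def, one_mul]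

theorem opT_single (r : ι × ℤ) (l : N) (q : Q) :
    D.opT Q r (single l q) = single (affineReflect P r l) (D.sig Q r.1 q) := by
  rw [opT_apply, tau_single, AddMonoidAlgebra.single_mul_single, one_mul, affineReflect_eq,
    sub_eq_neg_add]

theorem opT_smul (r : ι × ℤ) (q : Q) (a : AddMonoidAlgebra Q N) :
    D.opT Q r (q • a) = D.sig Q r.1 q • D.opT Q r a := by
  rw [opT_apply, tau_smul, mul_smul_comm, opT_apply]

theorem opT_mul (r : ι × ℤ) (a c : AddMonoidAlgebra Q N) :
    D.opT Q r (a * c) = D.opT Q r a * D.tau Q r.1 c := by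
  rw [opT_apply, map_mul, ← mul_assoc, opT_apply]

theorem op_add (r : ι × ℤ) (a c : AddMonoidAlgebra Q N) :
    D.op Q r (a + c) = D.op Q r a + D.op Q r c := by
  rw [op, op, op, map_add, ← smul_add]
  congr 1
  abel

theorem op_zero_right (r : ι × ℤ) : D.op Q r 0 = 0 := by simp [op]

theorem op_smul (r : ι × ℤ) (q : Q) (a : AddMonoidAlgebra Q N) :
    D.op Q r (q • a) = D.sig Q r.1 q • D.op Q r a + (D.inv Q r.1 * (q - D.sig Q r.1 q)) • a := by
  rw [op, op, opT_smul, smul_sub, smul_sub, smul_sub, mul_sub, sub_smul, mul_smul, smul_smul,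
    smul_smul, smul_smul, smul_smul, mul_comm (D.sig Q r.1 q)]
  abel

/-- Twisted Leibniz rule. As T_r(ac) = T_r(a) τ(c), the second factor meets only the linear part of
the affine reflection. -/
theorem op_mul (r : ι × ℤ) (a c : AddMonoidAlgebra Q N) :
    D.op Q r (a * c) = D.op Q r a * D.tau Q r.1 c + a * D.op Q (r.1, 0) c := by
  rw [op, op, op, opT_mul, opT_zero, smul_mul_assoc, mul_smul_comm, ← smul_add]
  congr 1
  ring

/-- The Leibniz rule at τ(c), using τ² = 1. It reduces products with X_r(a) to products with a, as
an induction on generators requires. -/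
theorem op_mul' (r : ι × ℤ) (a c : AddMonoidAlgebra Q N) :
    D.op Q r a * c = D.op Q r (a * D.tau Q r.1 c) - a * D.op Q (r.1, 0) (D.tau Q r.1 c) := by
  rw [op_mul, tau_tau, add_sub_cancel_right]

theorem opT_eq (r : ι × ℤ) (a : AddMonoidAlgebra Q N) :
    D.opT Q r a = a - D.x r.1 • D.op Q r a := by
  rw [op, ← algebraMap_smul Q (D.x r.1), smul_smul, x_mul_inv, one_smul, sub_sub_cancel]

theorem op_conj (i j : ι) (a : AddMonoidAlgebra Q N) :
    D.op Q (P.reflectionPerm i j, 0) a = D.tau Q i (D.op Q (j, 0) (D.tau Q i a)) := by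
  rw [op, op, opT_zero, opT_zero, tau_smul, map_sub, tau_tau, sig_inv, tau_conj]

theorem exists_op_neg (i : ι) : ∃ s : S, ∀ a : AddMonoidAlgebra Q N,
    D.op Q (P.reflectionPerm i i, 0) a = s • D.op Q (i, 0) a := by
  obtain ⟨s, hs⟩ := D.exists_inv_neg (Q := Q) i
  refine ⟨s, fun a => ?_⟩
  rw [op, op, opT_zero, opT_zero, tau_neg, hs, mul_smul, algebraMap_smul]

/-- The operators `X_r` preserve the `S`-span of a stable set. -/
theorem op_mem_span {r : ι × ℤ} {V : Submodule S (AddMonoidAlgebra Q N)}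
    {X : Set (AddMonoidAlgebra Q N)} (hX : ∀ a ∈ X, D.op Q r a ∈ V) (hXV : X ⊆ V)
    {a : AddMonoidAlgebra Q N} (ha : a ∈ Submodule.span S X) : D.op Q r a ∈ V := by
  have hV : Submodule.span S X ≤ V := Submodule.span_le.2 hXV
  induction ha using Submodule.span_induction with
  | mem a ha => exact hX a ha
  | zero => rw [op_zero_right]; exact V.zero_mem
  | add a c _ _ ha hc => rw [op_add]; exact V.add_mem ha hc
  | smul s a h ha =>
    obtain ⟨t, ht⟩ := D.exists_inv_mul_sub (Q := Q) r.1 s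
    rw [← algebraMap_smul Q s, op_smul, ht, sig_algebraMap, algebraMap_smul, algebraMap_smul]
    exact V.add_mem (V.smul_mem _ ha) (V.smul_mem _ (hV h))

variable (b : P.Base) (θ : ι)

variable (Q) in
/-- The smallest `S`-submodule of the group algebra of the coroot lattice which contains `1` and is
stable under the Demazure operators of the simple affine roots. -/
def peterson : Submodule S (AddMonoidAlgebra Q N) :=
  sInf {C | 1 ∈ C ∧ ∀ r, IsSimpleAffine b θ r → ∀ a ∈ C, D.op Q r a ∈ C}

variable {b θ}

theorem peterson_le {C : Submodule S (AddMonoidAlgebra Q N)} (h1 : 1 ∈ C)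
    (h : ∀ r, IsSimpleAffine b θ r → ∀ a ∈ C, D.op Q r a ∈ C) : D.peterson Q b θ ≤ C :=
  sInf_le ⟨h1, h⟩

theorem one_mem_peterson : 1 ∈ D.peterson Q b θ :=
  (Submodule.mem_sInf).2 fun _ hC => hC.1

theorem op_mem_peterson {r : ι × ℤ} (hr : IsSimpleAffine b θ r) {a : AddMonoidAlgebra Q N}
    (ha : a ∈ D.peterson Q b θ) : D.op Q r a ∈ D.peterson Q b θ :=
  (Submodule.mem_sInf).2 fun C hC => hC.2 r hr a ((Submodule.mem_sInf).1 ha C hC)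

theorem opT_mem_peterson {r : ι × ℤ} (hr : IsSimpleAffine b θ r) {a : AddMonoidAlgebra Q N}
    (ha : a ∈ D.peterson Q b θ) : D.opT Q r a ∈ D.peterson Q b θ := by
  rw [opT_eq]
  exact Submodule.sub_mem _ ha (Submodule.smul_mem _ _ (D.op_mem_peterson hr ha))

theorem tau_mem_peterson_of_mem_support {i : ι} (hi : i ∈ b.support) {a : AddMonoidAlgebra Q N}
    (ha : a ∈ D.peterson Q b θ) : D.tau Q i a ∈ D.peterson Q b θ := by
  rw [← opT_zero]
  exact D.opT_mem_peterson (Or.inl ⟨hi, rfl⟩) ha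

variable [Finite ι] [P.IsReduced]

theorem tau_mem_peterson (i : ι) {a : AddMonoidAlgebra Q N}
    (ha : a ∈ D.peterson Q b θ) : D.tau Q i a ∈ D.peterson Q b θ := by
  induction i using b.induction_reflect generalizing a with
  | h₀ i ih => rw [tau_neg]; exact ih ha
  | h₁ i hi => exact D.tau_mem_peterson_of_mem_support hi ha
  | h₂ i j ih hj =>
    rw [tau_conj]
    exact D.tau_mem_peterson_of_mem_support hj (ih (D.tau_mem_peterson_of_mem_support hj ha))

/-- Needed for roots that are not simple: the Leibniz rule at (-θ, 1) involves the operator at (-θ,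
0). Conjugation by simple reflections reduces to simple roots. -/
theorem op_root_mem_peterson (i : ι) {a : AddMonoidAlgebra Q N}
    (ha : a ∈ D.peterson Q b θ) : D.op Q (i, 0) a ∈ D.peterson Q b θ := by
  induction i using b.induction_reflect generalizing a with
  | h₀ i ih =>
    obtain ⟨s, hs⟩ := D.exists_op_neg (Q := Q) i
    rw [hs]
    exact Submodule.smul_mem _ _ (ih ha)
  | h₁ i hi => exact D.op_mem_peterson (Or.inl ⟨hi, rfl⟩) ha
  | h₂ i j ih hj =>
    rw [op_conj]
    exact D.tau_mem_peterson j (ih (D.tau_mem_peterson j ha))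

/-- The elements that multiply `peterson` into itself form an S-submodule containing 1, and it is
stable under the X_r by `op_mul'`. Minimality does the rest. -/
theorem mul_mem_peterson {a c : AddMonoidAlgebra Q N} (ha : a ∈ D.peterson Q b θ)
    (hc : c ∈ D.peterson Q b θ) : a * c ∈ D.peterson Q b θ := by
  let E : Submodule S (AddMonoidAlgebra Q N) :=
    { carrier := {a | ∀ c ∈ D.peterson Q b θ, a * c ∈ D.peterson Q b θ}
      zero_mem' := fun c _ => by rw [zero_mul]; exact Submodule.zero_mem _
      add_mem' := fun h1 h2 c hc => by
        rw [add_mul]; exact Submodule.add_mem _ (h1 c hc) (h2 c hc)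
      smul_mem' := fun s a h c hc => by
        rw [smul_mul_assoc]; exact Submodule.smul_mem _ _ (h c hc) }
  have : D.peterson Q b θ ≤ E := by
    refine D.peterson_le (fun c hc => by rwa [one_mul]) fun r hr a h c hc => ?_
    rw [op_mul']
    exact Submodule.sub_mem _ (D.op_mem_peterson hr (h _ (D.tau_mem_peterson _ hc)))
      (h _ (D.op_root_mem_peterson _ (D.tau_mem_peterson _ hc)))
  exact this ha c hc

/-- The operator T at (-θ, 1) sends 1 to the translation by θ^∨. Closure under products and under
the τ_i makes the translations in `peterson` a W-stable subgroup, so `eq_top_of_mem_coroot` applies.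
-/
theorem single_mem_peterson (hirr : IsIrreducibleDatum P) (hsc : IsSimplyConnectedDatum P)
    (hθ : IsHighestRoot b θ) (l : N) : single l 1 ∈ D.peterson Q b θ := by
  let L : AddSubgroup N :=
    { carrier := {l | single l 1 ∈ D.peterson Q b θ ∧ single (-l) 1 ∈ D.peterson Q b θ}
      zero_mem' := by
        rw [Set.mem_ofPred_eq, neg_zero, and_self]
        exact D.one_mem_peterson
      add_mem' := fun {x y} hx hy => by
        refine ⟨?_, ?_⟩
        · have := D.mul_mem_peterson hx.1 hy.1
          rwa [AddMonoidAlgebra.single_mul_single, one_mul] at this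
        · have := D.mul_mem_peterson hx.2 hy.2
          rwa [AddMonoidAlgebra.single_mul_single, one_mul, ← neg_add] at this
      neg_mem' := fun {x} hx => ⟨hx.2, by rw [neg_neg]; exact hx.1⟩ }
  have h0 : single (P.coroot θ) 1 ∈ D.peterson Q b θ := by
    have := D.opT_mem_peterson (Q := Q) (b := b) (θ := θ) (Or.inr rfl) D.one_mem_peterson
    rwa [AddMonoidAlgebra.one_def, opT_single, map_one, affineReflect_eq, map_zero, zero_sub,
      one_smul, coroot_reflectionPerm_self, neg_neg] at this
  have hL : L = ⊤ := by
    refine eq_top_of_mem_coroot hirr hsc hθ L ⟨h0, ?_⟩ fun i l hl => ⟨?_, ?_⟩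
    · have := D.tau_mem_peterson θ h0
      rwa [tau_single, map_one, RootPairing.coreflection_apply_self] at this
    · have := D.tau_mem_peterson i hl.1
      rwa [tau_single, map_one] at this
    · have := D.tau_mem_peterson i hl.2
      rwa [tau_single, map_one, map_neg] at this
  exact (show l ∈ L from hL ▸ AddSubgroup.mem_top l).1

end ReflDatum

end ReflDatum

end Peterson
end

-- Localisation at the primes x_α.

noncomputable section

namespace Peterson

namespace ReflDatum

open AddMonoidAlgebra (single)

variable {ι M N : Type*} [AddCommGroup M] [AddCommGroup N]
variable {P : RootPairing ι ℤ M N} {S : Type*} [CommRing S] (D : ReflDatum P S)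

/-- The elements `x_α` are primes, not associated except for opposite roots, and
`1/x_α + 1/x_{-α}` is integral. -/
structure IsGood : Prop where
  prime : ∀ i, Prime (D.x i)
  eq_or_eq : ∀ i j, D.x i ∣ D.x j → j = i ∨ j = P.reflectionPerm i i
  dvd_add : ∀ i, D.x i * D.x (P.reflectionPerm i i) ∣ D.x i + D.x (P.reflectionPerm i i)

variable {D}
variable {Q : Type*} [CommRing Q] [Algebra S Q] [IsLocalization D.denom Q]

theorem dvd_neg (i : ι) : D.x i ∣ D.x (P.reflectionPerm i i) := by
  have := D.neg_dvd (P.reflectionPerm i i)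
  rwa [reflectionPerm_self_self] at this

theorem IsGood.algebraMap_injective [IsDomain S] (hD : D.IsGood) :
    Function.Injective (algebraMap S Q) := by
  refine IsLocalization.injective Q (M := D.denom) (Submonoid.closure_le.2 ?_)
  rintro _ ⟨i, rfl⟩
  exact mem_nonZeroDivisors_of_ne_zero (hD.prime i).ne_zero

section LocalRing

variable (Q)

/-- The localization of `S` at the prime ideal generated by `x_α`. -/
def localRing (hD : D.IsGood) (i : ι) : Subring Q where
  carrier := {q | ∃ m s, ¬ D.x i ∣ m ∧ algebraMap S Q m * q = algebraMap S Q s}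
  zero_mem' := ⟨1, 0, fun h => (hD.prime i).not_isUnit (isUnit_of_dvd_one h), by simp⟩
  one_mem' := ⟨1, 1, fun h => (hD.prime i).not_isUnit (isUnit_of_dvd_one h), by simp⟩
  add_mem' := by
    rintro q q' ⟨m, s, hm, h⟩ ⟨m', s', hm', h'⟩
    refine ⟨m * m', m' * s + m * s', fun hd => ((hD.prime i).dvd_or_dvd hd).elim hm hm', ?_⟩
    simp only [map_mul, map_add, ← h, ← h']
    ring
  mul_mem' := by
    rintro q q' ⟨m, s, hm, h⟩ ⟨m', s', hm', h'⟩
    refine ⟨m * m', s * s', fun hd => ((hD.prime i).dvd_or_dvd hd).elim hm hm', ?_⟩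
    simp only [map_mul, ← h, ← h']
    ring
  neg_mem' := by
    rintro q ⟨m, s, hm, h⟩
    exact ⟨m, -s, hm, by rw [mul_neg, h, map_neg]⟩

variable {Q} (hD : D.IsGood)

theorem algebraMap_mem_localRing (i : ι) (s : S) : algebraMap S Q s ∈ localRing Q hD i :=
  ⟨1, s, fun h => (hD.prime i).not_isUnit (isUnit_of_dvd_one h), by simp⟩

theorem inv_mem_localRing {i j : ι} (h1 : j ≠ i) (h2 : j ≠ P.reflectionPerm i i) :
    D.inv Q j ∈ localRing Q hD i :=
  ⟨D.x j, 1, fun h => (hD.eq_or_eq i j h).elim h1 h2, by rw [x_mul_inv, map_one]⟩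

theorem localRing_neg (i : ι) : localRing Q hD (P.reflectionPerm i i) = localRing Q hD i := by
  have : ∀ m, D.x (P.reflectionPerm i i) ∣ m ↔ D.x i ∣ m := fun m =>
    ⟨(dvd_neg i).trans, (D.neg_dvd i).trans⟩
  ext q
  exact exists_congr fun m => exists_congr fun s => by rw [this]

theorem sig_mem_localRing {i : ι} (j : ι) {q : Q}
    (h : q ∈ localRing Q hD (P.reflectionPerm j i)) : D.sig Q j q ∈ localRing Q hD i := by
  obtain ⟨m, s, hm, h⟩ := h
  refine ⟨D.σ j m, D.σ j s, fun hd => hm ?_, ?_⟩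
  · have := map_dvd (D.σ j) hd
    rwa [D.σ_x, D.σ_σ] at this
  · rw [← sig_algebraMap, ← map_mul, h, sig_algebraMap]

theorem sig_self_mem_localRing {i : ι} {q : Q} (h : q ∈ localRing Q hD i) :
    D.sig Q i q ∈ localRing Q hD i :=
  sig_mem_localRing hD i (by rwa [localRing_neg])

/-- Quotient rule: for q = s/m, with s - σs = x u and m - σm = x v, one has (q - σq)/x = (u m - s
v)/(m σm), and x divides neither m nor σm. -/
theorem inv_mul_sub_mem_localRing {i : ι} {q : Q} (h : q ∈ localRing Q hD i) :
    D.inv Q i * (q - D.sig Q i q) ∈ localRing Q hD i := by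
  obtain ⟨m, s, hm, h⟩ := h
  have hm' : ¬ D.x i ∣ D.σ i m := fun hd => hm (by
    have := map_dvd (D.σ i) hd
    rw [D.σ_x, D.σ_σ] at this
    exact (dvd_neg i).trans this)
  have h' : algebraMap S Q (D.σ i m) * D.sig Q i q = algebraMap S Q (D.σ i s) := by
    rw [← sig_algebraMap, ← map_mul, h, sig_algebraMap]
  obtain ⟨u, hu⟩ := D.dvd_sub i s
  obtain ⟨v, hv⟩ := D.dvd_sub i m
  refine ⟨m * D.σ i m, u * m - s * v, fun hd => ((hD.prime i).dvd_or_dvd hd).elim hm hm', ?_⟩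
  have hu' := congrArg (algebraMap S Q) hu
  have hv' := congrArg (algebraMap S Q) hv
  simp only [map_sub, map_mul] at hu' hv' ⊢
  have hx := D.x_mul_inv (Q := Q) i
  linear_combination (D.inv Q i * algebraMap S Q (D.σ i m)) * h -
    (D.inv Q i * algebraMap S Q m) * h' + (D.inv Q i * algebraMap S Q m) * hu' -
    (D.inv Q i * algebraMap S Q s) * hv' +
    (algebraMap S Q u * algebraMap S Q m - algebraMap S Q s * algebraMap S Q v) * hx

/-- S is the intersection in 𝒬 of its localisations at the x_α. A denominator is a product of x_α,
and primality removes its factors one at a time. -/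
theorem exists_eq_algebraMap_of_forall_mem [IsDomain S] {q : Q}
    (h : ∀ i, q ∈ localRing Q hD i) : ∃ s, q = algebraMap S Q s := by
  have key : ∀ m ∈ D.denom, ∀ s, algebraMap S Q m * q = algebraMap S Q s →
      ∃ s, q = algebraMap S Q s := by
    intro m hm
    induction hm using Submonoid.closure_induction_left with
    | one => intro s hs; exact ⟨s, by rwa [map_one, one_mul] at hs⟩
    | mul_left x hx m _ ih =>
      obtain ⟨i, rfl⟩ := hx
      intro s hs
      obtain ⟨m', s', hm', h'⟩ := h i
      have h1 : D.x i * (m * s') = m' * s := by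
        apply hD.algebraMap_injective (Q := Q)
        rw [map_mul, map_mul, map_mul, ← h', ← hs, map_mul]
        ring
      obtain ⟨t, rfl⟩ := ((hD.prime i).dvd_or_dvd ⟨_, h1.symm⟩).resolve_left hm'
      refine ih t ?_
      have hx := D.x_mul_inv (Q := Q) i
      rw [map_mul, map_mul] at hs
      linear_combination D.inv Q i * hs -
        (algebraMap S Q m * q - algebraMap S Q t) * hx
  obtain ⟨⟨s, m⟩, hs⟩ := IsLocalization.surj D.denom q
  exact key m m.2 s (by rw [mul_comm]; exact hs)

end LocalRing

section LocalModule

variable (Q)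

/-- The element `(1 - η_{t_{α^∨}}) / x_α` of the group algebra of the coroot lattice. -/
def rootElt (D : ReflDatum P S) [IsLocalization D.denom Q] (i : ι) : AddMonoidAlgebra Q N :=
  D.inv Q i • (1 - single (P.coroot i) 1)

/-- The analogue of the Peterson subalgebra for the root `α`, over the localization of `S` at the
prime ideal generated by `x_α`. -/
def localModule (hD : D.IsGood) (i : ι) : Subring (AddMonoidAlgebra Q N) :=
  Subring.closure ({a | ∃ l, ∃ q ∈ localRing Q hD i, a = single l q} ∪ {rootElt Q D i})

variable {Q} (hD : D.IsGood)

theorem single_mem_localModule {i : ι} (l : N) {q : Q} (h : q ∈ localRing Q hD i) :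
    single l q ∈ localModule Q hD i :=
  Subring.subset_closure (Or.inl ⟨l, q, h, rfl⟩)

theorem rootElt_mem_localModule (i : ι) : rootElt Q D i ∈ localModule Q hD i :=
  Subring.subset_closure (Or.inr rfl)

theorem smul_mem_localModule {i : ι} {q : Q} (h : q ∈ localRing Q hD i)
    {a : AddMonoidAlgebra Q N} (ha : a ∈ localModule Q hD i) : q • a ∈ localModule Q hD i := by
  have := (localModule Q hD i).mul_mem (single_mem_localModule hD 0 h) ha
  have h0 : single 0 q = q • (1 : AddMonoidAlgebra Q N) := by
    rw [AddMonoidAlgebra.one_def, AddMonoidAlgebra.smul_single, smul_eq_mul, mul_one]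
  rwa [h0, smul_mul_assoc, one_mul] at this

theorem localModule_neg_le (i : ι) :
    localModule Q hD (P.reflectionPerm i i) ≤ localModule Q hD i := by
  refine Subring.closure_le.2 ?_
  rintro _ (⟨l, q, hq, rfl⟩ | rfl)
  · rw [localRing_neg] at hq
    exact single_mem_localModule hD l hq
  · obtain ⟨s, hs⟩ := D.exists_inv_neg (Q := Q) i
    have : rootElt Q D (P.reflectionPerm i i) =
        -(single (-P.coroot i) (algebraMap S Q s) * rootElt Q D i) := by
      rw [rootElt, rootElt, hs, coroot_reflectionPerm_self, mul_smul_comm, mul_sub, mul_one,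
        AddMonoidAlgebra.single_mul_single, mul_one, neg_add_cancel, AddMonoidAlgebra.one_def]
      simp only [smul_sub, AddMonoidAlgebra.smul_single, smul_eq_mul, one_mul, mul_comm,
          neg_sub]
    rw [SetLike.mem_coe, this]
    exact neg_mem (mul_mem (single_mem_localModule hD _ (algebraMap_mem_localRing hD i s))
      (rootElt_mem_localModule hD i))

theorem localModule_neg (i : ι) :
    localModule Q hD (P.reflectionPerm i i) = localModule Q hD i := by
  refine le_antisymm (localModule_neg_le hD i) ?_
  have := localModule_neg_le (Q := Q) hD (P.reflectionPerm i i)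
  rwa [reflectionPerm_self_self] at this

theorem tau_mem_localModule {i : ι} (j : ι) {a : AddMonoidAlgebra Q N}
    (ha : a ∈ localModule Q hD (P.reflectionPerm j i)) : D.tau Q j a ∈ localModule Q hD i := by
  have : localModule Q hD (P.reflectionPerm j i) ≤ (localModule Q hD i).comap (D.tau Q j) := by
    refine Subring.closure_le.2 ?_
    rintro _ (⟨l, q, hq, rfl⟩ | rfl)
    · rw [SetLike.mem_coe, Subring.mem_comap, tau_single]
      exact single_mem_localModule hD _ (sig_mem_localRing hD j hq)
    · rw [SetLike.mem_coe, Subring.mem_comap, rootElt, tau_smul, map_sub, map_one, tau_single,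
        sig_inv, map_one, RootPairing.coroot_reflectionPerm, RootPairing.coreflection_same,
        RootPairing.reflectionPerm_self]
      exact rootElt_mem_localModule hD i
  exact this ha

theorem tau_self_mem_localModule {i : ι} {a : AddMonoidAlgebra Q N}
    (ha : a ∈ localModule Q hD i) : D.tau Q i a ∈ localModule Q hD i :=
  tau_mem_localModule hD i (by rwa [localModule_neg])

theorem inv_smul_one_sub_mem_localModule (i : ι) (n : ℤ) :
    D.inv Q i • (1 - single (n • P.coroot i) 1) ∈ localModule Q hD i := by
  have step : ∀ n : ℤ, D.inv Q i • (1 - single ((n + 1) • P.coroot i) 1) =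
      D.inv Q i • (1 - single (n • P.coroot i) 1) +
        single (n • P.coroot i) 1 * rootElt Q D i := by
    intro n
    rw [rootElt, mul_smul_comm, ← smul_add, mul_sub, mul_one, AddMonoidAlgebra.single_mul_single,
      mul_one, add_smul, one_smul, sub_add_sub_cancel]
  have hmem : ∀ n : ℤ, single (n • P.coroot i) 1 * rootElt Q D i ∈ localModule Q hD i := fun n =>
    mul_mem (single_mem_localModule hD _ (one_mem _)) (rootElt_mem_localModule hD i)
  induction n using Int.induction_on with
  | zero => rw [zero_smul, ← AddMonoidAlgebra.one_def, sub_self, smul_zero]; exact zero_mem _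
  | succ n ih => rw [step]; exact add_mem ih (hmem _)
  | pred n ih =>
    have := step (-n - 1)
    rw [sub_add_cancel] at this
    rw [← sub_eq_iff_eq_add] at this
    rw [← this]
    exact sub_mem ih (hmem _)

/-- With E = (1 - η)/x_α and 1/x_{-α} = t'/x_α, the operator sends E to (1/x_α + 1/x_{-α}) E + t'
η⁻¹ E². The first coefficient is integral by `dvd_add`; the square of E is why the local module has
to be a ring. -/
theorem op_rootElt_mem_localModule (i : ι) :
    D.op Q (i, 0) (rootElt Q D i) ∈ localModule Q hD i := by
  obtain ⟨s, hs⟩ := hD.dvd_add i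
  obtain ⟨t, ht⟩ := dvd_neg (D := D) i
  have hx := D.x_mul_inv (Q := Q) i
  have hx' := D.x_mul_inv (Q := Q) (P.reflectionPerm i i)
  obtain ⟨t', ht'⟩ := D.exists_inv_neg (Q := Q) i
  have h1 : D.inv Q i + D.inv Q (P.reflectionPerm i i) = algebraMap S Q s := by
    have := congrArg (algebraMap S Q) hs
    rw [map_add, map_mul, map_mul] at this
    linear_combination D.inv Q i * D.inv Q (P.reflectionPerm i i) * this -
      D.inv Q (P.reflectionPerm i i) * hx - D.inv Q i * hx' + algebraMap S Q s * hx' +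
      algebraMap S Q s * algebraMap S Q (D.x (P.reflectionPerm i i)) *
        D.inv Q (P.reflectionPerm i i) * hx
  have h2 : D.op Q (i, 0) (rootElt Q D i) = algebraMap S Q s • rootElt Q D i +
      single (-P.coroot i) (algebraMap S Q t') * rootElt Q D i * rootElt Q D i := by
    have h3 : single (-P.coroot i) (algebraMap S Q t') * rootElt Q D i =
        -(D.inv Q (P.reflectionPerm i i) • (1 - single (-P.coroot i) 1)) := by
      rw [rootElt, ht', mul_smul_comm, mul_sub, mul_one,
        AddMonoidAlgebra.single_mul_single, mul_one, neg_add_cancel, AddMonoidAlgebra.one_def]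
      simp only [smul_sub, AddMonoidAlgebra.smul_single, smul_eq_mul, one_mul, mul_comm,
          neg_sub]
    have h4 : single (P.coroot i) 1 * single (-P.coroot i) 1 = (1 : AddMonoidAlgebra Q N) := by
      rw [AddMonoidAlgebra.single_mul_single, mul_one, add_neg_cancel, AddMonoidAlgebra.one_def]
    rw [h3, ← h1, op, opT_zero, rootElt, tau_smul, map_sub, map_one, tau_single, sig_inv, map_one,
      RootPairing.coreflection_apply_self, add_smul]
    simp only [neg_mul, smul_mul_smul_comm, smul_smul, smul_sub, mul_comm (D.inv Q (P.reflectionPerm i i)),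
      sub_mul, mul_sub, one_mul, mul_one, mul_comm (single (-P.coroot i) (1 : Q)), h4]
    abel
  rw [h2]
  exact add_mem (smul_mem_localModule hD (algebraMap_mem_localRing hD i s)
    (rootElt_mem_localModule hD i)) (mul_mem (mul_mem (single_mem_localModule hD _
      (algebraMap_mem_localRing hD i t')) (rootElt_mem_localModule hD i))
        (rootElt_mem_localModule hD i))

theorem op_self_mem_localModule {i : ι} {a : AddMonoidAlgebra Q N}
    (ha : a ∈ localModule Q hD i) : D.op Q (i, 0) a ∈ localModule Q hD i := by
  induction ha using Subring.closure_induction with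
  | mem a ha =>
    rcases ha with ⟨l, q, hq, rfl⟩ | rfl
    · have : D.op Q (i, 0) (single l q) = single l (D.inv Q i * (q - D.sig Q i q)) +
          single l (D.sig Q i q) *
            (D.inv Q i • (1 - single ((-P.root' i l) • P.coroot i) 1)) := by
        have h3 : single l (D.inv Q i * (q - D.sig Q i q)) =
            D.inv Q i • (single l q - single l (D.sig Q i q)) := by
          rw [← AddMonoidAlgebra.single_sub, AddMonoidAlgebra.smul_single, smul_eq_mul]
        rw [h3, op, opT_zero, tau_single, mul_smul_comm, mul_sub, mul_one,
          AddMonoidAlgebra.single_mul_single, mul_one, RootPairing.coreflection_apply, neg_smul,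
          ← sub_eq_add_neg, ← smul_add, sub_add_sub_cancel]
      rw [this]
      exact add_mem (single_mem_localModule hD _ (inv_mul_sub_mem_localRing hD hq))
        (mul_mem (single_mem_localModule hD _ (sig_self_mem_localRing hD hq))
          (inv_smul_one_sub_mem_localModule hD _ _))
    · exact op_rootElt_mem_localModule hD i
  | zero => rw [op_zero_right]; exact zero_mem _
  | one =>
    rw [op, opT_zero, map_one, sub_self, smul_zero]
    exact zero_mem _
  | add a c _ _ ha hc => rw [op_add]; exact add_mem ha hc
  | neg a _ ha =>
    have : D.op Q (i, 0) (-a) = -D.op Q (i, 0) a := by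
      rw [op, op, map_neg, ← smul_neg]
      congr 1
      abel
    rw [this]
    exact neg_mem ha
  | mul a c ha hc iha ihc =>
    rw [op_mul]
    exact add_mem (mul_mem iha (tau_self_mem_localModule hD hc)) (mul_mem ha ihc)

/-- All local modules enter the hypothesis, since τ moves the one at s_r i to the one at i. If r.1 ≠
±i, then 1/x_{r.1} is integral at x_i. Otherwise the level splits off: X_{(γ,k)} a = X_{(γ,0)} a +
(1 - η_{-kγ^∨})/x_γ · τ a. -/
theorem op_mem_localModule (r : ι × ℤ) {a : AddMonoidAlgebra Q N}
    (ha : ∀ i, a ∈ localModule Q hD i) (i : ι) : D.op Q r a ∈ localModule Q hD i := by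
  by_cases h : r.1 = i ∨ r.1 = P.reflectionPerm i i
  · have hL : localModule Q hD i = localModule Q hD r.1 := by
      rcases h with h | h
      · rw [h]
      · rw [h, localModule_neg]
    have h1 : D.op Q r a = D.op Q (r.1, 0) a +
        D.inv Q r.1 • (1 - single ((-r.2) • P.coroot r.1) 1) * D.tau Q r.1 a := by
      rw [op, op, opT_zero, opT_apply, smul_mul_assoc, ← smul_add, sub_mul, one_mul, neg_smul,
        sub_add_sub_cancel]
    rw [h1, hL]
    exact add_mem (op_self_mem_localModule hD (ha _)) (mul_mem
      (inv_smul_one_sub_mem_localModule hD _ _) (tau_self_mem_localModule hD (ha _)))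
  · rw [not_or] at h
    rw [op, opT_apply]
    exact smul_mem_localModule hD (inv_mem_localRing hD h.1 h.2) (sub_mem (ha i)
      (mul_mem (single_mem_localModule hD _ (one_mem _)) (tau_mem_localModule hD _ (ha _))))

theorem peterson_le_localModule {b : P.Base} {θ : ι} {a : AddMonoidAlgebra Q N}
    (ha : a ∈ D.peterson Q b θ) (i : ι) : a ∈ localModule Q hD i := by
  let C : Submodule S (AddMonoidAlgebra Q N) :=
    { carrier := {a | ∀ i, a ∈ localModule Q hD i}
      zero_mem' := fun i => zero_mem _
      add_mem' := fun h h' i => add_mem (h i) (h' i)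
      smul_mem' := fun s a h i => by
        rw [← algebraMap_smul Q s a]
        exact smul_mem_localModule hD (algebraMap_mem_localRing hD i s) (h i) }
  have : D.peterson Q b θ ≤ C :=
    D.peterson_le (fun i => one_mem _) fun r _ a h i => op_mem_localModule hD r h i
  exact this ha i

end LocalModule

end ReflDatum

end Peterson
end

-- Taylor coefficients along coroot lines, and the triangular basis.

noncomputable section

namespace Peterson

namespace ReflDatum

open AddMonoidAlgebra (single)

variable {ι M N : Type*} [AddCommGroup M] [AddCommGroup N] {P : RootPairing ι ℤ M N}

section Taylor

variable (P) in
open Classical in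
/-- The binomial coefficient `(k choose n)` of an element `k α^∨`, and zero off the line through
`α^∨`. -/
def lineChoose (i : ι) (n : ℕ) (d : N) : ℤ :=
  if ∃ k : ℤ, d = k • P.coroot i then Ring.choose (P.root' i d / 2) n else 0

theorem lineChoose_smul (i : ι) (n : ℕ) (k : ℤ) :
    lineChoose P i n (k • P.coroot i) = Ring.choose k n := by
  rw [lineChoose, if_pos ⟨k, rfl⟩, map_smul, RootPairing.root'_coroot_eq_pairing,
    RootPairing.pairing_same, smul_eq_mul, Int.mul_ediv_cancel _ (by norm_num)]

theorem lineChoose_of_forall_ne {i : ι} {d : N} (h : ∀ k : ℤ, d ≠ k • P.coroot i) (n : ℕ) :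
    lineChoose P i n d = 0 :=
  if_neg (by simpa using h)

theorem lineChoose_zero_add (i : ι) (d : N) :
    lineChoose P i 0 (d + P.coroot i) = lineChoose P i 0 d := by
  by_cases h : ∃ k : ℤ, d = k • P.coroot i
  · obtain ⟨k, rfl⟩ := h
    rw [← add_one_zsmul, lineChoose_smul, lineChoose_smul, Ring.choose_zero_right,
      Ring.choose_zero_right]
  · rw [lineChoose_of_forall_ne (not_exists.1 h), lineChoose_of_forall_ne]
    intro k hk
    exact h ⟨k - 1, by rw [sub_smul, one_smul, ← hk, add_sub_cancel_right]⟩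

theorem lineChoose_succ_add (i : ι) (n : ℕ) (d : N) :
    lineChoose P i (n + 1) (d + P.coroot i) = lineChoose P i (n + 1) d + lineChoose P i n d := by
  by_cases h : ∃ k : ℤ, d = k • P.coroot i
  · obtain ⟨k, rfl⟩ := h
    rw [← add_one_zsmul, lineChoose_smul, lineChoose_smul, lineChoose_smul,
      Ring.choose_succ_succ, add_comm]
  · rw [lineChoose_of_forall_ne (not_exists.1 h), lineChoose_of_forall_ne (not_exists.1 h),
      lineChoose_of_forall_ne, add_zero]
    intro k hk
    exact h ⟨k - 1, by rw [sub_smul, one_smul, ← hk, add_sub_cancel_right]⟩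

variable {Q : Type*} [CommRing Q]

variable (P) in
/-- The Taylor coefficient of order `n`, at the identity of the torus dual to `α^∨`, of the part
of an element of the group algebra which is supported on the line `l + ℤ α^∨`. -/
def taylor (i : ι) (n : ℕ) (l : N) (a : AddMonoidAlgebra Q N) : Q :=
  a.coeff.sum fun m q => (lineChoose P i n (m - l) : Q) * q

theorem taylor_single (i : ι) (n : ℕ) (l m : N) (q : Q) :
    taylor P i n l (single m q) = (lineChoose P i n (m - l) : Q) * q := by
  rw [taylor, AddMonoidAlgebra.coeff_single, Finsupp.sum_single_index (mul_zero _)]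

theorem taylor_zero (i : ι) (n : ℕ) (l : N) : taylor P i n l (0 : AddMonoidAlgebra Q N) = 0 := by
  rw [taylor, AddMonoidAlgebra.coeff_zero, Finsupp.sum_zero_index]

theorem taylor_add (i : ι) (n : ℕ) (l : N) (a c : AddMonoidAlgebra Q N) :
    taylor P i n l (a + c) = taylor P i n l a + taylor P i n l c := by
  rw [taylor, AddMonoidAlgebra.coeff_add, Finsupp.sum_add_index' (fun _ => mul_zero _)
    fun _ _ _ => mul_add _ _ _]
  rfl

theorem taylor_neg (i : ι) (n : ℕ) (l : N) (a : AddMonoidAlgebra Q N) :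
    taylor P i n l (-a) = -taylor P i n l a := by
  rw [eq_neg_iff_add_eq_zero, ← taylor_add, neg_add_cancel, taylor_zero]

theorem taylor_single_mul (i : ι) (n : ℕ) (l m : N) (q : Q) (a : AddMonoidAlgebra Q N) :
    taylor P i n l (single m q * a) = q * taylor P i n (l - m) a := by
  induction a using AddMonoidAlgebra.induction_linear with
  | zero => simp [taylor_zero]
  | add a c ha hc => rw [mul_add, taylor_add, ha, hc, taylor_add, mul_add]
  | single m' p =>
    rw [AddMonoidAlgebra.single_mul_single, taylor_single, taylor_single,
      show m + m' - l = m' - (l - m) by abel]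
    ring

theorem taylor_zero_sub_coroot (i : ι) (l : N) (a : AddMonoidAlgebra Q N) :
    taylor P i 0 (l - P.coroot i) a = taylor P i 0 l a := by
  induction a using AddMonoidAlgebra.induction_linear with
  | zero => simp [taylor_zero]
  | add a c ha hc => rw [taylor_add, ha, hc, taylor_add]
  | single m p =>
    rw [taylor_single, taylor_single, show m - (l - P.coroot i) = m - l + P.coroot i by abel,
      lineChoose_zero_add]

theorem taylor_succ_sub_coroot (i : ι) (n : ℕ) (l : N) (a : AddMonoidAlgebra Q N) :
    taylor P i (n + 1) (l - P.coroot i) a = taylor P i (n + 1) l a + taylor P i n l a := by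
  induction a using AddMonoidAlgebra.induction_linear with
  | zero => simp [taylor_zero]
  | add a c ha hc => rw [taylor_add, ha, hc, taylor_add, taylor_add]; ring
  | single m p =>
    rw [taylor_single, taylor_single, taylor_single,
      show m - (l - P.coroot i) = m - l + P.coroot i by abel, lineChoose_succ_add]
    push_cast
    ring

variable {S : Type*} [CommRing S] {D : ReflDatum P S} [Algebra S Q] [IsLocalization D.denom Q]

/-- Multiplication by (1 - η)/x replaces x^{n+1} times the coefficient of order n + 1 by -x^n times
that of order n, and kills the coefficient of order 0. The bound is thus preserved by multiplication
by every generator of the local module, and it holds for 1. -/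
theorem taylor_mem_localRing (hD : D.IsGood) {i : ι} {a : AddMonoidAlgebra Q N}
    (ha : a ∈ localModule Q hD i) (n : ℕ) (l : N) :
    algebraMap S Q (D.x i) ^ n * taylor P i n l a ∈ localRing Q hD i := by
  have hx : algebraMap S Q (D.x i) ∈ localRing Q hD i := algebraMap_mem_localRing hD i _
  have key : ∀ c : AddMonoidAlgebra Q N,
      (∀ n l, algebraMap S Q (D.x i) ^ n * taylor P i n l c ∈ localRing Q hD i) →
      ∀ n l, algebraMap S Q (D.x i) ^ n * taylor P i n l (a * c) ∈ localRing Q hD i := by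
    induction ha using Subring.closure_induction with
    | mem a ha =>
      intro c hc n l
      rcases ha with ⟨m, q, hq, rfl⟩ | rfl
      · rw [taylor_single_mul, mul_left_comm]
        exact mul_mem hq (hc _ _)
      · have hr : rootElt Q D i = single 0 (D.inv Q i) + -single (P.coroot i) (D.inv Q i) := by
          rw [rootElt, AddMonoidAlgebra.one_def, smul_sub, AddMonoidAlgebra.smul_single,
            AddMonoidAlgebra.smul_single, smul_eq_mul, mul_one, sub_eq_add_neg]
        rw [hr, add_mul, taylor_add, neg_mul, taylor_neg, taylor_single_mul, taylor_single_mul,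
          sub_zero]
        cases n with
        | zero => rw [taylor_zero_sub_coroot, add_neg_cancel, mul_zero]; exact zero_mem _
        | succ n =>
          have : algebraMap S Q (D.x i) ^ (n + 1) * (D.inv Q i * taylor P i (n + 1) l c +
              -(D.inv Q i * taylor P i (n + 1) (l - P.coroot i) c)) =
              -(algebraMap S Q (D.x i) ^ n * taylor P i n l c) := by
            rw [taylor_succ_sub_coroot]
            linear_combination (-algebraMap S Q (D.x i) ^ n * taylor P i n l c) *
              D.x_mul_inv (Q := Q) i
          rw [this]
          exact neg_mem (hc _ _)
    | zero => intro c _ n l; rw [zero_mul, taylor_zero, mul_zero]; exact zero_mem _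
    | one => intro c hc; rwa [one_mul]
    | add a a' _ _ h h' =>
      intro c hc n l
      rw [add_mul, taylor_add, mul_add]
      exact add_mem (h c hc n l) (h' c hc n l)
    | neg a _ h =>
      intro c hc n l
      rw [neg_mul, taylor_neg, mul_neg]
      exact neg_mem (h c hc n l)
    | mul a a' _ _ h h' => intro c hc; rw [mul_assoc]; exact h _ (h' c hc)
  have h1 := key 1 (fun n l => by
    rw [AddMonoidAlgebra.one_def, taylor_single, mul_one]
    exact mul_mem (pow_mem hx n) (intCast_mem _ _)) n l
  rwa [mul_one] at h1

/-- Seen from l - nα^∨, the support on the line lies in positions 0, …, n. There (k choose n)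
vanishes except at k = n, so the n-th Taylor coefficient is the coefficient at l. -/
theorem pow_mul_coeff_mem_localRing (hD : D.IsGood) {i : ι} {a : AddMonoidAlgebra Q N}
    (ha : a ∈ localModule Q hD i) {l : N} {n : ℕ}
    (h : ∀ j : ℤ, a.coeff (l + j • P.coroot i) ≠ 0 → -(n : ℤ) ≤ j ∧ j ≤ 0) :
    algebraMap S Q (D.x i) ^ n * a.coeff l ∈ localRing Q hD i := by
  have h1 := taylor_mem_localRing hD ha n (l - (n : ℤ) • P.coroot i)
  have h2 : taylor P i n (l - (n : ℤ) • P.coroot i) a = a.coeff l := by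
    rw [taylor, Finsupp.sum, Finset.sum_eq_single l]
    · rw [sub_sub_cancel, lineChoose_smul, Ring.choose_natCast, Nat.choose_self, Nat.cast_one,
        Int.cast_one, one_mul]
    · intro m hm hml
      by_cases hk : ∃ k : ℤ, m - (l - (n : ℤ) • P.coroot i) = k • P.coroot i
      · obtain ⟨k, hk⟩ := hk
        have hm' : m = l + (k - n) • P.coroot i := by
          rw [sub_smul, ← hk]; abel
        have h3 := h (k - n) (by rw [← hm']; exact Finsupp.mem_support_iff.1 hm)
        have h4 : k ≠ n := by
          rintro rfl
          exact hml (by rw [hm', sub_self, zero_smul, add_zero])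
        obtain ⟨k, rfl⟩ : ∃ k' : ℕ, k = k' := ⟨k.toNat, by omega⟩
        rw [hk, lineChoose_smul, Ring.choose_natCast, Nat.choose_eq_zero_of_lt (by omega),
          Nat.cast_zero, Int.cast_zero, zero_mul]
      · rw [lineChoose_of_forall_ne (not_exists.1 hk), Int.cast_zero, zero_mul]
    · intro hl
      rw [Finsupp.notMem_support_iff.1 hl, mul_zero]
  rwa [h2] at h1

end Taylor

-- Leading denominators and the basis of the Peterson module.

section Triangular

variable [Fintype ι] {S : Type*} [CommRing S] (D : ReflDatum P S) (b : P.Base)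

/-- The product of the `x_α` over the affine reflections which separate `l` from `0`. -/
def leadDenom (l : N) : S := ∏ i, D.x i ^ inversions b i l

variable {D b} {Q : Type*} [CommRing Q] [Algebra S Q] [IsLocalization D.denom Q]

/-- By `string_window`, for ⟨i, l⟩ ≥ 0 the support on l + ℤ α_i^∨ lies in a window of width equal to
the inversion count of -i, so this power of x_i clears the pole at x_i. It divides `leadDenom`
because x_i divides x_{-i}. Roots with ⟨i, l⟩ ≤ 0 are replaced by their opposites, and integrality
at every x_i gives an element of S. -/
theorem exists_leadDenom_mul_coeff [IsDomain S] (hD : D.IsGood) {a : AddMonoidAlgebra Q N}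
    (ha : ∀ i, a ∈ localModule Q hD i) {l : N} (h : ∀ m, a.coeff m ≠ 0 → rank b m ≤ rank b l) :
    ∃ s, algebraMap S Q (D.leadDenom b l) * a.coeff l = algebraMap S Q s := by
  have key : ∀ i, 0 ≤ P.root' i l → algebraMap S Q (D.leadDenom b l) * a.coeff l ∈
      localRing Q hD i := by
    intro i hi
    have h1 := pow_mul_coeff_mem_localRing hD (ha i) (l := l)
      fun j hj => string_window (b := b) hi (h _ hj)
    have h2 : D.x i ^ inversions b (P.reflectionPerm i i) l ∣ D.leadDenom b l :=
      (pow_dvd_pow_of_dvd (dvd_neg i) _).trans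
        (Finset.dvd_prod_of_mem (fun i => D.x i ^ inversions b i l) (Finset.mem_univ _))
    obtain ⟨s, hs⟩ := h2
    rw [hs, map_mul, map_pow, mul_right_comm]
    exact mul_mem h1 (algebraMap_mem_localRing hD i s)
  obtain ⟨s, hs⟩ := exists_eq_algebraMap_of_forall_mem hD (fun i => by
    rcases le_total 0 (P.root' i l) with hi | hi
    · exact key i hi
    · rw [← localRing_neg]
      exact key _ (by rw [root'_reflectionPerm_self]; omega))
  exact ⟨s, hs⟩

omit [Fintype ι] in
theorem coeff_opT (r : ι × ℤ) (a : AddMonoidAlgebra Q N) (l : N) :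
    (D.opT Q r a).coeff l = D.sig Q r.1 (a.coeff (affineReflect P r l)) := by
  induction a using AddMonoidAlgebra.induction_linear with
  | zero => simp
  | add a c ha hc => simp only [map_add, AddMonoidAlgebra.coeff_add, Finsupp.add_apply, ha, hc]
  | single m q =>
    classical
    rw [opT_single, AddMonoidAlgebra.coeff_single, AddMonoidAlgebra.coeff_single,
      Finsupp.single_apply, Finsupp.single_apply]
    have : affineReflect P r m = l ↔ m = affineReflect P r l :=
      ⟨fun h => by rw [← h, affineReflect_affineReflect],
        fun h => by rw [h, affineReflect_affineReflect]⟩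
    simp only [this]
    split_ifs
    · rfl
    · rw [map_zero]

theorem leadDenom_zero : D.leadDenom b 0 = 1 :=
  Finset.prod_eq_one fun i _ => by rw [inversions_zero, pow_zero]

variable {θ : ι} [P.IsReduced]

theorem leadDenom_affineReflect (hθ : IsHighestRoot b θ) {r : ι × ℤ} (hr : IsSimpleAffine b θ r)
    {l : N} (h : 0 < affineEval P r l) :
    D.leadDenom b (affineReflect P r l) = D.x r.1 * D.σ r.1 (D.leadDenom b l) := by
  classical
  have h1 : ∀ i, inversions b i (affineReflect P r l) =
      inversions b (P.reflectionPerm r.1 i) l + if i = r.1 then 1 else 0 := by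
    intro i
    obtain ⟨h2, h3, h4⟩ := inversions_affineReflect_self hθ hr h
    split_ifs with hi
    · rw [hi, h3]
    · by_cases hi' : i = P.reflectionPerm r.1 r.1
      · rw [hi', h4, RootPairing.reflectionPerm_self, h2]
      · rw [add_zero, ← inversions_affineReflect hθ hr (i := P.reflectionPerm r.1 i)
          (fun h => hi' ((P.reflectionPerm_self r.1 i).symm.trans (congrArg (P.reflectionPerm r.1) h)))
          (fun h => hi ((P.reflectionPerm r.1).injective h)), RootPairing.reflectionPerm_self]
  simp only [leadDenom, map_prod, map_pow, D.σ_x]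
  rw [← Equiv.prod_comp (P.reflectionPerm r.1)
    (fun i => D.x (P.reflectionPerm r.1 i) ^ inversions b i l)]
  simp only [RootPairing.reflectionPerm_self, h1, pow_add, Finset.prod_mul_distrib]
  rw [mul_comm]
  congr 1
  simp [Finset.prod_ite_eq']

/-- Induction on the rank: l ≠ 0 is s_r l₀ with l₀ below l, and c_l = -X_r(c_{l₀}). As c_{l₀} has no
coefficient at l, the leading coefficient of c_l is the reflected one of c_{l₀} divided by x_r, in
accordance with `leadDenom_affineReflect`. `BruhatLE.reflect` bounds the support. -/
theorem exists_peterson_leading (hirr : IsIrreducibleDatum P) (hsc : IsSimplyConnectedDatum P)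
    (hθ : IsHighestRoot b θ) (l : N) : ∃ c ∈ D.peterson Q b θ,
      algebraMap S Q (D.leadDenom b l) * c.coeff l = 1 ∧ ∀ m, c.coeff m ≠ 0 → BruhatLE b m l := by
  induction hn : rank b l using Nat.strong_induction_on generalizing l with
  | _ n ih =>
    subst hn
    by_cases hl : l = 0
    · subst hl
      refine ⟨1, D.one_mem_peterson, ?_, fun m hm => ?_⟩
      · rw [leadDenom_zero, map_one, one_mul, AddMonoidAlgebra.one_def,
          AddMonoidAlgebra.coeff_single, Finsupp.single_eq_same]
      · rw [AddMonoidAlgebra.one_def, AddMonoidAlgebra.coeff_single] at hm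
        obtain rfl : m = 0 := by
          by_contra h
          exact hm (Finsupp.single_eq_of_ne h)
        exact Relation.ReflTransGen.refl
    · obtain ⟨r, hr, hrl⟩ := exists_isSimpleAffine_neg hirr hsc hθ hl
      obtain ⟨l, rfl⟩ : ∃ l₀, l = affineReflect P r l₀ := ⟨_, (affineReflect_affineReflect r l).symm⟩
      rw [affineEval_affineReflect_self, neg_neg_iff_pos] at hrl
      have hstep : BruhatStep b l (affineReflect P r l) := ⟨r, hr.isPosAffine, hrl, rfl⟩
      obtain ⟨c, hc, h1, h2⟩ := ih _ hstep.rank_lt l rfl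
      have hcoeff : ∀ m, (-D.op Q r c).coeff m =
          D.inv Q r.1 * (D.sig Q r.1 (c.coeff (affineReflect P r m)) - c.coeff m) := by
        intro m
        rw [op, ← smul_neg, neg_sub, AddMonoidAlgebra.coeff_smul, Finsupp.smul_apply, smul_eq_mul,
          AddMonoidAlgebra.coeff_sub, Finsupp.sub_apply, coeff_opT]
      refine ⟨-D.op Q r c, neg_mem (D.op_mem_peterson hr hc), ?_, fun m hm => ?_⟩
      · have h3 : c.coeff (affineReflect P r l) = 0 := by
          by_contra h
          rcases (h2 _ h).eq_or_rank_lt with h | h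
          · exact hstep.rank_lt.ne (by rw [h])
          · exact hstep.rank_lt.not_gt h
        rw [hcoeff, h3, sub_zero, affineReflect_affineReflect, leadDenom_affineReflect hθ hr hrl,
          map_mul, ← sig_algebraMap, mul_mul_mul_comm, x_mul_inv, one_mul, ← map_mul, h1, map_one]
      · rw [hcoeff] at hm
        by_cases h4 : c.coeff m = 0
        · rw [h4, sub_zero] at hm
          have h5 := (h2 (affineReflect P r m) (fun h => hm (by rw [h, map_zero, mul_zero]))).reflect
            hθ hr hrl.le
          rwa [affineReflect_affineReflect] at h5
        · exact (h2 m h4).tail hstep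

omit [P.IsReduced] in
-- Elimination from the top rank n: all the terms s_l c_l with l of rank n are subtracted at once,
-- where s_l ∈ S is `leadDenom` times the coefficient at l. Distinct elements of equal rank are
-- incomparable, so these terms do not interfere.
theorem peterson_le_span [IsDomain S] (hD : D.IsGood) {c : N → AddMonoidAlgebra Q N}
    (hc : ∀ l, c l ∈ D.peterson Q b θ)
    (h1 : ∀ l, algebraMap S Q (D.leadDenom b l) * (c l).coeff l = 1)
    (h2 : ∀ l m, (c l).coeff m ≠ 0 → BruhatLE b m l) :
    D.peterson Q b θ ≤ Submodule.span S (Set.range c) := by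
  classical
  have key : ∀ n, ∀ a ∈ D.peterson Q b θ, (∀ m, a.coeff m ≠ 0 → rank b m < n) →
      a ∈ Submodule.span S (Set.range c) := by
    intro n
    induction n with
    | zero =>
      intro a _ h
      have : a = 0 := by
        ext m
        by_contra hm
        exact absurd (h m hm) (Nat.not_lt_zero _)
      rw [this]
      exact zero_mem _
    | succ n ih =>
      intro a ha h
      have hs : ∀ l, rank b l = n →
          ∃ s, algebraMap S Q (D.leadDenom b l) * a.coeff l = algebraMap S Q s := fun l hl =>
        exists_leadDenom_mul_coeff hD (fun i => peterson_le_localModule hD ha i)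
          fun m hm => by rw [hl]; exact Nat.lt_succ_iff.1 (h m hm)
      choose! s hs using hs
      let A := a.coeff.support.filter fun l => rank b l = n
      have hA : ∑ l ∈ A, s l • c l ∈ Submodule.span S (Set.range c) :=
        sum_mem fun l _ => Submodule.smul_mem _ _ (Submodule.subset_span ⟨l, rfl⟩)
      have hA' : ∑ l ∈ A, s l • c l ∈ D.peterson Q b θ :=
        sum_mem fun l _ => Submodule.smul_mem _ _ (hc l)
      rw [← sub_add_cancel a (∑ l ∈ A, s l • c l)]
      refine add_mem (ih _ (sub_mem ha hA') fun m hm => ?_) hA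
      by_contra! hmn
      apply hm
      have h3 : ∀ l ∈ A, l ≠ m → (s l • c l).coeff m = 0 := by
        intro l hl hlm
        rw [AddMonoidAlgebra.coeff_smul, Finsupp.smul_apply]
        have : (c l).coeff m = 0 := by
          by_contra h
          rcases (h2 l m h).eq_or_rank_lt with h | h
          · exact hlm h.symm
          · rw [(Finset.mem_filter.1 hl).2] at h
            omega
        rw [this, smul_zero]
      rw [AddMonoidAlgebra.coeff_sub, AddMonoidAlgebra.coeff_sum, Finsupp.sub_apply,
        Finsupp.finsetSum_apply]
      by_cases hm' : m ∈ A
      · rw [Finset.sum_eq_single m (fun l hl hlm => h3 l hl hlm) (fun h => absurd hm' h),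
          AddMonoidAlgebra.coeff_smul, Finsupp.smul_apply, Algebra.smul_def,
          ← hs m (Finset.mem_filter.1 hm').2, mul_right_comm, h1, one_mul, sub_self]
      · rw [Finset.sum_eq_zero (fun l hl => h3 l hl (by rintro rfl; exact hm' hl)), sub_zero]
        by_contra h4
        exact hm' (Finset.mem_filter.2 ⟨Finsupp.mem_support_iff.2 h4,
          le_antisymm (Nat.lt_succ_iff.1 (h m h4)) hmn⟩)
  intro a ha
  refine key (a.coeff.support.sup (rank b) + 1) a ha fun m hm => ?_
  exact Nat.lt_succ_of_le (Finset.le_sup (f := rank b) (Finsupp.mem_support_iff.2 hm))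

end Triangular

section TriangularBasis

variable [Fintype ι] {b : P.Base} {Q : Type*} [CommRing Q] {c : N → AddMonoidAlgebra Q N}

theorem linearIndependent_of_triangular (h1 : ∀ l, IsUnit ((c l).coeff l))
    (h2 : ∀ l m, (c l).coeff m ≠ 0 → BruhatLE b m l) : LinearIndependent Q c := by
  rw [linearIndependent_iff]
  intro f hf
  by_contra hne
  obtain ⟨l, hl, hmax⟩ := Finset.exists_max_image f.support (rank b)
    (Finsupp.support_nonempty_iff.2 hne)
  have h3 := congrArg (fun a : AddMonoidAlgebra Q N => a.coeff l) hf
  simp only [Finsupp.linearCombination_apply, Finsupp.sum, AddMonoidAlgebra.coeff_sum,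
    Finsupp.finsetSum_apply, AddMonoidAlgebra.coeff_smul, Finsupp.smul_apply, smul_eq_mul,
    AddMonoidAlgebra.coeff_zero, Finsupp.zero_apply] at h3
  rw [Finset.sum_eq_single l (fun m hm hml => ?_) (fun h => absurd hl h)] at h3
  · exact Finsupp.mem_support_iff.1 hl ((h1 l).mul_left_eq_zero.1 h3)
  · have : (c m).coeff l = 0 := by
      by_contra h
      rcases (h2 m l h).eq_or_rank_lt with h | h
      · exact hml h.symm
      · exact (hmax m hm).not_gt h
    rw [this, mul_zero]

theorem span_eq_top_of_triangular (h1 : ∀ l, IsUnit ((c l).coeff l))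
    (h2 : ∀ l m, (c l).coeff m ≠ 0 → BruhatLE b m l) : Submodule.span Q (Set.range c) = ⊤ := by
  have key : ∀ n, ∀ l, rank b l = n → ∀ q, single l q ∈ Submodule.span Q (Set.range c) := by
    intro n
    induction n using Nat.strong_induction_on with
    | _ n ih =>
      rintro l rfl q
      obtain ⟨u, hu⟩ := h1 l
      have h3 : c l - single l (u : Q) ∈ Submodule.span Q (Set.range c) := by
        rw [← AddMonoidAlgebra.sum_coeff_single (c l - single l (u : Q))]
        refine sum_mem fun m hm => ?_
        by_cases hml : m = l
        · subst hml
          exact absurd (by simp [hu]) (Finsupp.mem_support_iff.1 hm)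
        · have h4 : (c l).coeff m ≠ 0 := by
            have := Finsupp.mem_support_iff.1 hm
            rwa [AddMonoidAlgebra.coeff_sub, Finsupp.sub_apply, AddMonoidAlgebra.coeff_single,
              Finsupp.single_eq_of_ne hml, sub_zero] at this
          exact ih _ ((h2 l m h4).eq_or_rank_lt.resolve_left hml) m rfl _
      have h5 : single l q = (q * ↑u⁻¹) • (c l - (c l - single l (u : Q))) := by
        rw [sub_sub_cancel, AddMonoidAlgebra.smul_single, smul_eq_mul, Units.inv_mul_cancel_right]
      rw [h5]
      exact Submodule.smul_mem _ _ (sub_mem (Submodule.subset_span ⟨l, rfl⟩) h3)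
  rw [eq_top_iff]
  intro a _
  rw [← AddMonoidAlgebra.sum_coeff_single a]
  exact sum_mem fun m _ => key _ m rfl _

end TriangularBasis

end ReflDatum

end Peterson
end

-- Descent of a Hopf algebra structure to a subring of the scalars.

noncomputable section

namespace Peterson

section Descent

open TensorProduct

section TensorMap

variable {S Q A A' H H' : Type*} [CommRing S] [CommRing Q] [Algebra S Q]
  [AddCommGroup A] [Module S A] [AddCommGroup A'] [Module S A']
  [AddCommGroup H] [Module S H] [Module Q H] [IsScalarTower S Q H]
  [AddCommGroup H'] [Module S H'] [Module Q H'] [IsScalarTower S Q H']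

/-- The image of the basis is independent over 𝒬, hence over S. The lemma is applied to the first
three tensor powers, in which products of basis vectors go to products of basis vectors. -/
theorem injective_of_basis {κ : Type*} (hSQ : Function.Injective (algebraMap S Q))
    (f : A →ₗ[S] H) (B : Module.Basis κ S A) (hf : LinearIndependent Q fun i => f (B i)) :
    Function.Injective f := by
  have h : LinearIndependent S fun i => f (B i) :=
    hf.restrict_scalars (by simpa [Algebra.smul_def] using hSQ)
  intro a a' haa'
  refine B.repr.injective (h ?_)
  rwa [← Function.comp_def f, ← Finsupp.apply_linearCombination, ← Finsupp.apply_linearCombination,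
    B.linearCombination_repr, B.linearCombination_repr]

variable (Q) in
/-- The map `A ⊗_S A' → H ⊗_Q H'` induced by `S`-linear maps `A → H` and `A' → H'`. -/
def tensorMap (f : A →ₗ[S] H) (f' : A' →ₗ[S] H') : A ⊗[S] A' →ₗ[S] H ⊗[Q] H' :=
  TensorProduct.mapOfCompatibleSMul Q S S H H' ∘ₗ TensorProduct.map f f'

@[simp]
theorem tensorMap_tmul (f : A →ₗ[S] H) (f' : A' →ₗ[S] H') (a : A) (a' : A') :
    tensorMap Q f f' (a ⊗ₜ a') = f a ⊗ₜ f' a' := rfl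

theorem tensorMap_basis {κ κ' : Type*} {f : A →ₗ[S] H} {f' : A' →ₗ[S] H'} {B : Module.Basis κ S A}
    {B' : Module.Basis κ' S A'} {C : Module.Basis κ Q H} {C' : Module.Basis κ' Q H'}
    (h : ∀ i, f (B i) = C i) (h' : ∀ i, f' (B' i) = C' i) (i : κ × κ') :
    tensorMap Q f f' (B.tensorProduct B' i) = C.tensorProduct C' i := by
  rw [Module.Basis.tensorProduct_apply', Module.Basis.tensorProduct_apply', tensorMap_tmul, h, h']

end TensorMap

variable {S Q A H : Type*} [CommRing S] [CommRing Q] [Algebra S Q] [Ring A] [Algebra S A]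
  [Ring H] [HopfAlgebra Q H] [Algebra S H] [IsScalarTower S Q H]

variable (Q) in
/-- The algebra homomorphism `A ⊗_S A → H ⊗_Q H` induced by `A → H`. -/
def tensorSquareHom (j : A →ₐ[S] H) : A ⊗[S] A →ₐ[S] H ⊗[Q] H :=
  (Algebra.TensorProduct.mapOfCompatibleSMul Q S S H H).comp (Algebra.TensorProduct.map j j)

@[simp]
theorem tensorSquareHom_tmul (j : A →ₐ[S] H) (a a' : A) :
    tensorSquareHom Q j (a ⊗ₜ a') = j a ⊗ₜ j a' := rfl

/-- The conditions under which the structure of a Hopf algebra `H` over `Q` induces one over `S` on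
an `S`-algebra `A` which embeds into it. -/
structure HopfDescent {κ : Type*} (j : A →ₐ[S] H) (B : Module.Basis κ S A)
    (C : Module.Basis κ Q H) : Prop where
  injective : Function.Injective (algebraMap S Q)
  apply_basis : ∀ i, j (B i) = C i
  comul : ∀ a, Coalgebra.comul (R := Q) (j a) ∈ (tensorSquareHom Q j).range
  counit : ∀ a, Coalgebra.counit (R := Q) (j a) ∈ (Algebra.ofId S Q).range
  antipode : ∀ a, HopfAlgebra.antipode Q (j a) ∈ LinearMap.range j.toLinearMap

namespace HopfDescent

variable {κ : Type*} {j : A →ₐ[S] H} {B : Module.Basis κ S A} {C : Module.Basis κ Q H}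
  (h : HopfDescent j B C)

include h

theorem injective_hom : Function.Injective j := by
  refine injective_of_basis (Q := Q) h.injective j.toLinearMap B ?_
  simp only [AlgHom.toLinearMap_apply, h.apply_basis]
  exact C.linearIndependent

theorem injective_tensorSquareHom : Function.Injective (tensorSquareHom Q j) := by
  refine injective_of_basis (Q := Q) h.injective (tensorMap Q j.toLinearMap j.toLinearMap)
    (B.tensorProduct B) ?_
  simp only [tensorMap_basis (f := j.toLinearMap) (f' := j.toLinearMap) h.apply_basis h.apply_basis]
  exact (C.tensorProduct C).linearIndependent

theorem injective_tensorCube : Function.Injective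
    (tensorMap Q j.toLinearMap (tensorMap Q j.toLinearMap j.toLinearMap)) := by
  have h2 := tensorMap_basis (f := j.toLinearMap) (f' := j.toLinearMap) h.apply_basis h.apply_basis
  refine injective_of_basis (Q := Q) h.injective _ (B.tensorProduct (B.tensorProduct B)) ?_
  simp only [tensorMap_basis (f := j.toLinearMap) h.apply_basis h2]
  exact (C.tensorProduct (C.tensorProduct C)).linearIndependent

/-- The induced coproduct. -/
def comulHom : A →ₐ[S] A ⊗[S] A :=
  (AlgEquiv.ofInjective _ h.injective_tensorSquareHom).symm.toAlgHom.comp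
    ((((Bialgebra.comulAlgHom Q H).restrictScalars S).comp j).codRestrict _ h.comul)

theorem tensorSquareHom_comulHom (a : A) :
    tensorSquareHom Q j (h.comulHom a) = Coalgebra.comul (R := Q) (j a) :=
  congrArg Subtype.val ((AlgEquiv.ofInjective _ h.injective_tensorSquareHom).apply_symm_apply
    ((((Bialgebra.comulAlgHom Q H).restrictScalars S).comp j).codRestrict _ h.comul a))

/-- The induced counit. -/
def counitHom : A →ₐ[S] S :=
  (AlgEquiv.ofInjective (Algebra.ofId S Q) h.injective).symm.toAlgHom.comp
    ((((Bialgebra.counitAlgHom Q H).restrictScalars S).comp j).codRestrict _ h.counit)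

theorem algebraMap_counitHom (a : A) :
    algebraMap S Q (h.counitHom a) = Coalgebra.counit (R := Q) (j a) :=
  congrArg Subtype.val ((AlgEquiv.ofInjective (Algebra.ofId S Q) h.injective).apply_symm_apply
    ((((Bialgebra.counitAlgHom Q H).restrictScalars S).comp j).codRestrict _ h.counit a))

/-- The induced antipode. -/
def antipodeMap : A →ₗ[S] A :=
  (LinearEquiv.ofInjective j.toLinearMap h.injective_hom).symm.toLinearMap ∘ₗ
    (((HopfAlgebra.antipode Q (A := H)).restrictScalars S) ∘ₗ j.toLinearMap).codRestrict _
      h.antipode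

theorem apply_antipodeMap (a : A) : j (h.antipodeMap a) = HopfAlgebra.antipode Q (j a) :=
  congrArg Subtype.val
    ((LinearEquiv.ofInjective j.toLinearMap h.injective_hom).apply_symm_apply
      ((((HopfAlgebra.antipode Q (A := H)).restrictScalars S) ∘ₗ j.toLinearMap).codRestrict _
        h.antipode a))

/-- Verified after embedding in H ⊗ H ⊗ H, where it is the coassociativity of H. The counit and
antipode laws below are pulled back in the same way. -/
theorem coassoc : (Algebra.TensorProduct.assoc S S S A A A).toAlgHom.comp
    ((Algebra.TensorProduct.map h.comulHom (.id S A)).comp h.comulHom) =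
      (Algebra.TensorProduct.map (.id S A) h.comulHom).comp h.comulHom := by
  have h1 : ∀ t : A ⊗[S] A, ∀ a, tensorMap Q j.toLinearMap (tensorMap Q j.toLinearMap j.toLinearMap)
      (TensorProduct.assoc S A A A (t ⊗ₜ a)) =
        TensorProduct.assoc Q H H H (tensorSquareHom Q j t ⊗ₜ j a) := by
    intro t a
    induction t with
    | zero => simp
    | tmul => rfl
    | add t t' ht ht' => simp only [TensorProduct.add_tmul, map_add, ht, ht']
  have h2 : ∀ t : A ⊗[S] A, tensorMap Q j.toLinearMap (tensorMap Q j.toLinearMap j.toLinearMap)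
      (TensorProduct.assoc S A A A (h.comulHom.toLinearMap.rTensor A t)) =
        TensorProduct.assoc Q H H H ((Coalgebra.comul (R := Q)).rTensor H
          (tensorSquareHom Q j t)) := by
    intro t
    induction t with
    | zero => simp
    | tmul a a' =>
      rw [LinearMap.rTensor_tmul, h1, tensorSquareHom_tmul, LinearMap.rTensor_tmul,
        AlgHom.toLinearMap_apply, h.tensorSquareHom_comulHom]
    | add t t' ht ht' => simp only [map_add, ht, ht']
  have h3 : ∀ t : A ⊗[S] A, tensorMap Q j.toLinearMap (tensorMap Q j.toLinearMap j.toLinearMap)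
      (h.comulHom.toLinearMap.lTensor A t) = (Coalgebra.comul (R := Q)).lTensor H
          (tensorSquareHom Q j t) := by
    intro t
    induction t with
    | zero => simp
    | tmul a a' =>
      rw [LinearMap.lTensor_tmul, tensorMap_tmul, tensorSquareHom_tmul, LinearMap.lTensor_tmul,
        ← h.tensorSquareHom_comulHom]
      rfl
    | add t t' ht ht' => simp only [map_add, ht, ht']
  refine AlgHom.ext fun a => h.injective_tensorCube ?_
  refine (h2 (h.comulHom a)).trans (Eq.trans ?_ (h3 (h.comulHom a)).symm)
  rw [h.tensorSquareHom_comulHom]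
  exact Coalgebra.coassoc_apply (j a)

theorem rTensor_counit : (Algebra.TensorProduct.map h.counitHom (.id S A)).comp h.comulHom =
    (Algebra.TensorProduct.lid S A).symm := by
  have h1 : ∀ t : A ⊗[S] A, j (TensorProduct.lid S A (h.counitHom.toLinearMap.rTensor A t)) =
      TensorProduct.lid Q H ((Coalgebra.counit (R := Q)).rTensor H (tensorSquareHom Q j t)) := by
    intro t
    induction t with
    | zero => simp
    | tmul a a' =>
      rw [LinearMap.rTensor_tmul, tensorSquareHom_tmul, LinearMap.rTensor_tmul,
        TensorProduct.lid_tmul, TensorProduct.lid_tmul, map_smul, ← h.algebraMap_counitHom,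
        algebraMap_smul]
      rfl
    | add t t' ht ht' => simp only [map_add, ht, ht']
  refine AlgHom.ext fun a => (TensorProduct.lid S A).injective (h.injective_hom ?_)
  refine (h1 (h.comulHom a)).trans ?_
  rw [h.tensorSquareHom_comulHom, Coalgebra.rTensor_counit_comul, TensorProduct.lid_tmul, one_smul]
  exact congrArg j ((TensorProduct.lid S A).apply_symm_apply a).symm

theorem lTensor_counit : (Algebra.TensorProduct.map (.id S A) h.counitHom).comp h.comulHom =
    (Algebra.TensorProduct.rid S S A).symm := by
  have h1 : ∀ t : A ⊗[S] A, j (TensorProduct.rid S A (h.counitHom.toLinearMap.lTensor A t)) =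
      TensorProduct.rid Q H ((Coalgebra.counit (R := Q)).lTensor H (tensorSquareHom Q j t)) := by
    intro t
    induction t with
    | zero => simp
    | tmul a a' =>
      rw [LinearMap.lTensor_tmul, tensorSquareHom_tmul, LinearMap.lTensor_tmul,
        TensorProduct.rid_tmul, TensorProduct.rid_tmul, map_smul, ← h.algebraMap_counitHom,
        algebraMap_smul]
      rfl
    | add t t' ht ht' => simp only [map_add, ht, ht']
  refine AlgHom.ext fun a => (TensorProduct.rid S A).injective (h.injective_hom ?_)
  refine (h1 (h.comulHom a)).trans ?_
  rw [h.tensorSquareHom_comulHom, Coalgebra.lTensor_counit_comul, TensorProduct.rid_tmul, one_smul]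
  exact congrArg j ((TensorProduct.rid S A).apply_symm_apply a).symm

theorem mul_antipode_rTensor (a : A) :
    LinearMap.mul' S A (h.antipodeMap.rTensor A (h.comulHom a)) =
      algebraMap S A (h.counitHom a) := by
  have h1 : ∀ t : A ⊗[S] A, j (LinearMap.mul' S A (h.antipodeMap.rTensor A t)) =
      LinearMap.mul' Q H ((HopfAlgebra.antipode Q).rTensor H (tensorSquareHom Q j t)) := by
    intro t
    induction t with
    | zero => simp
    | tmul a a' => simp [h.apply_antipodeMap]
    | add t t' ht ht' => simp only [map_add, ht, ht']
  apply h.injective_hom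
  rw [h1, h.tensorSquareHom_comulHom, HopfAlgebra.mul_antipode_rTensor_comul_apply,
    AlgHom.commutes, ← h.algebraMap_counitHom, ← IsScalarTower.algebraMap_apply]

theorem mul_antipode_lTensor (a : A) :
    LinearMap.mul' S A (h.antipodeMap.lTensor A (h.comulHom a)) =
      algebraMap S A (h.counitHom a) := by
  have h1 : ∀ t : A ⊗[S] A, j (LinearMap.mul' S A (h.antipodeMap.lTensor A t)) =
      LinearMap.mul' Q H ((HopfAlgebra.antipode Q).lTensor H (tensorSquareHom Q j t)) := by
    intro t
    induction t with
    | zero => simp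
    | tmul a a' => simp [h.apply_antipodeMap]
    | add t t' ht ht' => simp only [map_add, ht, ht']
  apply h.injective_hom
  rw [h1, h.tensorSquareHom_comulHom, HopfAlgebra.mul_antipode_lTensor_comul_apply,
    AlgHom.commutes, ← h.algebraMap_counitHom, ← IsScalarTower.algebraMap_apply]

/-- The induced Hopf algebra structure. -/
abbrev hopfAlgebra : HopfAlgebra S A where
  __ := Bialgebra.ofAlgHom h.comulHom h.counitHom h.coassoc h.rTensor_counit h.lTensor_counit
  antipode := h.antipodeMap
  mul_antipode_rTensor_comul := LinearMap.ext h.mul_antipode_rTensor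
  mul_antipode_lTensor_comul := LinearMap.ext h.mul_antipode_lTensor

theorem isHopfHom : @IsHopfHom S Q A H _ _ _ _ h.hopfAlgebra _ _ _ _ j :=
  @IsHopfHom.mk S Q A H _ _ _ _ h.hopfAlgebra _ _ _ _ j
    (fun a => (h.tensorSquareHom_comulHom a).symm) (fun a => (h.algebraMap_counitHom a).symm)
    fun a => (h.apply_antipodeMap a).symm

theorem injective_tensorSquare :
    Function.Injective (@tensorSquare S Q A H _ _ _ _ h.hopfAlgebra _ _ _ _ j) :=
  h.injective_tensorSquareHom

end HopfDescent

end Descent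

end Peterson
end

-- Change of the base ring, and stability under the Hopf operations.

noncomputable section

namespace Peterson

namespace ReflDatum

open AddMonoidAlgebra (single)
open TensorProduct

variable {ι M N : Type*} [AddCommGroup M] [AddCommGroup N] {P : RootPairing ι ℤ M N}
variable {S : Type*} [CommRing S] {D : ReflDatum P S}
variable {Q : Type*} [CommRing Q] [Algebra S Q] [IsLocalization D.denom Q]
variable {b : P.Base} {θ : ι}

section Comparison

variable {T : Type*} [CommRing T] {E : ReflDatum P T}
variable {Q' : Type*} [CommRing Q'] [Algebra T Q'] [IsLocalization E.denom Q'] {φ : T →+* S}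

/-- Compatibility of a ring homomorphism with the elements `x_α` and with the reflections. -/
structure IsHom (E : ReflDatum P T) (D : ReflDatum P S) (φ : T →+* S) : Prop where
  map_x : ∀ i, φ (E.x i) = D.x i
  map_σ : ∀ i t, φ (E.σ i t) = D.σ i (φ t)

namespace IsHom

variable (h : IsHom E D φ)

include h

theorem denom_le_comap : E.denom ≤ D.denom.comap φ := by
  refine Submonoid.closure_le.2 ?_
  rintro _ ⟨i, rfl⟩
  rw [SetLike.mem_coe, Submonoid.mem_comap, h.map_x]
  exact D.x_mem_denom i

variable (Q' Q) in
/-- The induced homomorphism of localizations. -/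
def mapQ : Q' →+* Q := IsLocalization.map Q φ h.denom_le_comap

theorem mapQ_algebraMap (t : T) : h.mapQ Q Q' (algebraMap T Q' t) = algebraMap S Q (φ t) :=
  IsLocalization.map_eq _ t

theorem mapQ_inv (i : ι) : h.mapQ Q Q' (E.inv Q' i) = D.inv Q i := by
  apply D.eq_inv_of_mul_eq_one
  rw [← h.map_x, ← h.mapQ_algebraMap (Q' := Q'), ← map_mul, x_mul_inv, map_one]

theorem mapQ_sig (i : ι) (q : Q') : h.mapQ Q Q' (E.sig Q' i q) = D.sig Q i (h.mapQ Q Q' q) := by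
  have : (h.mapQ Q Q').comp (E.sig Q' i) = (D.sig Q i).comp (h.mapQ Q Q') :=
    IsLocalization.ringHom_ext E.denom (RingHom.ext fun s => by
      simp [sig_algebraMap, mapQ_algebraMap, h.map_σ])
  exact RingHom.congr_fun this q

variable (Q' Q) in
/-- The induced homomorphism of group algebras. -/
def mapH : AddMonoidAlgebra Q' N →+* AddMonoidAlgebra Q N :=
  AddMonoidAlgebra.mapRingHom N (h.mapQ Q Q')

theorem mapH_single (l : N) (q : Q') : h.mapH Q Q' (single l q) = single l (h.mapQ Q Q' q) := by
  simp [mapH]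

theorem coeff_mapH (a : AddMonoidAlgebra Q' N) (l : N) :
    (h.mapH Q Q' a).coeff l = h.mapQ Q Q' (a.coeff l) := by
  simp [mapH]

theorem mapH_smul (q : Q') (a : AddMonoidAlgebra Q' N) :
    h.mapH Q Q' (q • a) = h.mapQ Q Q' q • h.mapH Q Q' a := by
  ext l
  simp [coeff_mapH]

theorem mapH_smul' (t : T) (a : AddMonoidAlgebra Q' N) :
    h.mapH Q Q' (t • a) = φ t • h.mapH Q Q' a := by
  rw [← algebraMap_smul Q' t a, mapH_smul, mapQ_algebraMap, algebraMap_smul]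

theorem mapH_opT (r : ι × ℤ) (a : AddMonoidAlgebra Q' N) :
    h.mapH Q Q' (E.opT Q' r a) = D.opT Q r (h.mapH Q Q' a) := by
  induction a using AddMonoidAlgebra.induction_linear with
  | zero => simp
  | add a c ha hc => simp only [map_add, ha, hc]
  | single l q => rw [opT_single, mapH_single, mapH_single, opT_single, mapQ_sig]

theorem mapH_op (r : ι × ℤ) (a : AddMonoidAlgebra Q' N) :
    h.mapH Q Q' (E.op Q' r a) = D.op Q r (h.mapH Q Q' a) := by
  rw [op, op, mapH_smul, mapQ_inv, map_sub, mapH_opT]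

theorem mapH_mem_peterson {a : AddMonoidAlgebra Q' N} (ha : a ∈ E.peterson Q' b θ) :
    h.mapH Q Q' a ∈ D.peterson Q b θ := by
  let C : Submodule T (AddMonoidAlgebra Q' N) :=
    { carrier := {a | h.mapH Q Q' a ∈ D.peterson Q b θ}
      zero_mem' := by rw [Set.mem_ofPred_eq, map_zero]; exact zero_mem _
      add_mem' := fun {x y} hx hy => by
        rw [Set.mem_ofPred_eq, map_add]; exact add_mem hx hy
      smul_mem' := fun t x hx => by
        rw [Set.mem_ofPred_eq, mapH_smul']; exact Submodule.smul_mem _ _ hx }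
  have : E.peterson Q' b θ ≤ C := E.peterson_le
    (show h.mapH Q Q' 1 ∈ D.peterson Q b θ by rw [map_one]; exact D.one_mem_peterson)
    fun r hr a ha => show h.mapH Q Q' (E.op Q' r a) ∈ D.peterson Q b θ by
      rw [mapH_op]
      exact D.op_mem_peterson hr ha
  exact this ha

theorem mapH_mem_span {c : N → AddMonoidAlgebra Q' N} {a : AddMonoidAlgebra Q' N}
    (ha : a ∈ Submodule.span T (Set.range c)) :
    h.mapH Q Q' a ∈ Submodule.span S (Set.range fun l => h.mapH Q Q' (c l)) := by
  induction ha using Submodule.span_induction with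
  | mem a ha =>
    obtain ⟨l, rfl⟩ := ha
    exact Submodule.subset_span ⟨l, rfl⟩
  | zero => rw [map_zero]; exact zero_mem _
  | add a c _ _ ha hc => rw [map_add]; exact add_mem ha hc
  | smul t a _ ha => rw [mapH_smul']; exact Submodule.smul_mem _ _ ha

variable (Q) in
-- The c_l are built over T, where the x_α are prime, and mapped to S. Their S-span contains 1 and
-- is stable under the X_r by `op_mem_span`, hence it is `peterson`. Diagonal coefficients stay
-- units, so triangularity gives a 𝒬-basis. Neither flatness nor injectivity of φ is required.
theorem exists_triangular [Finite ι] [P.IsReduced] [IsDomain T] (hE : E.IsGood)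
    (hirr : IsIrreducibleDatum P) (hsc : IsSimplyConnectedDatum P) (hθ : IsHighestRoot b θ) :
    ∃ c : N → AddMonoidAlgebra Q N, Submodule.span S (Set.range c) = D.peterson Q b θ ∧
      LinearIndependent Q c ∧ Submodule.span Q (Set.range c) = ⊤ := by
  have := Fintype.ofFinite ι
  choose c hc h1 h2 using fun l =>
    E.exists_peterson_leading (Q := Localization E.denom) hirr hsc hθ l
  have hspan := peterson_le_span hE hc h1 h2
  have h3 : ∀ l m, (h.mapH Q (Localization E.denom) (c l)).coeff m ≠ 0 → BruhatLE b m l :=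
    fun l m hm => h2 l m fun h0 => hm (by rw [coeff_mapH, h0, map_zero])
  have h4 : ∀ l, IsUnit ((h.mapH Q (Localization E.denom) (c l)).coeff l) := fun l => by
    rw [coeff_mapH]
    exact (IsUnit.of_mul_eq_one_right _ (h1 l)).map _
  refine ⟨fun l => h.mapH Q (Localization E.denom) (c l), le_antisymm ?_ ?_,
    linearIndependent_of_triangular h4 h3, span_eq_top_of_triangular h4 h3⟩
  · rw [Submodule.span_le]
    rintro _ ⟨l, rfl⟩
    exact h.mapH_mem_peterson (hc l)
  · refine D.peterson_le ?_ fun r hr a ha => D.op_mem_span ?_ Submodule.subset_span ha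
    · have := h.mapH_mem_span (Q := Q) (hspan E.one_mem_peterson)
      rwa [map_one] at this
    · rintro _ ⟨l, rfl⟩
      rw [← h.mapH_op]
      exact h.mapH_mem_span (hspan (E.op_mem_peterson hr (hc l)))

end IsHom

end Comparison

section HopfStructure

/-- The counit turns T_r into σ_r, so if a has counit s then X_r(a) has counit (s - σ_r s)/x_r,
which is in S. -/
theorem counit_mem_range {a : AddMonoidAlgebra Q N} (ha : a ∈ D.peterson Q b θ) :
    ∃ s : S, Coalgebra.counit (R := Q) a = algebraMap S Q s := by
  let C : Submodule S (AddMonoidAlgebra Q N) :=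
    (LinearMap.range (Algebra.linearMap S Q)).comap
      ((Coalgebra.counit (R := Q) (A := AddMonoidAlgebra Q N)).restrictScalars S)
  have hC : ∀ a : AddMonoidAlgebra Q N, a ∈ C ↔ ∃ s : S, algebraMap S Q s =
    Coalgebra.counit (R := Q) a := fun a => Iff.rfl
  have hT : ∀ (r : ι × ℤ) (a : AddMonoidAlgebra Q N),
      Coalgebra.counit (R := Q) (D.opT Q r a) = D.sig Q r.1 (Coalgebra.counit (R := Q) a) := by
    intro r a
    induction a using AddMonoidAlgebra.induction_linear with
    | zero => simp
    | add a c ha hc => simp only [map_add, ha, hc]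
    | single l q => simp [opT_single]
  have : D.peterson Q b θ ≤ C := by
    refine D.peterson_le ((hC 1).2 ⟨1, by simp⟩) fun r _ a ha => ?_
    obtain ⟨s, hs⟩ := (hC a).1 ha
    obtain ⟨t, ht⟩ := D.exists_inv_mul_sub (Q := Q) r.1 s
    refine (hC _).2 ⟨t, ?_⟩
    rw [op, map_smul, map_sub, hT, ← hs, smul_eq_mul, ht]
  obtain ⟨s, hs⟩ := (hC a).1 (this ha)
  exact ⟨s, hs.symm⟩

theorem antipode_opT (r : ι × ℤ) (a : AddMonoidAlgebra Q N) :
    HopfAlgebra.antipode Q (D.opT Q r a) =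
      D.opT Q (r.1, -r.2) (HopfAlgebra.antipode Q a) := by
  induction a using AddMonoidAlgebra.induction_linear with
  | zero => simp
  | add a c ha hc => simp only [map_add, ha, hc]
  | single l q =>
    rw [opT_single, AddMonoidAlgebra.antipode_single, AddMonoidAlgebra.antipode_single, opT_single,
      affineReflect_eq, affineReflect_eq]
    simp [sub_eq_add_neg, add_comm]

theorem antipode_op (r : ι × ℤ) (a : AddMonoidAlgebra Q N) :
    HopfAlgebra.antipode Q (D.op Q r a) = D.op Q (r.1, -r.2) (HopfAlgebra.antipode Q a) := by
  rw [op, op, map_smul, map_sub, antipode_opT]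

/-- The antipode reverses translations and turns the operator at (-θ, 1) into the one at (-θ, -1),
which is not a simple affine root. The formula expresses it by operations that preserve `peterson`.
-/
theorem op_neg_one (i : ι) (a : AddMonoidAlgebra Q N) :
    D.op Q (i, -1) a = D.op Q (i, 0) a -
      single (P.coroot i) 1 * D.op Q (i, 1) 1 * D.tau Q i a := by
  have h : single (P.coroot i) 1 * single (-P.coroot i) 1 = (1 : AddMonoidAlgebra Q N) := by
    rw [AddMonoidAlgebra.single_mul_single, mul_one, add_neg_cancel, AddMonoidAlgebra.one_def]
  rw [op, op, op, opT_zero, opT_apply, opT_apply, map_one, mul_one, one_smul, neg_smul, one_smul,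
    neg_neg, mul_smul_comm, smul_mul_assoc, ← smul_sub, mul_sub, mul_one, h, sub_mul, one_mul]
  congr 1
  abel

theorem antipode_mem_peterson [Finite ι] [P.IsReduced] (hirr : IsIrreducibleDatum P)
    (hsc : IsSimplyConnectedDatum P) (hθ : IsHighestRoot b θ) {a : AddMonoidAlgebra Q N}
    (ha : a ∈ D.peterson Q b θ) : HopfAlgebra.antipode Q a ∈ D.peterson Q b θ := by
  let C : Submodule S (AddMonoidAlgebra Q N) := (D.peterson Q b θ).comap
      ((HopfAlgebra.antipode Q (A := AddMonoidAlgebra Q N)).restrictScalars S)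
  have hC : ∀ a : AddMonoidAlgebra Q N, a ∈ C ↔ HopfAlgebra.antipode Q a ∈ D.peterson Q b θ :=
    fun a => Iff.rfl
  have : D.peterson Q b θ ≤ C := by
    refine D.peterson_le ((hC 1).2 ?_) fun r hr a ha => (hC _).2 ?_
    · rw [HopfAlgebra.antipode_one]
      exact D.one_mem_peterson
    rw [hC] at ha
    rw [antipode_op]
    rcases hr with ⟨h1, h2⟩ | rfl
    · have h3 : IsSimpleAffine b θ (r.1, (0 : ℤ)) := Or.inl ⟨h1, rfl⟩
      rw [h2, neg_zero]
      exact D.op_mem_peterson h3 ha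
    · rw [op_neg_one]
      exact sub_mem (D.op_root_mem_peterson _ ha) (D.mul_mem_peterson (D.mul_mem_peterson
        (D.single_mem_peterson hirr hsc hθ _) (D.op_mem_peterson (Or.inr rfl) D.one_mem_peterson))
        (D.tau_mem_peterson _ ha))
  exact (hC a).1 (this ha)

variable (D Q) in
/-- The diagonal action of an affine reflection on the tensor square of the group algebra. -/
def opT₂ (r : ι × ℤ) : AddMonoidAlgebra Q N ⊗[Q] AddMonoidAlgebra Q N →+
    AddMonoidAlgebra Q N ⊗[Q] AddMonoidAlgebra Q N :=
  TensorProduct.liftAddHom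
    { toFun := fun a =>
        { toFun := fun c => D.opT Q r a ⊗ₜ D.opT Q r c
          map_zero' := by rw [map_zero, TensorProduct.tmul_zero]
          map_add' := fun c c' => by rw [map_add, TensorProduct.tmul_add] }
      map_zero' := AddMonoidHom.ext fun c => by
        change D.opT Q r 0 ⊗ₜ _ = 0
        rw [map_zero, TensorProduct.zero_tmul]
      map_add' := fun a a' => AddMonoidHom.ext fun c => by
        change D.opT Q r (a + a') ⊗ₜ _ = D.opT Q r a ⊗ₜ _ + D.opT Q r a' ⊗ₜ _
        rw [map_add, TensorProduct.add_tmul] }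
    fun q a c => by
      change D.opT Q r (q • a) ⊗ₜ _ = D.opT Q r a ⊗ₜ D.opT Q r (q • c)
      rw [opT_smul, opT_smul, TensorProduct.smul_tmul]

theorem opT₂_tmul (r : ι × ℤ) (a c : AddMonoidAlgebra Q N) :
    D.opT₂ Q r (a ⊗ₜ c) = D.opT Q r a ⊗ₜ D.opT Q r c := rfl

theorem comul_opT (r : ι × ℤ) (a : AddMonoidAlgebra Q N) :
    Coalgebra.comul (R := Q) (D.opT Q r a) = D.opT₂ Q r (Coalgebra.comul (R := Q) a) := by
  induction a using AddMonoidAlgebra.induction_linear with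
  | zero => simp
  | add a c ha hc => simp only [map_add, ha, hc]
  | single l q =>
    rw [opT_single, AddMonoidAlgebra.comul_single, AddMonoidAlgebra.comul_single,
      CommSemiring.comul_apply, CommSemiring.comul_apply, TensorProduct.map_tmul,
      TensorProduct.map_tmul, opT₂_tmul]
    simp [opT_single]

variable (D Q b θ) in
/-- The image of the tensor square of the Peterson subalgebra. -/
def petersonSquare : Submodule S (AddMonoidAlgebra Q N ⊗[Q] AddMonoidAlgebra Q N) :=
  LinearMap.range (tensorMap Q (D.peterson Q b θ).subtype (D.peterson Q b θ).subtype)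

theorem tmul_mem_petersonSquare {a c : AddMonoidAlgebra Q N} (ha : a ∈ D.peterson Q b θ)
    (hc : c ∈ D.peterson Q b θ) : a ⊗ₜ c ∈ D.petersonSquare Q b θ :=
  ⟨⟨a, ha⟩ ⊗ₜ ⟨c, hc⟩, rfl⟩

/-- The coproduct turns T_r into T_r ⊗ T_r, and (a ⊗ c - T_r a ⊗ T_r c)/x_r = X_r a ⊗ c + T_r a ⊗
X_r c stays in the tensor square. -/
theorem comul_mem_petersonSquare {a : AddMonoidAlgebra Q N} (ha : a ∈ D.peterson Q b θ) :
    Coalgebra.comul (R := Q) a ∈ D.petersonSquare Q b θ := by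
  let C : Submodule S (AddMonoidAlgebra Q N) := (D.petersonSquare Q b θ).comap
      ((Coalgebra.comul (R := Q) (A := AddMonoidAlgebra Q N)).restrictScalars S)
  have hC : ∀ a : AddMonoidAlgebra Q N, a ∈ C ↔
    Coalgebra.comul (R := Q) a ∈ D.petersonSquare Q b θ := fun a => Iff.rfl
  have key : ∀ r, IsSimpleAffine b θ r → ∀ t ∈ D.petersonSquare Q b θ,
      D.inv Q r.1 • (t - D.opT₂ Q r t) ∈ D.petersonSquare Q b θ := by
    rintro r hr _ ⟨u, rfl⟩
    induction u with
    | zero => rw [map_zero, map_zero, sub_zero, smul_zero]; exact zero_mem _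
    | tmul a c =>
      obtain ⟨a, ha⟩ := a
      obtain ⟨c, hc⟩ := c
      have : D.inv Q r.1 • (a ⊗ₜ[Q] c - D.opT₂ Q r (a ⊗ₜ c)) =
          D.op Q r a ⊗ₜ c + D.opT Q r a ⊗ₜ D.op Q r c := by
        rw [opT₂_tmul, op, op, TensorProduct.tmul_smul, ← TensorProduct.smul_tmul', ← smul_add,
          TensorProduct.sub_tmul, TensorProduct.tmul_sub, sub_add_sub_cancel]
      rw [tensorMap_tmul]
      change D.inv Q r.1 • (a ⊗ₜ[Q] c - D.opT₂ Q r (a ⊗ₜ c)) ∈ _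
      rw [this]
      exact add_mem (tmul_mem_petersonSquare (D.op_mem_peterson hr ha) hc)
        (tmul_mem_petersonSquare (D.opT_mem_peterson hr ha) (D.op_mem_peterson hr hc))
    | add u v hu hv =>
      rw [map_add, map_add, add_sub_add_comm, smul_add]
      exact add_mem hu hv
  have : D.peterson Q b θ ≤ C := by
    refine D.peterson_le ((hC 1).2 ?_) fun r hr a ha => (hC _).2 ?_
    · rw [Bialgebra.comul_one]
      exact tmul_mem_petersonSquare D.one_mem_peterson D.one_mem_peterson
    · rw [op, map_smul, map_sub, comul_opT]
      exact key r hr _ ((hC a).1 ha)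
  exact (hC a).1 (this ha)

end HopfStructure

end ReflDatum

end Peterson
end

-- From the twisted group algebra to operators on the group algebra.

noncomputable section

namespace Peterson

section Action

variable {ι M N : Type*} [AddCommGroup M] [AddCommGroup N] {P : RootPairing ι ℤ M N}

theorem ofIdx_smul_weight (i : ι) (m : M) :
    RootPairing.weylGroup.ofIdx P i • m = P.reflection i m := rfl

theorem ofIdx_mul_self (i : ι) :
    RootPairing.weylGroup.ofIdx P i * RootPairing.weylGroup.ofIdx P i = 1 := by
  apply Subtype.ext
  apply RootPairing.Equiv.weightHom_injective P
  ext m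
  exact P.reflection_same i m

theorem ofIdx_reflectionPerm (i j : ι) :
    RootPairing.weylGroup.ofIdx P (P.reflectionPerm i j) =
      RootPairing.weylGroup.ofIdx P i * RootPairing.weylGroup.ofIdx P j *
        RootPairing.weylGroup.ofIdx P i := by
  apply Subtype.ext
  apply RootPairing.Equiv.weightHom_injective P
  ext m
  exact LinearEquiv.congr_fun P.reflection_reflectionPerm m

theorem weylCoweightHom_ofIdx (i : ι) (l : Multiplicative N) :
    weylCoweightHom P (RootPairing.weylGroup.ofIdx P i) l =
      Multiplicative.ofAdd (P.coreflection i l.toAdd) := by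
  change Multiplicative.ofAdd
    (MulOpposite.op (RootPairing.weylGroup.ofIdx P i)⁻¹.val • l.toAdd) = _
  rw [inv_eq_of_mul_eq_one_left (ofIdx_mul_self i)]
  rfl

namespace ReflDatum

variable {S : Type*} [CommRing S] [MulSemiringAction P.weylGroup S] (x : M →[P.weylGroup] S)

/-- The datum of reflections given by an action of the Weyl group. -/
def ofAction (h1 : ∀ i s, x (P.root i) ∣ s - RootPairing.weylGroup.ofIdx P i • s)
    (h2 : ∀ i, x (P.root (P.reflectionPerm i i)) ∣ x (P.root i)) : ReflDatum P S where
  x i := x (P.root i)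
  σ i := MulSemiringAction.toRingHom P.weylGroup S (RootPairing.weylGroup.ofIdx P i)
  σ_x i j := by
    rw [MulSemiringAction.toRingHom_apply, ← map_smul, ofIdx_smul_weight,
      RootPairing.root_reflectionPerm]
  σ_σ i s := by
    rw [MulSemiringAction.toRingHom_apply, MulSemiringAction.toRingHom_apply, smul_smul,
      ofIdx_mul_self, one_smul]
  σ_conj i j s := by
    simp only [MulSemiringAction.toRingHom_apply, smul_smul, ofIdx_reflectionPerm, mul_assoc]
  dvd_sub := h1
  neg_dvd := h2

variable {x} (h1 : ∀ i s, x (P.root i) ∣ s - RootPairing.weylGroup.ofIdx P i • s)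
  (h2 : ∀ i, x (P.root (P.reflectionPerm i i)) ∣ x (P.root i))

instance : IsLocalization (ofAction x h1 h2).denom (QRing x) :=
  inferInstanceAs (IsLocalization (rootSubmonoid x) (QRing x))

theorem ofAction_sig (i : ι) :
    (ofAction x h1 h2).sig (QRing x) i = weylQHom x (RootPairing.weylGroup.ofIdx P i) := rfl

theorem ofAction_inv (i : ι) : (ofAction x h1 h2).inv (QRing x) i = invRoot x i :=
  ((ofAction x h1 h2).eq_inv_of_mul_eq_one (by
    change algebraMap S (QRing x) (x (P.root i)) * Localization.mk 1 _ = 1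
    rw [Localization.mk_eq_mk', IsLocalization.mk'_spec'_mk, map_one])).symm

theorem pr_scalar_mul (q : QRing x) (z : QAffineWeyl x) : pr x (scalar x q * z) = q • pr x z := by
  induction z using SkewMonoidAlgebra.induction_on with
  | zero => simp
  | add z y hz hy => rw [mul_add, map_add, map_add, hz, hy, smul_add]
  | single g p =>
    rw [scalar, SkewMonoidAlgebra.single_mul_single, one_mul, one_smul, pr_single, pr_single,
      AddMonoidAlgebra.smul_single, smul_eq_mul]

theorem pr_reflection_mul (i : ι) (z : QAffineWeyl x) :
    pr x (eta x (reflection i) * z) = (ofAction x h1 h2).opT (QRing x) (i, 0) (pr x z) := by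
  induction z using SkewMonoidAlgebra.induction_on with
  | zero => simp
  | add z y hz hy => rw [mul_add, map_add, map_add, hz, hy, map_add]
  | single g p =>
    rw [eta, SkewMonoidAlgebra.single_mul_single, one_mul, pr_single, pr_single, opT_single,
      affineReflect_eq, zero_smul, sub_zero, ofAction_sig, reflection, SemidirectProduct.mul_left,
      SemidirectProduct.left_inr, SemidirectProduct.right_inr, one_mul, weylCoweightHom_ofIdx,
      affineWeyl_smul, SemidirectProduct.right_inr]
    rfl

/-- On Q^∨ = W_a/W, the element t_{θ^∨} s_θ acts by l ↦ s_θ l + θ^∨, the affine reflection in (-θ,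
1); its gradient matches the x_{-θ} in X_0. -/
theorem pr_affineReflection_mul (θ : ι) (z : QAffineWeyl x) :
    pr x (eta x (affineReflection θ) * z) =
      (ofAction x h1 h2).opT (QRing x) (P.reflectionPerm θ θ, 1) (pr x z) := by
  induction z using SkewMonoidAlgebra.induction_on with
  | zero => simp
  | add z y hz hy => rw [mul_add, map_add, map_add, hz, hy, map_add]
  | single g p =>
    rw [eta, SkewMonoidAlgebra.single_mul_single, one_mul, pr_single, pr_single, opT_single,
      affineReflect_eq, one_smul, coroot_reflectionPerm_self, coreflection_reflectionPerm_self,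
      sig_neg, ofAction_sig, affineReflection, reflection, translation, affineWeyl_smul,
      sub_neg_eq_add, add_comm]
    simp only [SemidirectProduct.mul_left, SemidirectProduct.mul_right, SemidirectProduct.left_inr,
      SemidirectProduct.right_inr, SemidirectProduct.left_inl, SemidirectProduct.right_inl,
      one_mul, map_one, mul_one, weylCoweightHom_ofIdx]
    rfl

theorem pr_demazure_mul (i : ι) (z : QAffineWeyl x) :
    pr x (demazure x i * z) = (ofAction x h1 h2).op (QRing x) (i, 0) (pr x z) := by
  rw [demazure, mul_assoc, pr_scalar_mul, sub_mul, one_mul, map_sub, pr_reflection_mul h1 h2, op,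
    ofAction_inv]

theorem pr_affineDemazure_mul (θ : ι) (z : QAffineWeyl x) :
    pr x (affineDemazure x θ * z) =
      (ofAction x h1 h2).op (QRing x) (P.reflectionPerm θ θ, 1) (pr x z) := by
  rw [affineDemazure, mul_assoc, pr_scalar_mul, sub_mul, one_mul, map_sub,
    pr_affineReflection_mul h1 h2, op, ofAction_inv]

theorem pr_k (a : QCorootLattice x) : pr x (k x a) = a := by
  induction a using AddMonoidAlgebra.induction_linear with
  | zero => simp
  | add a c ha hc => rw [map_add, map_add, ha, hc]
  | single l q => rw [k_single, pr_single]; rfl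

theorem k_injective : Function.Injective (k x) := Function.LeftInverse.injective pr_k

theorem pr_one : pr x 1 = 1 := by
  rw [SkewMonoidAlgebra.one_def, pr_single, AddMonoidAlgebra.one_def]
  rfl

variable {b : P.Base} {θ : ι}

/-- The map `pr` is not multiplicative but intertwines left multiplication by generators with the
operators. One inclusion is therefore an induction on z for all products z y; the other is the
minimality of `peterson`. -/
theorem image_pr_demazureAlgebra : pr x '' demazureAlgebra x b θ =
    ((ofAction x h1 h2).peterson (QRing x) b θ : Set (QCorootLattice x)) := by
  apply Set.Subset.antisymm
  · have key : ∀ z ∈ demazureAlgebra x b θ, ∀ y,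
        pr x y ∈ (ofAction x h1 h2).peterson (QRing x) b θ →
          pr x (z * y) ∈ (ofAction x h1 h2).peterson (QRing x) b θ := by
      intro z hz
      induction hz using Subring.closure_induction with
      | mem z hz =>
        intro y hy
        rcases hz with (⟨s, rfl⟩ | ⟨i, hi, rfl⟩) | rfl
        · rw [pr_scalar_mul, algebraMap_smul]
          exact Submodule.smul_mem _ _ hy
        · rw [pr_demazure_mul h1 h2]
          exact op_mem_peterson _ (Or.inl ⟨hi, rfl⟩) hy
        · rw [pr_affineDemazure_mul h1 h2]
          exact op_mem_peterson _ (Or.inr rfl) hy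
      | zero => intro y _; rw [zero_mul, map_zero]; exact zero_mem _
      | one => intro y hy; rwa [one_mul]
      | add z z' _ _ hz hz' =>
        intro y hy
        rw [add_mul, map_add]
        exact add_mem (hz y hy) (hz' y hy)
      | neg z _ hz =>
        intro y hy
        have : pr x (-z * y) = -pr x (z * y) :=
          (congrArg (pr x) (neg_mul z y)).trans (map_neg (pr x) (z * y))
        rw [this]
        exact neg_mem (hz y hy)
      | mul z z' _ _ hz hz' => intro y hy; rw [mul_assoc]; exact hz _ (hz' y hy)
    rintro _ ⟨z, hz, rfl⟩
    have := key z hz 1 (by rw [pr_one]; exact one_mem_peterson _)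
    rwa [mul_one] at this
  · let C : Submodule S (QCorootLattice x) :=
      { carrier := pr x '' demazureAlgebra x b θ
        zero_mem' := ⟨0, zero_mem _, map_zero _⟩
        add_mem' := by
          rintro _ _ ⟨z, hz, rfl⟩ ⟨y, hy, rfl⟩
          exact ⟨z + y, add_mem hz hy, map_add _ _ _⟩
        smul_mem' := by
          rintro s _ ⟨z, hz, rfl⟩
          refine ⟨scalar x (algebraMap S (QRing x) s) * z,
            mul_mem (Subring.subset_closure (Or.inl (Or.inl ⟨s, rfl⟩))) hz, ?_⟩
          rw [pr_scalar_mul, algebraMap_smul] }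
    have hle : (ofAction x h1 h2).peterson (QRing x) b θ ≤ C := by
      refine peterson_le _ ⟨1, one_mem _, pr_one⟩ ?_
      rintro r hr _ ⟨z, hz, rfl⟩
      rcases hr with ⟨hi, h0⟩ | rfl
      · obtain ⟨i, n⟩ := r
        obtain rfl : n = 0 := h0
        exact ⟨demazure x i * z,
          mul_mem (Subring.subset_closure (Or.inl (Or.inr ⟨i, hi, rfl⟩))) hz,
          pr_demazure_mul h1 h2 i z⟩
      · exact ⟨affineDemazure x θ * z, mul_mem (Subring.subset_closure (Or.inr rfl)) hz,
          pr_affineDemazure_mul h1 h2 θ z⟩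
    exact hle

end ReflDatum

end Action

end Peterson
end

-- Assembly of the Hopf algebra structure on the Peterson subalgebra.

noncomputable section

namespace Peterson

namespace ReflDatum

open AddMonoidAlgebra (single)
open TensorProduct

variable {ι M N : Type*} [AddCommGroup M] [AddCommGroup N] {P : RootPairing ι ℤ M N}
variable {S : Type*} [CommRing S]

section

variable (D : ReflDatum P S) (Q : Type*) [CommRing Q] [Algebra S Q] [IsLocalization D.denom Q]
  (b : P.Base) (θ : ι)

/-- The Peterson subalgebra of the group algebra of the coroot lattice, as an algebra over `S`. -/
def petersonAlg [Finite ι] [P.IsReduced] : Subalgebra S (AddMonoidAlgebra Q N) :=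
  (D.peterson Q b θ).toSubalgebra D.one_mem_peterson fun _ _ => D.mul_mem_peterson

end

variable [MulSemiringAction P.weylGroup S] {x : M →[P.weylGroup] S}
  (h1 : ∀ i s, x (P.root i) ∣ s - RootPairing.weylGroup.ofIdx P i • s)
  (h2 : ∀ i, x (P.root (P.reflectionPerm i i)) ∣ x (P.root i))
  [Finite ι] [P.IsReduced] (b : P.Base) (θ : ι)

/-- The Peterson subalgebra of the twisted group algebra, as a subring. -/
def petersonSubring : Subring (QAffineWeyl x) :=
  ((ofAction x h1 h2).petersonAlg (QRing x) b θ).toSubring.map (k x)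

theorem coe_petersonSubring : (petersonSubring h1 h2 b θ : Set (QAffineWeyl x)) =
    petersonSet x b θ := by
  rw [petersonSet, image_pr_demazureAlgebra h1 h2]
  rfl

/-- The isomorphism of the two forms of the Peterson subalgebra. -/
def petersonEquiv : (ofAction x h1 h2).petersonAlg (QRing x) b θ ≃+* petersonSubring h1 h2 b θ :=
  Subring.equivMapOfInjective ((ofAction x h1 h2).petersonAlg (QRing x) b θ).toSubring (k x)
    k_injective

/-- The Peterson subalgebra as an algebra over `S`. -/
abbrev petersonAlgebra : Algebra S (petersonSubring h1 h2 b θ) :=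
  ((petersonEquiv h1 h2 b θ : _ →+* petersonSubring h1 h2 b θ).comp
    (algebraMap S ((ofAction x h1 h2).petersonAlg (QRing x) b θ))).toAlgebra' fun s d => by
      obtain ⟨a, rfl⟩ := (petersonEquiv h1 h2 b θ).surjective d
      rw [RingHom.comp_apply]
      change petersonEquiv h1 h2 b θ _ * _ = _ * petersonEquiv h1 h2 b θ _
      rw [← map_mul, ← map_mul, mul_comm]

section

attribute [local instance] petersonAlgebra

/-- The isomorphism of the two forms of the Peterson subalgebra. -/
def petersonAlgEquiv :
    (ofAction x h1 h2).petersonAlg (QRing x) b θ ≃ₐ[S] petersonSubring h1 h2 b θ :=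
  AlgEquiv.ofRingEquiv (f := petersonEquiv h1 h2 b θ) fun _ => rfl

/-- The embedding of the Peterson subalgebra into the group algebra of the coroot lattice. -/
def petersonEmbedding : petersonSubring h1 h2 b θ →ₐ[S] QCorootLattice x :=
  (Subalgebra.val _).comp (petersonAlgEquiv h1 h2 b θ).symm.toAlgHom

theorem petersonEmbedding_petersonAlgEquiv (a : (ofAction x h1 h2).petersonAlg (QRing x) b θ) :
    petersonEmbedding h1 h2 b θ (petersonAlgEquiv h1 h2 b θ a) = a :=
  congrArg Subtype.val ((petersonAlgEquiv h1 h2 b θ).symm_apply_apply a)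

theorem petersonEmbedding_mem (d : petersonSubring h1 h2 b θ) :
    petersonEmbedding h1 h2 b θ d ∈ (ofAction x h1 h2).peterson (QRing x) b θ :=
  Subtype.prop ((petersonAlgEquiv h1 h2 b θ).symm d)

theorem exists_petersonEmbedding_eq {a : QCorootLattice x}
    (ha : a ∈ (ofAction x h1 h2).peterson (QRing x) b θ) :
    ∃ d, petersonEmbedding h1 h2 b θ d = a :=
  ⟨_, petersonEmbedding_petersonAlgEquiv h1 h2 b θ ⟨a, ha⟩⟩

theorem k_petersonEmbedding (d : petersonSubring h1 h2 b θ) :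
    k x (petersonEmbedding h1 h2 b θ d) = d :=
  congrArg Subtype.val ((petersonAlgEquiv h1 h2 b θ).apply_symm_apply d)

variable {b θ}

theorem exists_hopfDescent (hirr : IsIrreducibleDatum P) (hsc : IsSimplyConnectedDatum P)
    (hθ : IsHighestRoot b θ) (hinj : Function.Injective (algebraMap S (QRing x)))
    {c : N → QCorootLattice x}
    (hc : Submodule.span S (Set.range c) = (ofAction x h1 h2).peterson (QRing x) b θ)
    (hli : LinearIndependent (QRing x) c) (htop : Submodule.span (QRing x) (Set.range c) = ⊤) :
    ∃ (B : Module.Basis N S (petersonSubring h1 h2 b θ))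
      (C : Module.Basis N (QRing x) (QCorootLattice x)),
      HopfDescent (petersonEmbedding h1 h2 b θ) B C := by
  have hli' : LinearIndependent S c :=
    hli.restrict_scalars (by simpa [Algebra.smul_def] using hinj)
  let e : Submodule.span S (Set.range c) ≃ₗ[S] petersonSubring h1 h2 b θ :=
    (LinearEquiv.ofEq _ _ hc).trans (petersonAlgEquiv h1 h2 b θ).toLinearEquiv
  refine ⟨(Module.Basis.span hli').map e, Module.Basis.mk hli htop.ge, hinj, fun l => ?_,
    fun d => ?_, fun d => ?_, fun d => ?_⟩
  · rw [Module.Basis.mk_apply, Module.Basis.map_apply]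
    refine (petersonEmbedding_petersonAlgEquiv h1 h2 b θ _).trans ?_
    exact Module.Basis.coe_span_apply hli' l
  · obtain ⟨u, hu⟩ := comul_mem_petersonSquare (petersonEmbedding_mem h1 h2 b θ d)
    rw [← hu]
    clear hu
    induction u with
    | zero => rw [map_zero]; exact zero_mem _
    | add u v hu hv => rw [map_add]; exact add_mem hu hv
    | tmul a a' =>
      obtain ⟨d, hd⟩ := exists_petersonEmbedding_eq h1 h2 b θ a.2
      obtain ⟨d', hd'⟩ := exists_petersonEmbedding_eq h1 h2 b θ a'.2
      refine ⟨d ⊗ₜ d', ?_⟩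
      change petersonEmbedding h1 h2 b θ d ⊗ₜ petersonEmbedding h1 h2 b θ d' = _
      rw [hd, hd', tensorMap_tmul]
      rfl
  · obtain ⟨s, hs⟩ := counit_mem_range (petersonEmbedding_mem h1 h2 b θ d)
    exact ⟨s, hs.symm⟩
  · exact exists_petersonEmbedding_eq h1 h2 b θ
      (antipode_mem_peterson hirr hsc hθ (petersonEmbedding_mem h1 h2 b θ d))

theorem petersonIsHopf_of_basis (hirr : IsIrreducibleDatum P) (hsc : IsSimplyConnectedDatum P)
    (hθ : IsHighestRoot b θ) (hinj : Function.Injective (algebraMap S (QRing x)))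
    {c : N → QCorootLattice x}
    (hc : Submodule.span S (Set.range c) = (ofAction x h1 h2).peterson (QRing x) b θ)
    (hli : LinearIndependent (QRing x) c) (htop : Submodule.span (QRing x) (Set.range c) = ⊤) :
    PetersonIsHopf x b θ := by
  obtain ⟨B, C, h⟩ := exists_hopfDescent h1 h2 hirr hsc hθ hinj hc hli htop
  refine ⟨petersonSubring h1 h2 b θ, coe_petersonSubring h1 h2 b θ, h.hopfAlgebra,
    petersonEmbedding h1 h2 b θ, fun s => ?_, k_petersonEmbedding h1 h2 b θ, h.isHopfHom,
    h.injective_tensorSquare, fun l => ?_⟩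
  · change k x (algebraMap S (QCorootLattice x) s) = _
    rw [Algebra.algebraMap_eq_smul_one, ← algebraMap_smul (QRing x) s, AddMonoidAlgebra.one_def,
      AddMonoidAlgebra.smul_single, smul_eq_mul, mul_one, k_single, translation, ofAdd_zero,
      map_one, scalar]
  · obtain ⟨d, hd⟩ := exists_petersonEmbedding_eq h1 h2 b θ
      ((ofAction x h1 h2).single_mem_peterson (Q := QRing x) hirr hsc hθ l)
    obtain ⟨d', hd'⟩ := exists_petersonEmbedding_eq h1 h2 b θ
      ((ofAction x h1 h2).single_mem_peterson (Q := QRing x) hirr hsc hθ (-l))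
    refine ⟨d, d', ?_, ?_, ?_, ?_, ?_⟩
    · rw [← k_petersonEmbedding h1 h2 b θ d, hd, k_single]
      rfl
    · rw [← k_petersonEmbedding h1 h2 b θ d', hd', k_single]
      rfl
    -- The formulas for translations are those of 𝒬_{Q^∨}, read back through the injections of the
    -- tensor square, of S and of the subalgebra.
    · apply h.injective_tensorSquareHom
      refine (h.tensorSquareHom_comulHom d).trans ?_
      change _ = petersonEmbedding h1 h2 b θ d ⊗ₜ petersonEmbedding h1 h2 b θ d
      rw [hd]
      simp
    · apply h.injective
      refine (h.algebraMap_counitHom d).trans ?_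
      rw [hd]
      simp
    · apply h.injective_hom
      refine (h.apply_antipodeMap d).trans ?_
      rw [hd, hd']
      simp

theorem petersonIsHopf_of_isHom (hirr : IsIrreducibleDatum P) (hsc : IsSimplyConnectedDatum P)
    (hθ : IsHighestRoot b θ) [IsDomain S] (h0 : ∀ i, x (P.root i) ≠ 0) {T : Type*} [CommRing T]
    [IsDomain T] {E : ReflDatum P T} (hE : E.IsGood) {φ : T →+* S}
    (h : IsHom E (ofAction x h1 h2) φ) : PetersonIsHopf x b θ := by
  have hinj : Function.Injective (algebraMap S (QRing x)) := by
    refine IsLocalization.injective (QRing x) (M := rootSubmonoid x) (Submonoid.closure_le.2 ?_)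
    rintro _ ⟨i, rfl⟩
    exact mem_nonZeroDivisors_of_ne_zero (h0 i)
  obtain ⟨c, hc, hli, htop⟩ := h.exists_triangular (QRing x) hE hirr hsc hθ
  exact petersonIsHopf_of_basis h1 h2 hirr hsc hθ hinj hc hli htop

end

end ReflDatum

end Peterson
end

-- Rings attached to a lattice, and primality over the root lattice.

noncomputable section

namespace Peterson

section LatticeRing

/-- A ring with elements `x_μ` for the elements `μ` of a lattice, functorial for the endomorphisms
of the lattice, with the divisibilities which hold in formal group algebras. -/
structure LatticeRing (L A : Type*) [AddCommGroup L] [CommRing A] where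
  /-- The element `x_μ`. -/
  x : L → A
  /-- The endomorphism `x_μ ↦ x_{f μ}`. -/
  map : (L →+ L) → A →+* A
  map_x : ∀ f μ, map f (x μ) = x (f μ)
  map_id : ∀ z, map (AddMonoidHom.id L) z = z
  map_comp : ∀ f g z, map (f.comp g) z = map f (map g z)
  dvd_sub : ∀ γ f, (∀ μ, ∃ n : ℤ, f μ = μ - n • γ) → ∀ z, x γ ∣ z - map f z
  mul_dvd_add : ∀ γ, x γ * x (-γ) ∣ x γ + x (-γ)
  x_zero : x 0 = 0
  eq_zero : ∀ μ, x μ = 0 → μ = 0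

namespace LatticeRing

variable {L A : Type*} [AddCommGroup L] [CommRing A] (X : LatticeRing L A)

theorem x_neg_dvd (γ : L) : X.x (-γ) ∣ X.x γ :=
  (dvd_add_left dvd_rfl).1 ((Dvd.intro_left _ rfl).trans (X.mul_dvd_add γ))

section Basis

variable {κ : Type*} (B : Module.Basis κ ℤ L) (k : κ)

/-- The projection of the lattice which kills a basis element and fixes the others. -/
def killBasis : L →+ L :=
  AddMonoidHom.id L - ((zmultiplesHom L (B k)).comp (B.coord k).toAddMonoidHom)

theorem killBasis_apply (μ : L) : killBasis B k μ = μ - B.coord k μ • B k := rfl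

/-- The projection along B k fixes every element modulo x_{B k} and kills x_{B k}. The ideal
generated by x_{B k} is thus the kernel of an endomorphism, whence primality over a domain. -/
theorem x_basis_dvd_iff {z : A} : X.x (B k) ∣ z ↔ X.map (killBasis B k) z = 0 := by
  have h : X.map (killBasis B k) (X.x (B k)) = 0 := by
    rw [X.map_x, killBasis_apply, Module.Basis.coord_apply, Module.Basis.repr_self,
      Finsupp.single_eq_same, one_smul, sub_self, X.x_zero]
  constructor
  · rintro ⟨y, rfl⟩
    rw [map_mul, h, zero_mul]
  · intro hz
    have := X.dvd_sub (B k) (killBasis B k) (fun μ => ⟨_, rfl⟩) z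
    rwa [hz, sub_zero] at this

theorem prime_x_basis [IsDomain A] : Prime (X.x (B k)) := by
  refine ⟨fun h => B.ne_zero k (X.eq_zero _ h), fun h => ?_, fun y z h => ?_⟩
  · have := (X.x_basis_dvd_iff B k).1 (isUnit_iff_dvd_one.1 h)
    rw [map_one] at this
    exact one_ne_zero this
  · rw [x_basis_dvd_iff, map_mul, mul_eq_zero] at h
    rwa [x_basis_dvd_iff, x_basis_dvd_iff]

theorem eq_smul_of_x_basis_dvd {μ : L} (h : X.x (B k) ∣ X.x μ) : μ = B.coord k μ • B k := by
  rw [x_basis_dvd_iff, X.map_x] at h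
  exact sub_eq_zero.1 (X.eq_zero _ h)

end Basis

variable {ι M N : Type*} [AddCommGroup M] [AddCommGroup N] (P : RootPairing ι ℤ M N)
variable {f : L →+ M} {r : ι → L}

/-- A reflection of a sublattice of the weight lattice which contains the roots. -/
def latticeReflection (f : L →+ M) (r : ι → L) (i : ι) : L →+ L :=
  AddMonoidHom.id L - (zmultiplesHom L (r i)).comp ((P.coroot' i).toAddMonoidHom.comp f)

theorem latticeReflection_apply (i : ι) (μ : L) :
    latticeReflection P f r i μ = μ - P.coroot' i (f μ) • r i := rfl

variable (hr : ∀ i, f (r i) = P.root i)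

include hr in
theorem apply_latticeReflection (i : ι) (μ : L) :
    f (latticeReflection P f r i μ) = P.reflection i (f μ) := by
  rw [latticeReflection_apply, map_sub, map_zsmul, hr, RootPairing.reflection_apply]

variable (hf : Function.Injective f)

include hr hf in
theorem latticeReflection_root (i j : ι) :
    latticeReflection P f r i (r j) = r (P.reflectionPerm i j) :=
  hf (by rw [apply_latticeReflection P hr, hr, hr, RootPairing.root_reflectionPerm])

include hr hf in
theorem root_neg (i : ι) : r (P.reflectionPerm i i) = -r i :=
  hf (by rw [hr, map_neg, hr, RootPairing.root_reflectionPerm, RootPairing.reflection_apply_self])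

/-- The datum of reflections on the ring of a lattice. -/
def reflDatum : ReflDatum P A where
  x i := X.x (r i)
  σ i := X.map (latticeReflection P f r i)
  σ_x i j := by rw [X.map_x, latticeReflection_root P hr hf]
  σ_σ i s := by
    rw [← X.map_comp]
    convert X.map_id s using 3
    refine AddMonoidHom.ext fun μ => hf ?_
    rw [AddMonoidHom.comp_apply, apply_latticeReflection P hr, apply_latticeReflection P hr,
      RootPairing.reflection_same, AddMonoidHom.id_apply]
  σ_conj i j s := by
    rw [← X.map_comp, ← X.map_comp]
    congr 2
    refine AddMonoidHom.ext fun μ => hf ?_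
    simp only [AddMonoidHom.comp_apply, apply_latticeReflection P hr,
      RootPairing.reflection_reflectionPerm]
    rfl
  dvd_sub i := X.dvd_sub _ _ fun μ => ⟨_, rfl⟩
  neg_dvd i := by
    rw [root_neg P hr hf]
    exact X.x_neg_dvd _

/-- Simple roots are basis vectors, so their x_α are prime, and x_α divides x_β only if β is a
multiple of α, hence ±α because the datum is reduced. Other roots are reached by signs and simple
reflections, which act by automorphisms. -/
theorem isGood_reflDatum [Finite ι] [P.IsReduced] [IsDomain A] (b : P.Base) {κ : Type*}
    (B : Module.Basis κ ℤ L) (hB : ∀ i ∈ b.support, ∃ k, B k = r i) :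
    (X.reflDatum P hr hf).IsGood where
  prime i := by
    induction i using b.induction_reflect with
    | h₀ i ih =>
      have h : Associated ((X.reflDatum P hr hf).x i)
          ((X.reflDatum P hr hf).x (P.reflectionPerm i i)) :=
        associated_of_dvd_dvd (ReflDatum.dvd_neg i) ((X.reflDatum P hr hf).neg_dvd i)
      exact h.prime ih
    | h₁ i hi =>
      obtain ⟨k, hk⟩ := hB i hi
      change Prime (X.x (r i))
      rw [← hk]
      exact X.prime_x_basis B k
    | h₂ i j ih hj =>
      rw [← ReflDatum.σ_x]
      let e : A ≃+* A := RingEquiv.ofRingHom ((X.reflDatum P hr hf).σ j)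
        ((X.reflDatum P hr hf).σ j) (RingHom.ext ((X.reflDatum P hr hf).σ_σ j))
        (RingHom.ext ((X.reflDatum P hr hf).σ_σ j))
      exact (MulEquiv.prime_iff e.toMulEquiv).2 ih
  eq_or_eq i := by
    induction i using b.induction_reflect with
    | h₀ i ih =>
      intro j h
      rw [reflectionPerm_self_self]
      exact (ih j ((ReflDatum.dvd_neg i).trans h)).symm
    | h₁ i hi =>
      intro j h
      obtain ⟨k, hk⟩ := hB i hi
      change X.x (r i) ∣ X.x (r j) at h
      rw [← hk] at h
      have h1 := congrArg f (X.eq_smul_of_x_basis_dvd B k h)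
      rw [map_zsmul, hk, hr, hr] at h1
      have h2 : ¬ LinearIndependent ℤ ![P.root i, P.root j] := by
        intro h2
        have := (LinearIndependent.pair_iff.1 h2 (B.coord k (r j)) (-1) (by rw [← h1]; simp)).2
        norm_num at this
      rcases RootPairing.IsReduced.eq_or_eq_neg i j h2 with h3 | h3
      · exact Or.inl (P.root.injective h3.symm)
      · right
        apply P.root.injective
        rw [RootPairing.root_reflectionPerm, RootPairing.reflection_apply_self, h3, neg_neg]
    | h₂ i j ih hj =>
      intro m h
      have h1 := map_dvd ((X.reflDatum P hr hf).σ j) h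
      rw [ReflDatum.σ_x, ReflDatum.σ_x, RootPairing.reflectionPerm_self] at h1
      have h2 : P.reflectionPerm (P.reflectionPerm j i) (P.reflectionPerm j i) =
          P.reflectionPerm j (P.reflectionPerm i i) := by
        rw [reflectionPerm_reflectionPerm, RootPairing.reflectionPerm_self]
      rw [h2]
      rcases ih _ h1 with h3 | h3
      · exact Or.inl (by rw [← h3, RootPairing.reflectionPerm_self])
      · exact Or.inr (by rw [← h3, RootPairing.reflectionPerm_self])
  dvd_add i := by
    change X.x (r i) * X.x (r (P.reflectionPerm i i)) ∣ X.x (r i) + X.x (r (P.reflectionPerm i i))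
    rw [root_neg P hr hf]
    exact X.mul_dvd_add _

end LatticeRing

open ReflDatum LatticeRing

variable {ι M N : Type*} [AddCommGroup M] [AddCommGroup N] {P : RootPairing ι ℤ M N}

/-- The ring X over M supplies the reflection datum of S, but its x_α may fail to be prime. The ring
Y over the root lattice, with the base as a ℤ-basis, is good, and φ compares the two. -/
theorem petersonIsHopf_of_latticeRing [Finite ι] [P.IsReduced] (hirr : IsIrreducibleDatum P)
    (hsc : IsSimplyConnectedDatum P) {b : P.Base} {θ : ι} (hθ : IsHighestRoot b θ)
    {S : Type*} [CommRing S] [IsDomain S] [MulSemiringAction P.weylGroup S]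
    (x : M →[P.weylGroup] S) (X : LatticeRing M S) (hx : ∀ μ, X.x μ = x μ)
    (hsmul : ∀ (w : P.weylGroup) s, X.map (DistribSMul.toAddMonoidHom M w) s = w • s)
    {T : Type*} [CommRing T] [IsDomain T] (Y : LatticeRing (P.rootSpan ℤ) T) (φ : T →+* S)
    (hφx : ∀ μ, φ (Y.x μ) = X.x μ)
    (hφ : ∀ (g : P.rootSpan ℤ →+ P.rootSpan ℤ) (h : M →+ M), (∀ μ, (g μ : M) = h μ) →
      ∀ t, φ (Y.map g t) = X.map h (φ t)) : PetersonIsHopf x b θ := by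
  have h1 : ∀ i s, x (P.root i) ∣ s - RootPairing.weylGroup.ofIdx P i • s := by
    intro i s
    rw [← hx, ← hsmul]
    refine X.dvd_sub _ _ (fun μ => ⟨P.coroot' i μ, ?_⟩) s
    exact P.reflection_apply i μ
  have h2 : ∀ i, x (P.root (P.reflectionPerm i i)) ∣ x (P.root i) := by
    intro i
    rw [RootPairing.root_reflectionPerm, RootPairing.reflection_apply_self, ← hx, ← hx]
    exact X.x_neg_dvd _
  have h0 : ∀ i, x (P.root i) ≠ 0 := by
    intro i h
    rw [← hx] at h
    exact P.ne_zero i (X.eq_zero _ h)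
  have hr : ∀ i, (P.rootSpan ℤ).subtype.toAddMonoidHom (P.rootSpanMem ℤ i) = P.root i :=
    fun i => rfl
  have hE := Y.isGood_reflDatum P hr Subtype.val_injective b b.toWeightBasisInt
    fun i hi => ⟨⟨i, hi⟩, Subtype.ext (b.coe_toWeightBasisInt_apply ⟨i, hi⟩)⟩
  refine petersonIsHopf_of_isHom h1 h2 hirr hsc hθ h0 hE (φ := φ) ⟨fun i => ?_, fun i t => ?_⟩
  · change φ (Y.x _) = x (P.root i)
    rw [hφx, hx]
  · change φ (Y.map _ t) = RootPairing.weylGroup.ofIdx P i • φ t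
    rw [← hsmul]
    refine hφ _ _ (fun μ => ?_) t
    exact apply_latticeReflection P hr i μ

end LatticeRing

end Peterson
end

-- The connective case.

noncomputable section

namespace Peterson

namespace ConnectiveAlgebra

variable {R : Type*} [CommRing R] (c : R) {L L' : Type*} [AddCommGroup L] [AddCommGroup L']

theorem x_zero : x c (0 : L) = 0 :=
  Ideal.Quotient.eq_zero_iff_mem.2 (Ideal.subset_span (Or.inl rfl))

theorem x_add (μ ν : L) : x c (μ + ν) =
    x c μ + x c ν - algebraMap R (ConnectiveAlgebra c L) c * x c μ * x c ν :=
  Ideal.Quotient.eq.2 (Ideal.subset_span (Or.inr ⟨(μ, ν), rfl⟩))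

theorem x_add_x_neg (μ : L) : x c μ + x c (-μ) -
    algebraMap R (ConnectiveAlgebra c L) c * x c μ * x c (-μ) = 0 := by
  rw [← x_add, add_neg_cancel, x_zero]

section Lift

variable {A : Type*} [CommRing A] [Algebra R A] (p : L → A) (h0 : p 0 = 0)
  (hadd : ∀ μ ν, p (μ + ν) = p μ + p ν - algebraMap R A c * p μ * p ν)

/-- The universal property of the connective algebra. -/
def lift : ConnectiveAlgebra c L →ₐ[R] A :=
  Ideal.Quotient.liftₐ _ (MvPolynomial.aeval p) fun a ha => by
    have : connectiveIdeal c L ≤ RingHom.ker (MvPolynomial.aeval (R := R) p) := by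
      refine Ideal.span_le.2 ?_
      rintro _ (h | ⟨q, rfl⟩)
      · rw [Set.mem_singleton_iff.1 h, SetLike.mem_coe, RingHom.mem_ker, MvPolynomial.aeval_X, h0]
      · rw [SetLike.mem_coe, RingHom.mem_ker]
        simp [hadd]
    exact this ha

theorem lift_x (μ : L) : lift c p h0 hadd (x c μ) = p μ := by
  change MvPolynomial.aeval p (MvPolynomial.X μ) = p μ
  rw [MvPolynomial.aeval_X]

omit [CommRing A] [Algebra R A] in
theorem induction {q : ConnectiveAlgebra c L → Prop} (z : ConnectiveAlgebra c L)
    (h1 : ∀ a, q (algebraMap R _ a)) (h2 : ∀ y z, q y → q z → q (y + z))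
    (h3 : ∀ y μ, q y → q (y * x c μ)) : q z := by
  obtain ⟨z, rfl⟩ := Ideal.Quotient.mk_surjective z
  induction z using MvPolynomial.induction_on with
  | C a => exact h1 a
  | add y z hy hz => rw [map_add]; exact h2 _ _ hy hz
  | mul_X y μ hy => rw [map_mul]; exact h3 _ _ hy

variable {c} in
theorem algHom_ext {f g : ConnectiveAlgebra c L →ₐ[R] A} (h : ∀ μ, f (x c μ) = g (x c μ)) :
    f = g := by
  ext z
  induction z using induction with
  | h1 a => rw [AlgHom.commutes, AlgHom.commutes]
  | h2 y z hy hz => rw [map_add, map_add, hy, hz]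
  | h3 y μ hy => rw [map_mul, map_mul, hy, h]

end Lift

/-- The homomorphism of connective algebras induced by a homomorphism of lattices. -/
def latticeMap (f : L →+ L') : ConnectiveAlgebra c L →ₐ[R] ConnectiveAlgebra c L' :=
  lift c (fun μ => x c (f μ)) (by rw [map_zero, x_zero]) fun μ ν => by rw [map_add, x_add]

theorem latticeMap_x (f : L →+ L') (μ : L) : latticeMap c f (x c μ) = x c (f μ) := lift_x _ _ _ _ μ

theorem latticeMap_comp {L'' : Type*} [AddCommGroup L''] (f : L' →+ L'') (g : L →+ L')
    (z : ConnectiveAlgebra c L) : latticeMap c (f.comp g) z = latticeMap c f (latticeMap c g z) := by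
  have : latticeMap c (f.comp g) = (latticeMap c f).comp (latticeMap c g) :=
    algHom_ext fun μ => by simp [latticeMap_x]
  rw [this, AlgHom.comp_apply]

theorem latticeMap_id (z : ConnectiveAlgebra c L) : latticeMap c (AddMonoidHom.id L) z = z := by
  have : latticeMap c (AddMonoidHom.id L) = AlgHom.id R _ :=
    algHom_ext fun μ => by simp [latticeMap_x]
  rw [this, AlgHom.id_apply]

theorem mapHom_eq_latticeMap (f : L →+ L) (z : ConnectiveAlgebra c L) :
    mapHom c f z = latticeMap c f z := by
  induction z using induction with
  | h1 a =>
    rw [AlgHom.commutes]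
    change mapHom c f (Ideal.Quotient.mk _ (MvPolynomial.C a)) = _
    rw [mapHom_mk, MvPolynomial.rename_C]
    rfl
  | h2 y z hy hz => rw [map_add, map_add, hy, hz]
  | h3 y μ hy =>
    rw [map_mul, map_mul, hy, latticeMap_x]
    congr 1
    change mapHom c f (Ideal.Quotient.mk _ (MvPolynomial.X μ)) = _
    rw [mapHom_mk, MvPolynomial.rename_X]
    rfl

theorem x_dvd_x_neg (γ : L) : x c γ ∣ x c (-γ) := by
  refine ⟨algebraMap R _ c * x c (-γ) - 1, ?_⟩
  linear_combination x_add_x_neg c γ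

theorem x_dvd_x_smul (γ : L) (n : ℤ) : x c γ ∣ x c (n • γ) := by
  induction n using Int.induction_on with
  | zero => rw [zero_smul, x_zero]; exact dvd_zero _
  | succ n ih =>
    rw [add_smul, one_smul, x_add]
    exact dvd_sub (dvd_add ih dvd_rfl) (Dvd.intro_left _ rfl)
  | pred n ih =>
    rw [sub_smul, one_smul, sub_eq_add_neg, x_add]
    exact dvd_sub (dvd_add ih (x_dvd_x_neg c γ)) ((x_dvd_x_neg c γ).mul_left _)

theorem x_dvd_sub_latticeMap {γ : L} {f : L →+ L} (hf : ∀ μ, ∃ n : ℤ, f μ = μ - n • γ)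
    (z : ConnectiveAlgebra c L) : x c γ ∣ z - latticeMap c f z := by
  induction z using induction with
  | h1 a => rw [AlgHom.commutes, sub_self]; exact dvd_zero _
  | h2 y z hy hz => rw [map_add, add_sub_add_comm]; exact dvd_add hy hz
  | h3 y μ hy =>
    obtain ⟨n, hn⟩ := hf μ
    have h1 : x c γ ∣ x c μ - x c (f μ) := by
      rw [hn, sub_eq_add_neg μ, ← neg_smul, x_add]
      obtain ⟨t, ht⟩ := x_dvd_x_smul c γ (-n)
      rw [ht]
      exact ⟨-t + algebraMap R _ c * x c μ * t, by ring⟩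
    rw [map_mul, latticeMap_x]
    have : y * x c μ - latticeMap c f y * x c (f μ) =
        (y - latticeMap c f y) * x c μ + latticeMap c f y * (x c μ - x c (f μ)) := by ring
    rw [this]
    exact dvd_add (hy.mul_right _) (h1.mul_left _)

section Points

variable (A : Type*) [CommRing A] [Algebra R A]

/-- The group of points of the connective formal group law `x + y - c x y`: pairs of mutually
inverse elements. -/
@[ext]
structure Pt where
  /-- The point. -/
  val : A
  /-- Its inverse. -/
  inv : A
  add_sub : val + inv - algebraMap R A c * val * inv = 0

namespace Pt

variable {c A}

theorem ext_val {p q : Pt c A} (h : p.val = q.val) : p = q := by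
  refine Pt.ext h ?_
  have h1 := p.add_sub
  rw [h] at h1
  linear_combination (1 - algebraMap R A c * p.inv) * (h1 - q.add_sub) +
    algebraMap R A c * (p.inv - q.inv) * h1

instance : Add (Pt c A) where
  add p q := ⟨p.val + q.val - algebraMap R A c * p.val * q.val,
    p.inv + q.inv - algebraMap R A c * p.inv * q.inv, by
      linear_combination p.add_sub + q.add_sub - algebraMap R A c * q.add_sub * p.val -
        algebraMap R A c * q.add_sub * p.inv +
          algebraMap R A c ^ 2 * p.val * p.inv * q.add_sub - algebraMap R A c * p.add_sub * 0⟩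

instance : Zero (Pt c A) where
  zero := ⟨0, 0, by ring⟩

instance : Neg (Pt c A) where
  neg p := ⟨p.inv, p.val, by linear_combination p.add_sub⟩

theorem val_add (p q : Pt c A) :
    (p + q).val = p.val + q.val - algebraMap R A c * p.val * q.val := rfl

theorem inv_add (p q : Pt c A) :
    (p + q).inv = p.inv + q.inv - algebraMap R A c * p.inv * q.inv := rfl

theorem val_zero : (0 : Pt c A).val = 0 := rfl

theorem inv_zero : (0 : Pt c A).inv = 0 := rfl

instance : AddCommGroup (Pt c A) where
  add_assoc p q r := Pt.ext (by simp only [val_add]; ring) (by simp only [inv_add]; ring)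
  zero_add p := Pt.ext (by simp only [val_add, val_zero]; ring)
    (by simp only [inv_add, inv_zero]; ring)
  add_zero p := Pt.ext (by simp only [val_add, val_zero]; ring)
    (by simp only [inv_add, inv_zero]; ring)
  add_comm p q := Pt.ext (by simp only [val_add]; ring) (by simp only [inv_add]; ring)
  nsmul := nsmulRec
  zsmul := zsmulRec
  neg_add_cancel p := Pt.ext
    (show p.inv + p.val - algebraMap R A c * p.inv * p.val = 0 by
      linear_combination p.add_sub)
    (show p.val + p.inv - algebraMap R A c * p.val * p.inv = 0 from p.add_sub)

/-- Functoriality of points. -/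
def map {A' : Type*} [CommRing A'] [Algebra R A'] (f : A →ₐ[R] A') : Pt c A →+ Pt c A' where
  toFun p := ⟨f p.val, f p.inv, by
    have := congrArg f p.add_sub
    simpa only [map_sub, map_add, map_mul, map_zero, AlgHom.commutes] using this⟩
  map_zero' := Pt.ext (map_zero f) (map_zero f)
  map_add' p q := Pt.ext
    (by simp only [val_add, map_sub, map_add, map_mul, AlgHom.commutes])
    (by simp only [inv_add, map_sub, map_add, map_mul, AlgHom.commutes])

end Pt

/-- The tautological point. -/
def ptHom : L →+ Pt c (ConnectiveAlgebra c L) where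
  toFun μ := ⟨x c μ, x c (-μ), x_add_x_neg c μ⟩
  map_zero' := Pt.ext (x_zero c) (by
    change x c (-0 : L) = 0
    rw [neg_zero, x_zero])
  map_add' μ ν := Pt.ext (x_add c μ ν) (by
    change x c (-(μ + ν)) = _
    rw [neg_add, x_add]
    rfl)

variable {c A} in
/-- The homomorphism defined by a homomorphism from the lattice to the group of points. -/
def liftPt (p : L →+ Pt c A) : ConnectiveAlgebra c L →ₐ[R] A :=
  lift c (fun μ => (p μ).val) (by rw [map_zero]; rfl) fun μ ν => by rw [map_add]; rfl

variable {c A} in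
theorem liftPt_x (p : L →+ Pt c A) (μ : L) : liftPt p (x c μ) = (p μ).val := lift_x _ _ _ _ μ

end Points

section Domain

variable {κ : Type*}

variable (κ) in
/-- The multiplicative set of polynomials generated by the `1 - c X_i`. -/
def unitSubmonoid : Submonoid (MvPolynomial κ R) :=
  Submonoid.closure (Set.range fun i => 1 - MvPolynomial.C c * MvPolynomial.X i)

theorem one_sub_mul_X_ne_zero [Nontrivial R] (i : κ) :
    (1 - MvPolynomial.C c * MvPolynomial.X i : MvPolynomial κ R) ≠ 0 := by
  intro h
  have := congrArg (MvPolynomial.aeval (fun _ => (0 : R))) h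
  simp at this

theorem unitSubmonoid_le [IsDomain R] : unitSubmonoid c κ ≤ nonZeroDivisors (MvPolynomial κ R) := by
  refine Submonoid.closure_le.2 ?_
  rintro _ ⟨i, rfl⟩
  exact mem_nonZeroDivisors_of_ne_zero (one_sub_mul_X_ne_zero c i)

/-- The points with values the variables, in a localization of the polynomial ring. -/
def ptX (i : κ) : Pt c (Localization (unitSubmonoid c κ)) where
  val := algebraMap (MvPolynomial κ R) _ (MvPolynomial.X i)
  inv := -algebraMap (MvPolynomial κ R) _ (MvPolynomial.X i) * IsLocalization.mk' _ 1
    (⟨_, Submonoid.subset_closure ⟨i, rfl⟩⟩ : unitSubmonoid c κ)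
  add_sub := by
    have h := IsLocalization.mk'_spec' (Localization (unitSubmonoid c κ)) 1
      (⟨_, Submonoid.subset_closure ⟨i, rfl⟩⟩ : unitSubmonoid c κ)
    rw [map_sub, map_one, map_mul] at h
    have hc : algebraMap R (Localization (unitSubmonoid c κ)) c =
      algebraMap (MvPolynomial κ R) _ (MvPolynomial.C c) :=
        IsScalarTower.algebraMap_apply R (MvPolynomial κ R) _ c
    rw [hc]
    linear_combination -algebraMap (MvPolynomial κ R) (Localization (unitSubmonoid c κ))
      (MvPolynomial.X i) * h

variable (B : Module.Basis κ ℤ L)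

/-- The comparison of the connective algebra with a localization of a polynomial ring. -/
def toLocalization : ConnectiveAlgebra c L →ₐ[R] Localization (unitSubmonoid c κ) :=
  liftPt (B.constr ℤ (ptX c)).toAddMonoidHom

/-- The inverse of `toLocalization`. -/
def ofLocalization : Localization (unitSubmonoid c κ) →ₐ[R] ConnectiveAlgebra c L :=
  IsLocalization.liftAlgHom (M := unitSubmonoid c κ)
    (f := MvPolynomial.aeval (R := R) fun i => x c (B i)) (by
      rintro ⟨y, hy⟩
      induction hy using Submonoid.closure_induction with
      | mem y hy =>
        obtain ⟨i, rfl⟩ := hy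
        refine IsUnit.of_mul_eq_one (1 - algebraMap R _ c * x c (-B i)) ?_
        simp only [map_sub, map_one, map_mul, MvPolynomial.aeval_X, MvPolynomial.algHom_C]
        linear_combination -algebraMap R _ c * x_add_x_neg c (B i)
      | one => simp
      | mul y z _ _ hy hz => simpa only [map_mul] using hy.mul hz)

theorem ofLocalization_toLocalization (z : ConnectiveAlgebra c L) :
    ofLocalization c B (toLocalization c B z) = z := by
  have h : (Pt.map (ofLocalization c B)).comp (B.constr ℤ (ptX c)).toAddMonoidHom =
      ptHom c (L := L) := by
    have : ((Pt.map (ofLocalization c B)).comp (B.constr ℤ (ptX c)).toAddMonoidHom).toIntLinearMap =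
        (ptHom c (L := L)).toIntLinearMap := by
      refine B.ext fun i => Pt.ext_val ?_
      change ofLocalization c B (B.constr ℤ (ptX c) (B i)).val = x c (B i)
      rw [B.constr_basis]
      exact (IsLocalization.lift_eq _ _).trans (MvPolynomial.aeval_X _ i)
    exact AddMonoidHom.toIntLinearMap_injective this
  have h2 : (ofLocalization c B).comp (toLocalization c B) = AlgHom.id R _ :=
    algHom_ext fun μ => by
      rw [AlgHom.comp_apply, toLocalization, liftPt_x, AlgHom.id_apply]
      exact congrArg Pt.val (DFunLike.congr_fun h μ)
  exact DFunLike.congr_fun h2 z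

/-- The algebra embeds in the localisation of R[X_i] at the elements 1 - c X_i. These are inverted
because the formal inverse of X_i is -X_i/(1 - c X_i). -/
theorem isDomain [IsDomain R] {κ : Type*} (B : Module.Basis κ ℤ L) : IsDomain (ConnectiveAlgebra c L) :=
  have := IsLocalization.isDomain_localization (unitSubmonoid_le c (κ := κ))
  (Function.LeftInverse.injective (ofLocalization_toLocalization c B)).isDomain
    (toLocalization c B).toRingHom

end Domain

section Vanishing

/-- Over the dual numbers, x_ν ↦ (k-th coordinate of ν) ε respects the relations because ε² = 0
makes the formal group law additive. Characteristic 0 then detects every coordinate. -/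
theorem eq_zero_of_x_eq_zero [CharZero R] {κ : Type*} (B : Module.Basis κ ℤ L) {μ : L}
    (h : x c μ = 0) : μ = 0 := by
  refine B.ext_elem fun k => ?_
  let f : ConnectiveAlgebra c L →ₐ[R] DualNumber R :=
    lift c (fun μ => (B.coord k μ : ℤ) • DualNumber.eps) (by simp) fun μ ν => by
      have h2 : (DualNumber.eps : DualNumber R) * DualNumber.eps = 0 := DualNumber.eps_mul_eps
      simp only [map_add, add_smul, zsmul_eq_mul]
      linear_combination (algebraMap R (DualNumber R) c * (B.coord k μ : DualNumber R) *
        (B.coord k ν : DualNumber R)) * h2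
  have h1 := congrArg TrivSqZeroExt.snd (lift_x c _ _ _ μ : f (x c μ) = _)
  rw [h, map_zero, TrivSqZeroExt.snd_zero] at h1
  simpa using h1.symm

end Vanishing

/-- The connective algebra as a ring over a lattice. -/
def latticeRing [CharZero R] {κ : Type*} (B : Module.Basis κ ℤ L) :
    LatticeRing L (ConnectiveAlgebra c L) where
  x := x c
  map f := (latticeMap c f).toRingHom
  map_x := latticeMap_x c
  map_id := latticeMap_id c
  map_comp := latticeMap_comp c
  dvd_sub γ f hf z := x_dvd_sub_latticeMap c hf z
  mul_dvd_add γ := ⟨algebraMap R _ c, by linear_combination x_add_x_neg c γ⟩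
  x_zero := x_zero c
  eq_zero μ := eq_zero_of_x_eq_zero c B

end ConnectiveAlgebra

/-- N is generated by the finitely many coroots and is torsion-free as a submodule of the dual of M,
hence free of finite rank; M is its dual. -/
theorem finite_free_of_isSimplyConnectedDatum {ι M N : Type*} [Finite ι] [AddCommGroup M]
    [AddCommGroup N] {P : RootPairing ι ℤ M N} (hsc : IsSimplyConnectedDatum P) :
    Module.Finite ℤ M ∧ Module.Free ℤ M := by
  have h1 : Module.Finite ℤ N := ⟨hsc ▸ Submodule.fg_span (Set.finite_range _)⟩
  have h2 : Module.IsTorsionFree ℤ N := P.flip.toPerfPair.injective.moduleIsTorsionFree _ (by simp)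
  have h3 : Module.Free ℤ N := inferInstance
  have e := P.toPerfPair
  exact ⟨Module.Finite.equiv e.symm, Module.Free.of_equiv e.symm⟩

theorem petersonIsHopf_connective {ι M N : Type*} [Finite ι] [AddCommGroup M] [AddCommGroup N]
    {P : RootPairing ι ℤ M N} [P.IsReduced] (hirr : IsIrreducibleDatum P)
    (hsc : IsSimplyConnectedDatum P) {b : P.Base} {θ : ι} (hθ : IsHighestRoot b θ)
    {R : Type*} [CommRing R] [IsDomain R] [CharZero R] (c : R) :
    PetersonIsHopf (ConnectiveAlgebra.xHom c P.weylGroup) b θ := by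
  obtain ⟨_, _⟩ := finite_free_of_isSimplyConnectedDatum hsc
  have B := Module.Free.chooseBasis ℤ M
  have := ConnectiveAlgebra.isDomain c B
  have := ConnectiveAlgebra.isDomain c b.toWeightBasisInt
  refine petersonIsHopf_of_latticeRing hirr hsc hθ _ (ConnectiveAlgebra.latticeRing c B)
    (fun μ => rfl) (fun w s => (ConnectiveAlgebra.mapHom_eq_latticeMap c _ s).symm)
    (ConnectiveAlgebra.latticeRing c b.toWeightBasisInt)
    (ConnectiveAlgebra.latticeMap c (P.rootSpan ℤ).subtype.toAddMonoidHom).toRingHom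
    (ConnectiveAlgebra.latticeMap_x c _) fun g h hgh t => ?_
  change ConnectiveAlgebra.latticeMap c _ (ConnectiveAlgebra.latticeMap c g t) =
    ConnectiveAlgebra.latticeMap c h (ConnectiveAlgebra.latticeMap c _ t)
  rw [← ConnectiveAlgebra.latticeMap_comp, ← ConnectiveAlgebra.latticeMap_comp]
  congr 2
  exact AddMonoidHom.ext hgh

end Peterson
end

-- The case of a formal group law: divisibility of power series.

noncomputable section

namespace Peterson

section Divisibility

open MvPowerSeries

variable {R : Type*} [CommRing R] {σ τ : Type*} [Finite σ]

theorem X_none_dvd_sub_rename_killCompl (p : MvPowerSeries (Option τ) R) :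
    (X none : MvPowerSeries (Option τ) R) ∣
      p - rename Function.Embedding.some (killCompl Function.Embedding.some p) := by
  rw [X_dvd_iff]
  intro m hm
  have : m ∈ Set.range (Finsupp.embDomain (Function.Embedding.some : τ ↪ Option τ)) := by
    rw [Finsupp.mem_range_embDomain_iff]
    intro i hi
    cases i with
    | none => exact absurd hm (Finsupp.mem_support_iff.1 hi)
    | some i => exact ⟨i, rfl⟩
  obtain ⟨m, rfl⟩ := this
  rw [map_sub, coeff_embDomain_rename, coeff_killCompl, sub_self]

/-- Termwise division of an infinite sum is avoided by adjoining a variable t. With b = a + h d, the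
series f(a + t d) differs from its t-free part by a multiple of t. Specialising to t = 0 identifies
the t-free part as f(a), and t = h gives the claim. -/
theorem dvd_subst_sub_subst [Finite τ] {a b : σ → MvPowerSeries τ R} {h : MvPowerSeries τ R}
    (ha : ∀ i, IsNilpotent (constantCoeff (a i))) (hh : IsNilpotent (constantCoeff h))
    (hab : ∀ i, h ∣ b i - a i) (f : MvPowerSeries σ R) : h ∣ f.subst b - f.subst a := by
  choose d hd using hab
  let e : τ ↪ Option τ := Function.Embedding.some
  let E (t : MvPowerSeries τ R) : Option τ → MvPowerSeries τ R := fun i => i.elim t X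
  have hE : ∀ t, IsNilpotent (constantCoeff t) → HasSubst (E t) := fun t ht =>
    hasSubst_of_constantCoeff_nilpotent fun i => by
      cases i with
      | none => exact ht
      | some i => exact (constantCoeff_X (R := R) i).symm ▸ IsNilpotent.zero
  have hEr : ∀ t, IsNilpotent (constantCoeff t) → ∀ g : MvPowerSeries τ R,
      subst (E t) (rename e g) = g := fun t ht g => by
    rw [rename_eq_subst, subst_comp_subst_apply (HasSubst.X_comp _) (hE t ht)]
    have : (fun s => subst (E t) ((X ∘ e : τ → MvPowerSeries (Option τ) R) s)) = X :=
      funext fun s => subst_X (hE t ht) _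
    rw [this]
    exact congrFun subst_self g
  let q : σ → MvPowerSeries (Option τ) R := fun i => rename e (a i) + X none * rename e (d i)
  have hq : HasSubst q := hasSubst_of_constantCoeff_nilpotent fun i => by
    simpa [q] using ha i
  have hEq : ∀ t, IsNilpotent (constantCoeff t) →
      subst (E t) (f.subst q) = f.subst fun i => a i + t * d i := fun t ht => by
    rw [subst_comp_subst_apply hq (hE t ht)]
    congr 1
    funext i
    rw [subst_add (hE t ht), subst_mul (hE t ht), hEr t ht, hEr t ht, subst_X (hE t ht)]
    rfl
  obtain ⟨g, hg⟩ := X_none_dvd_sub_rename_killCompl (f.subst q)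
  have key : ∀ t, IsNilpotent (constantCoeff t) →
      (f.subst fun i => a i + t * d i) - killCompl e (f.subst q) = t * subst (E t) g := by
    intro t ht
    have := congrArg (subst (E t)) hg
    rw [subst_sub (hE t ht), subst_mul (hE t ht), hEq t ht, subst_X (hE t ht)] at this
    erw [hEr t ht] at this
    exact this
  have h0 := key 0 (by simp)
  have h1 := key h hh
  have hb : b = fun i => a i + h * d i := funext fun i => by linear_combination hd i
  simp only [zero_mul, add_zero] at h0
  rw [hb, eq_of_sub_eq_zero h0]
  exact ⟨_, h1⟩

end Divisibility

section FormalGroup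

open MvPowerSeries

variable {R : Type*} [CommRing R] (F : FormalGroup R)

theorem X_zero_dvd_sub : (X 0 : MvPowerSeries (Fin 2) R) ∣ F.toPowerSeries - X 1 := by
  have h := dvd_subst_sub_subst (a := ![0, X 1]) (b := ![X 0, X 1])
    (h := (X 0 : MvPowerSeries (Fin 2) R)) (by simp) (by simp) (by simp) F.toPowerSeries
  rw [F.zero_add (PowerSeries.HasSubst.X 1)] at h
  have h2 : (![X 0, X 1] : Fin 2 → MvPowerSeries (Fin 2) R) = X := by
    funext i; fin_cases i <;> rfl
  rwa [h2, subst_self] at h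

theorem X_one_dvd_sub : (X 1 : MvPowerSeries (Fin 2) R) ∣ F.toPowerSeries - X 0 := by
  have h := dvd_subst_sub_subst (a := ![X 0, 0]) (b := ![X 0, X 1])
    (h := (X 1 : MvPowerSeries (Fin 2) R)) (by simp) (by simp) (by simp) F.toPowerSeries
  rw [F.add_zero (PowerSeries.HasSubst.X 0)] at h
  have h2 : (![X 0, X 1] : Fin 2 → MvPowerSeries (Fin 2) R) = X := by
    funext i; fin_cases i <;> rfl
  rwa [h2, subst_self] at h

/-- F is congruent to Y modulo X and to X modulo Y, so what remains beyond X + Y is divisible by XY.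
The divisibilities between the x_μ rest on this shape. -/
theorem exists_eq_add_mul : ∃ G : MvPowerSeries (Fin 2) R,
    F.toPowerSeries = X 0 + X 1 + X 0 * X 1 * G := by
  obtain ⟨u, hu⟩ := X_zero_dvd_sub F
  have h1 : (X 1 : MvPowerSeries (Fin 2) R) ∣ u - 1 := by
    have h := X_one_dvd_sub F
    rw [X_dvd_iff] at h ⊢
    intro m hm
    have h2 : F.toPowerSeries - X 0 = X 1 + X 0 * (u - 1) := by linear_combination hu
    have h3 := h (Finsupp.single 0 1 + m) (by simp [hm])
    rw [h2, map_add, X_def (0 : Fin 2), coeff_add_monomial_mul, one_mul] at h3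
    rwa [X_dvd_iff.1 (dvd_refl (X 1)) _ (by simp [hm]), zero_add] at h3
  obtain ⟨G, hG⟩ := h1
  exact ⟨G, by linear_combination hu + X 0 * hG⟩

variable {κ : Type*}

theorem exists_subst_eq_add_mul {f g : MvPowerSeries κ R} (hf : PowerSeries.HasSubst f)
    (hg : PowerSeries.HasSubst g) : ∃ G : MvPowerSeries κ R,
    F.toPowerSeries.subst ![f, g] = f + g + f * g * G := by
  obtain ⟨G, hG⟩ := exists_eq_add_mul F
  have h : HasSubst ![f, g] := hasSubst_of_constantCoeff_nilpotent fun s => by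
    fin_cases s
    · exact hf
    · exact hg
  refine ⟨G.subst ![f, g], ?_⟩
  rw [hG, subst_add h, subst_add h, subst_mul h, subst_mul h, subst_X h, subst_X h]
  rfl

end FormalGroup

section PowerMap

open MvPowerSeries

variable {R : Type*} [CommRing R] (F : FormalGroup R) [F.IsComm]
  {L L' L'' : Type*} [AddCommGroup L] [AddCommGroup L'] [AddCommGroup L'']
  {κ κ' κ'' : Type*} (B : Module.Basis κ ℤ L) (B' : Module.Basis κ' ℤ L')
  (B'' : Module.Basis κ'' ℤ L'')

theorem hasSubst_xSeries_single (μ : L) : PowerSeries.HasSubst (xSeries F B μ) :=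
  hasSubst_pointVal F (point F B μ)

theorem xSeries_add_dvd (μ γ : L) :
    ∃ G, xSeries F B (μ + γ) = xSeries F B μ + xSeries F B γ + xSeries F B μ * xSeries F B γ * G := by
  rw [xSeries_add]
  exact exists_subst_eq_add_mul F (hasSubst_xSeries_single F B μ) (hasSubst_xSeries_single F B γ)

theorem xSeries_dvd_sub_of_dvd {γ ν : L} (h : xSeries F B γ ∣ xSeries F B ν) (μ : L) :
    xSeries F B γ ∣ xSeries F B (μ + ν) - xSeries F B μ := by
  obtain ⟨G, hG⟩ := xSeries_add_dvd F B μ ν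
  have : xSeries F B (μ + ν) - xSeries F B μ = xSeries F B ν * (1 + xSeries F B μ * G) := by
    linear_combination hG
  rw [this]
  exact h.mul_right _

theorem xSeries_mul_dvd (γ : L) : xSeries F B γ * xSeries F B (-γ) ∣
    xSeries F B γ + xSeries F B (-γ) := by
  obtain ⟨G, hG⟩ := xSeries_add_dvd F B γ (-γ)
  rw [add_neg_cancel, xSeries_zero] at hG
  exact ⟨-G, by linear_combination -hG⟩

theorem xSeries_dvd_neg (γ : L) : xSeries F B γ ∣ xSeries F B (-γ) :=
  (dvd_add_right dvd_rfl).1 ((Dvd.intro _ rfl).trans (xSeries_mul_dvd F B γ))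

theorem xSeries_dvd_smul (γ : L) (n : ℤ) : xSeries F B γ ∣ xSeries F B (n • γ) := by
  induction n using Int.induction_on with
  | zero => rw [zero_smul, xSeries_zero]; exact dvd_zero _
  | succ n ih =>
    rw [add_smul, one_smul]
    exact (dvd_sub_left ih).1 (xSeries_dvd_sub_of_dvd F B dvd_rfl _)
  | pred n ih =>
    rw [sub_smul, one_smul, sub_eq_add_neg]
    exact (dvd_sub_left ih).1 (xSeries_dvd_sub_of_dvd F B (xSeries_dvd_neg F B γ) _)

/-- Points of F are only required to have nilpotent constant coefficient; over a reduced ring it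
vanishes, so that linear coefficients become additive in μ. -/
theorem constantCoeff_xSeries [IsReduced R] (μ : L) : constantCoeff (xSeries F B μ) = 0 :=
  IsNilpotent.eq_zero (hasSubst_xSeries_single F B μ)

theorem coeff_single_mul_eq_zero {f g : MvPowerSeries κ R} (hf : constantCoeff f = 0)
    (hg : constantCoeff g = 0) (k : κ) : coeff (Finsupp.single k 1) (f * g) = 0 := by
  classical
  rw [coeff_mul, Finsupp.antidiagonal_single, Finset.sum_map]
  refine Finset.sum_eq_zero fun p hp => ?_
  have hp2 : p = (0, 1) ∨ p = (1, 0) := by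
    have := Finset.HasAntidiagonal.mem_antidiagonal.1 hp
    rcases p with ⟨p, q⟩
    simp only [Prod.mk.injEq] at this ⊢
    omega
  rcases hp2 with rfl | rfl
  · simp [hf]
  · simp [hg]

/-- The linear coefficients of the series `x_μ`. -/
def linearCoeff [IsReduced R] (k : κ) : L →+ R where
  toFun μ := coeff (Finsupp.single k 1) (xSeries F B μ)
  map_zero' := by rw [xSeries_zero, map_zero]
  map_add' μ ν := by
    obtain ⟨G, hG⟩ := xSeries_add_dvd F B μ ν
    rw [hG, map_add, map_add, mul_assoc, coeff_single_mul_eq_zero (constantCoeff_xSeries F B μ)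
      (by rw [map_mul, constantCoeff_xSeries, zero_mul]), add_zero]

theorem linearCoeff_eq [IsReduced R] (k : κ) (μ : L) : linearCoeff F B k μ = (B.coord k μ : R) := by
  have h : (linearCoeff F B k).toIntLinearMap =
      ((Int.castAddHom R).comp (B.coord k).toAddMonoidHom).toIntLinearMap := by
    classical
    refine B.ext fun i => ?_
    change coeff (Finsupp.single k 1) (xSeries F B (B i)) = (B.coord k (B i) : R)
    rw [xSeries_basis, coeff_X, B.coord_apply, B.repr_self, Finsupp.single_apply]
    simp [Finsupp.single_left_inj, eq_comm]
  exact DFunLike.congr_fun h μ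

theorem eq_zero_of_xSeries_eq_zero [IsReduced R] [CharZero R] {μ : L} (h : xSeries F B μ = 0) :
    μ = 0 := by
  refine B.ext_elem fun k => ?_
  have h1 := linearCoeff_eq F B k μ
  change coeff (Finsupp.single k 1) (xSeries F B μ) = _ at h1
  rw [h, map_zero] at h1
  simpa using h1.symm

/-- Substitution as a homomorphism of groups of points. -/
def pointSubst {a : κ → MvPowerSeries κ' R} (ha : HasSubst a) : F.Point κ →+ F.Point κ' where
  toFun p := pointMk F (subst a (pointVal F p)) (IsNilpotent_subst ha (hasSubst_pointVal F p))
  map_zero' := point_ext F (by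
    rw [pointVal_pointMk, pointVal_zero, pointVal_zero, ← substAlgHom_apply ha, map_zero])
  map_add' p q := by
    apply point_ext
    rw [pointVal_pointMk, pointVal_add F p q, pointVal_add, pointVal_pointMk, pointVal_pointMk]
    have h : HasSubst ![pointVal F p, pointVal F q] :=
      hasSubst_of_constantCoeff_nilpotent fun s => by
        fin_cases s
        · exact hasSubst_pointVal F p
        · exact hasSubst_pointVal F q
    rw [subst_comp_subst_apply h ha]
    congr 1
    funext s
    fin_cases s <;> rfl

variable [Finite κ]

theorem hasSubst_xSeries_map (f : L →+ L') : HasSubst fun i => xSeries F B' (f (B i)) :=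
  hasSubst_of_constantCoeff_nilpotent fun _ => hasSubst_xSeries_single F B' _

/-- The homomorphism of power series rings induced by a homomorphism of lattices. -/
def powerMap (f : L →+ L') : MvPowerSeries κ R →ₐ[R] MvPowerSeries κ' R :=
  substAlgHom (hasSubst_xSeries_map F B B' f)

theorem powerMap_apply (f : L →+ L') (z : MvPowerSeries κ R) :
    powerMap F B B' f z = subst (fun i => xSeries F B' (f (B i))) z :=
  substAlgHom_apply _ _

theorem powerMap_xSeries (f : L →+ L') (μ : L) :
    powerMap F B B' f (xSeries F B μ) = xSeries F B' (f μ) := by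
  have h : ((pointSubst F (hasSubst_xSeries_map F B B' f)).comp (point F B)).toIntLinearMap =
      ((point F B').comp f).toIntLinearMap := by
    refine B.ext fun i => point_ext F ?_
    change subst (fun i => xSeries F B' (f (B i))) (xSeries F B (B i)) = xSeries F B' (f (B i))
    rw [xSeries_basis]
    exact subst_X (hasSubst_xSeries_map F B B' f) i
  rw [powerMap_apply]
  exact congrArg (pointVal F) (DFunLike.congr_fun h μ)

theorem powerMap_id (z : MvPowerSeries κ R) : powerMap F B B (AddMonoidHom.id L) z = z := by
  rw [powerMap_apply]
  simp only [AddMonoidHom.id_apply, xSeries_basis]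
  exact congrFun subst_self z

theorem powerMap_comp [Finite κ'] (f : L' →+ L'') (g : L →+ L') (z : MvPowerSeries κ R) :
    powerMap F B B'' (f.comp g) z = powerMap F B' B'' f (powerMap F B B' g z) := by
  rw [powerMap_apply F B B', powerMap_apply F B' B'', powerMap_apply,
    subst_comp_subst_apply (hasSubst_xSeries_map F B B' g) (hasSubst_xSeries_map F B' B'' f)]
  congr 1
  funext i
  rw [← powerMap_apply, powerMap_xSeries]
  rfl

/-- Both terms are substitutions into the same series z, at the x_{B i} and at the x_{f(B i)}, and
these agree modulo x_γ because x_γ divides x_{nγ}. -/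
theorem xSeries_dvd_sub_powerMap {γ : L} {f : L →+ L} (hf : ∀ μ, ∃ n : ℤ, f μ = μ - n • γ)
    (z : MvPowerSeries κ R) : xSeries F B γ ∣ z - powerMap F B B f z := by
  have h := dvd_subst_sub_subst (a := fun i => xSeries F B (B i))
    (b := fun i => xSeries F B (f (B i))) (h := xSeries F B γ)
    (fun i => hasSubst_xSeries_single F B _) (hasSubst_xSeries_single F B γ) (fun i => by
      obtain ⟨n, hn⟩ := hf (B i)
      rw [hn, sub_eq_add_neg (B i), ← neg_smul]
      exact xSeries_dvd_sub_of_dvd F B (xSeries_dvd_smul F B γ _) _) z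
  rw [dvd_sub_comm, powerMap_apply]
  have h2 := powerMap_id F B z
  rw [powerMap_apply] at h2
  simp only [AddMonoidHom.id_apply] at h2
  rwa [h2] at h

instance [IsDomain R] : IsDomain (FormalGroupAlgebra F B) := by
  change IsDomain (MvPowerSeries κ R)
  exact NoZeroDivisors.to_isDomain _

/-- The formal group algebra as a ring over a lattice. -/
def powerLatticeRing [IsReduced R] [CharZero R] : LatticeRing L (FormalGroupAlgebra F B) where
  x := xSeries F B
  map f := (powerMap F B B f).toRingHom
  map_x := powerMap_xSeries F B B
  map_id := powerMap_id F B
  map_comp := powerMap_comp F B B B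
  dvd_sub _ _ hf := xSeries_dvd_sub_powerMap F B hf
  mul_dvd_add := xSeries_mul_dvd F B
  x_zero := xSeries_zero F B
  eq_zero _ := eq_zero_of_xSeries_eq_zero F B

end PowerMap

theorem petersonIsHopf_formalGroup {ι M N : Type*} [Finite ι] [AddCommGroup M] [AddCommGroup N]
    {P : RootPairing ι ℤ M N} [P.IsReduced] (hirr : IsIrreducibleDatum P)
    (hsc : IsSimplyConnectedDatum P) {b : P.Base} {θ : ι} (hθ : IsHighestRoot b θ)
    {R : Type*} [CommRing R] [IsDomain R] [CharZero R] (F : FormalGroup R) [F.IsComm]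
    {κ : Type*} [Finite κ] (B : Module.Basis κ ℤ M) :
    PetersonIsHopf (FormalGroupAlgebra.xHom F B P.weylGroup) b θ := by
  refine petersonIsHopf_of_latticeRing hirr hsc hθ _ (powerLatticeRing F B)
    (fun μ => rfl) (fun w s => rfl) (powerLatticeRing F b.toWeightBasisInt)
    (powerMap F b.toWeightBasisInt B (P.rootSpan ℤ).subtype.toAddMonoidHom).toRingHom
    (powerMap_xSeries F _ B _) fun g h hgh t => ?_
  exact (powerMap_comp F b.toWeightBasisInt b.toWeightBasisInt B _ g t).symm.trans
    ((congrArg (fun f => powerMap F b.toWeightBasisInt B f t) (AddMonoidHom.ext hgh)).trans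
      (powerMap_comp F b.toWeightBasisInt B B h _ t))

end Peterson
end

theorem mainTheorem6 {ι M N : Type*} [Finite ι] [AddCommGroup M] [AddCommGroup N]
    (P : RootPairing ι ℤ M N) [P.IsReduced]
    (hirr : Peterson.IsIrreducibleDatum P) (hsc : Peterson.IsSimplyConnectedDatum P)
    (b : P.Base) (θ : ι) (hθ : Peterson.IsHighestRoot b θ)
    (R : Type*) [CommRing R] [IsDomain R] [CharZero R] :
    (∀ (F : FormalGroup R) [F.IsComm] (κ : Type*) [Finite κ] (B : Module.Basis κ ℤ M),
      Peterson.PetersonIsHopf (Peterson.FormalGroupAlgebra.xHom F B P.weylGroup) b θ) ∧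
    (∀ c : R, Peterson.PetersonIsHopf (Peterson.ConnectiveAlgebra.xHom c P.weylGroup) b θ) :=
  ⟨fun F _ _ _ B => Peterson.petersonIsHopf_formalGroup hirr hsc hθ F B,
    fun c => Peterson.petersonIsHopf_connective hirr hsc hθ c⟩
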